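/- **Setting.** Let $(M,\widetilde g)$ be a smooth Riemannian manifold of dimension $m$, let $f:\mathbb R\to(0,\infty)$ be smooth, and let $N=\mathbb R\times M$ carry the Lorentzian metric $\overline g=-dt^2+f(t)^2\widetilde g$. For a space-like immersion $F:M\to N$ (that is, $g=F^*\overline g$ is Riemannian) let $\mu$ be the unit normal with $\overline g(\mu,\mu)=-1$ and $-\overline g(\partial_t,\mu)>0$, and let $$h(X,Y)=\overline g\bigl(\nabla^{F^*TN}_X(DF(Y))-DF(\nabla_XY),\mu\bigr),\qquad H=\operatorname{tr}_g h=g^{ij}h_{ij}$$ be its scalar second fundamental form and its mean curvature. $\nabla$, $\|\cdot\|$ and $\Delta=-\operatorname{div}\nabla$ refer to the induced metric $g$, and $\operatorname{Ric}^N$ is the Ricci tensor of $\overline g$ (with the sign for which $\operatorname{Ric}^N(\partial_t,\partial_t)=-m f''/f$). Let $\mathcal H\in C^1(M)$ and $T>0$, and let $F(s):M\to N$, $s\in[0,T]$, be space-like immersions (for instance embeddings onto graphs of functions $\hat u(s):M\to\mathbb R$) that solve the prescribed mean curvature flow $$\partial_sF(p,s)=-\bigl(H(p,s)-\mathcal H(p)\bigr)\,\mu(p,s),\qquad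 p\in M,\ s\in[0,T],$$ such that each $F(s)$ is $C^3$ and, in local coordinates, $F$ and its spatial derivatives up to order three are continuous on $M\times[0,T]$; derivatives in $s$ at $s=0,T$ are one-sided. Let $u=t\circ F$ be the height function (so $u(p,s)$ is the value of $\hat u(s)$ at the $M$-component of $F(p,s)$ in the graphical case), and let $v=-\overline g(\partial_t,\mu)$ be the gradient function, both regarded as functions of $(p,s)\in M\times[0,T]$. **Theorem.** For every $s\in[0,T]$ the function $v(\cdot,s)$ is $C^2$ on $M$, $v$ is differentiable in $s$, and on $M\times[0,T]$ $$\begin{aligned} (\partial_s+\Delta)v=&-\|h\|^2v-\operatorname{Ric}^N(\mu,\mu)\,v-2\frac{f'(u)}{f(u)}H+\frac{f'(u)}{f(u)}\mathcal H-V(\mathcal H)\\ &-\frac{f'(u)}{f(u)}\mathcal H\,v^2+2\frac{f'(u)}{f(u)}\,g(\nabla u,\nabla v)-m\frac{f''(u)}{f(u)}v\\ &-\Bigl(\frac{f'(u)}{f(u)}\Bigr)^2\|\nabla u\|^2v+\frac{f''(u)}{f(u)}\|\nabla u\|^2v-m\Bigl(\frac{f'(u)}{f(u)}\Bigr)^2v,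 \end{aligned}$$ where $V=g^{ij}\,\overline g(\partial_t,DF(\partial_i))\,\partial_j$ is the vector field on $M$ for which $DF(V)$ is the tangential part of $\partial_t$. -/

import Mathlib

open scoped Manifold ContDiff

noncomputable section

namespace GRW

/-! ## Semi-Riemannian geometry in coordinates

A metric is given on (an open part of) `ℝ^ι` by the matrix `G` of its components. -/

section Coordinates

variable {ι : Type*} [Fintype ι] [DecidableEq ι]

/-- The partial derivative `∂_i w`. -/
def pd (i : ι) (w : EuclideanSpace ℝ ι → ℝ) (x : EuclideanSpace ℝ ι) : ℝ :=
  fderiv ℝ w x (EuclideanSpace.single i 1)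

/-- The Christoffel symbol `Γ^k_{ij}` of the Levi-Civita connection of `G`. -/
def christoffel (G : EuclideanSpace ℝ ι → Matrix ι ι ℝ) (k i j : ι)
    (x : EuclideanSpace ℝ ι) : ℝ :=
  (1 / 2) * ∑ l, (G x)⁻¹ k l *
    (pd i (fun y => G y j l) x + pd j (fun y => G y i l) x - pd l (fun y => G y i j) x)

/-- The component `R_{αβγ}^δ` of the Riemann curvature tensor,
`R(∂_α, ∂_β) ∂_γ = R_{αβγ}^δ ∂_δ`, where `R(X, Y) = [∇_X, ∇_Y] - ∇_{[X, Y]}`. -/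
def riemann (G : EuclideanSpace ℝ ι → Matrix ι ι ℝ) (α β γ δ : ι)
    (x : EuclideanSpace ℝ ι) : ℝ :=
  pd α (christoffel G δ β γ) x - pd β (christoffel G δ α γ) x
    + ∑ η, (christoffel G η β γ x * christoffel G δ α η x
      - christoffel G η α γ x * christoffel G δ β η x)

/-- The component `Ric(∂_α, ∂_β) = R_{δαβ}^δ` of the Ricci tensor. -/
def ricci (G : EuclideanSpace ℝ ι → Matrix ι ι ℝ) (α β : ι) (x : EuclideanSpace ℝ ι) : ℝ :=
  ∑ δ, riemann G δ α β δ x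

/-- The inner product `G(X, Y)` at `x` of two vectors given by their components. -/
def pairing (G : EuclideanSpace ℝ ι → Matrix ι ι ℝ) (x : EuclideanSpace ℝ ι) (X Y : ι → ℝ) : ℝ :=
  ∑ i, ∑ j, G x i j * X i * Y j

/-- The components `(∇w)^k = G^{kl} ∂_l w` of the gradient. -/
def grad (G : EuclideanSpace ℝ ι → Matrix ι ι ℝ) (w : EuclideanSpace ℝ ι → ℝ)
    (x : EuclideanSpace ℝ ι) (k : ι) : ℝ :=
  ∑ l, (G x)⁻¹ k l * pd l w x

/-- The divergence `∂_i X^i + Γ^i_{ij} X^j` of a vector field given by its components. -/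
def divergence (G : EuclideanSpace ℝ ι → Matrix ι ι ℝ) (X : EuclideanSpace ℝ ι → ι → ℝ)
    (x : EuclideanSpace ℝ ι) : ℝ :=
  ∑ i, (pd i (fun y => X y i) x + ∑ j, christoffel G i i j x * X x j)

/-- The positive Laplace-Beltrami operator `Δ w = - div (∇ w)`. -/
def laplacian (G : EuclideanSpace ℝ ι → Matrix ι ι ℝ) (w : EuclideanSpace ℝ ι → ℝ)
    (x : EuclideanSpace ℝ ι) : ℝ :=
  - divergence G (grad G w) x

end Coordinates

/-! ## Charts of `M` and of the space-time `N = ℝ × M` -/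

section Charts

variable {m : ℕ} {M : Type*} [TopologicalSpace M] [ChartedSpace (EuclideanSpace ℝ (Fin m)) M]

/-- The tangent space `T_{(t, x)} N = ℝ × T_x M` of `N = ℝ × M`. -/
abbrev TN (n : ℝ × M) : Type := TangentSpace (𝓘(ℝ, ℝ).prod (𝓡 m)) n

/-- The vector `a ∂_t + X` in `T_n N`, where `X` is tangent to `M`. -/
def mkTN (n : ℝ × M) (a : ℝ) (X : TangentSpace (𝓡 m) n.2) : TN (m := m) n :=
  ((a, X) : ℝ × EuclideanSpace ℝ (Fin m))

/-- The coefficient `a` of `a ∂_t + X` in `T_n N`. -/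
def timePart (n : ℝ × M) (W : TN (m := m) n) : ℝ :=
  (W : ℝ × EuclideanSpace ℝ (Fin m)).1

/-- The component `X` of `a ∂_t + X` in `T_n N`. -/
def spacePart (n : ℝ × M) (W : TN (m := m) n) : TangentSpace (𝓡 m) n.2 :=
  (W : ℝ × EuclideanSpace ℝ (Fin m)).2

/-- The vector field `∂_t` on `N`. -/
def dt (n : ℝ × M) : TN (m := m) n := mkTN n 1 0

/-- The coordinate vector `∂_i` on `M` of the chart `φ`, at the point with coordinates `y`. -/
def frame (φ : OpenPartialHomeomorph M (EuclideanSpace ℝ (Fin m)))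
    (y : EuclideanSpace ℝ (Fin m)) (i : Fin m) : TangentSpace (𝓡 m) (φ.symm y) :=
  mfderiv (𝓡 m) (𝓡 m) φ.symm y (EuclideanSpace.single i (1 : ℝ))

/-- The coordinates `(t, x^1, …, x^m)` on `N` given by a chart `ψ` of `M`; the index `0` is `t`. -/
def chartN (ψ : OpenPartialHomeomorph M (EuclideanSpace ℝ (Fin m))) (n : ℝ × M) :
    EuclideanSpace ℝ (Fin (m + 1)) :=
  WithLp.toLp 2 (Fin.cons n.1 (fun a => ψ n.2 a) : Fin (m + 1) → ℝ)

/-- The spatial coordinates `(x^1, …, x^m)` of `(t, x^1, …, x^m)`. -/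
def spaceCoord (z : EuclideanSpace ℝ (Fin (m + 1))) : EuclideanSpace ℝ (Fin m) :=
  WithLp.toLp 2 (fun a => z a.succ)

/-- The point of `N` with given coordinates. -/
def chartNInv (ψ : OpenPartialHomeomorph M (EuclideanSpace ℝ (Fin m)))
    (z : EuclideanSpace ℝ (Fin (m + 1))) : ℝ × M :=
  (z 0, ψ.symm (spaceCoord z))

/-- The coordinate frame `(∂_t, ∂_1, …, ∂_m)` of `TN`. -/
def frameN (ψ : OpenPartialHomeomorph M (EuclideanSpace ℝ (Fin m)))
    (z : EuclideanSpace ℝ (Fin (m + 1))) (α : Fin (m + 1)) : TN (m := m) (chartNInv ψ z) :=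
  Fin.cases (motive := fun _ => TN (m := m) (chartNInv ψ z)) (dt (chartNInv ψ z))
    (fun a => mkTN (chartNInv ψ z) 0 (frame ψ (spaceCoord z) a)) α

theorem frameN_zero (ψ : OpenPartialHomeomorph M (EuclideanSpace ℝ (Fin m)))
    (z : EuclideanSpace ℝ (Fin (m + 1))) : frameN ψ z 0 = dt (chartNInv ψ z) := rfl

theorem frameN_succ (ψ : OpenPartialHomeomorph M (EuclideanSpace ℝ (Fin m)))
    (z : EuclideanSpace ℝ (Fin (m + 1))) (a : Fin m) :
    frameN ψ z a.succ = mkTN (chartNInv ψ z) 0 (frame ψ (spaceCoord z) a) := rfl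

/-- The components `dx^a(X)` of a tangent vector `X` of `M` at `p` in the frame `∂_a` of `ψ`. -/
def componentsM (ψ : OpenPartialHomeomorph M (EuclideanSpace ℝ (Fin m))) (p : M)
    (X : TangentSpace (𝓡 m) p) : EuclideanSpace ℝ (Fin m) :=
  mfderiv (𝓡 m) (𝓡 m) ψ p X

/-- The components of a tangent vector of `N` in the coordinate frame `(∂_t, ∂_1, …, ∂_m)`. -/
def components (ψ : OpenPartialHomeomorph M (EuclideanSpace ℝ (Fin m))) (n : ℝ × M)
    (W : TN (m := m) n) : Fin (m + 1) → ℝ :=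
  Fin.cons (timePart n W) (fun a => componentsM ψ n.2 (spacePart n W) a)

/-- The differential `DF : T_p M → T_{F(p)} N`. -/
def D (F : M → ℝ × M) (p : M) (X : TangentSpace (𝓡 m) p) : TN (m := m) (F p) :=
  mfderiv (𝓡 m) (𝓘(ℝ, ℝ).prod (𝓡 m)) F p X

/-- The map `F : M → N` in the charts `φ` and `ψ`. -/
def localRep (φ ψ : OpenPartialHomeomorph M (EuclideanSpace ℝ (Fin m))) (F : M → ℝ × M)
    (y : EuclideanSpace ℝ (Fin m)) : EuclideanSpace ℝ (Fin (m + 1)) :=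
  chartN ψ (F (φ.symm y))

/-- A family `F(s) : M → N`, `s ∈ [0, T]`, of class `C^3` in space: each `F(s)` is `C^3`, and `F`
and its spatial derivatives of order up to three are continuous on `M × [0, T]`. No regularity in
`s` beyond this continuity is required. -/
structure IsSpatiallyC3 (T : ℝ) (F : ℝ → M → ℝ × M) : Prop where
  continuousOn : ContinuousOn (fun q : ℝ × M => F q.1 q.2) (Set.Icc 0 T ×ˢ Set.univ)
  contMDiff : ∀ s ∈ Set.Icc 0 T, ContMDiff (𝓡 m) (𝓘(ℝ, ℝ).prod (𝓡 m)) 3 (F s)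
  continuousOn_deriv : ∀ φ ∈ atlas (EuclideanSpace ℝ (Fin m)) M,
    ∀ ψ ∈ atlas (EuclideanSpace ℝ (Fin m)) M, ∀ k : ℕ, k ≤ 3 →
    ContinuousOn
      (fun q : ℝ × EuclideanSpace ℝ (Fin m) => iteratedFDeriv ℝ k (localRep φ ψ (F q.1)) q.2)
      {q | q.1 ∈ Set.Icc 0 T ∧ q.2 ∈ φ.target ∧ (F q.1 (φ.symm q.2)).2 ∈ ψ.source}

end Charts

/-! ## The metric `ḡ = -dt² + f(t)² g̃` on `N = ℝ × M` and the geometry of hypersurfaces -/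

section Hypersurfaces

variable {m : ℕ} {M : Type*} [TopologicalSpace M] [ChartedSpace (EuclideanSpace ℝ (Fin m)) M]
  [IsManifold (𝓡 m) ∞ M]

/-- The warped product metric `ḡ = -dt² + f(t)² g̃` on `N = ℝ × M`. -/
def warped (f : ℝ → ℝ)
    (gt : Bundle.ContMDiffRiemannianMetric (𝓡 m) ∞ (EuclideanSpace ℝ (Fin m))
      (fun x : M => TangentSpace (𝓡 m) x))
    (n : ℝ × M) (X Y : TN (m := m) n) : ℝ :=
  - (timePart n X * timePart n Y) + f n.1 ^ 2 * gt.inner n.2 (spacePart n X) (spacePart n Y)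

variable (f : ℝ → ℝ)
  (gt : Bundle.ContMDiffRiemannianMetric (𝓡 m) ∞ (EuclideanSpace ℝ (Fin m))
    (fun x : M => TangentSpace (𝓡 m) x))

/-- The components `ḡ_{αβ}` in the coordinates `(t, x^1, …, x^m)` given by `ψ`. -/
def ambientMatrix (ψ : OpenPartialHomeomorph M (EuclideanSpace ℝ (Fin m)))
    (z : EuclideanSpace ℝ (Fin (m + 1))) : Matrix (Fin (m + 1)) (Fin (m + 1)) ℝ :=
  Matrix.of fun α β => warped f gt (chartNInv ψ z) (frameN ψ z α) (frameN ψ z β)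

/-- The value `Ric^N(W, W')` of the Ricci tensor of `(N, ḡ)`, computed in the chart `ψ`. -/
def ricciN (ψ : OpenPartialHomeomorph M (EuclideanSpace ℝ (Fin m))) (n : ℝ × M)
    (W W' : TN (m := m) n) : ℝ :=
  ∑ α, ∑ β, ricci (ambientMatrix f gt ψ) α β (chartN ψ n) *
    components ψ n W α * components ψ n W' β

/-- The map `F` is a space-like immersion: `g = F^* ḡ` is positive definite. -/
def IsSpacelike (F : M → ℝ × M) : Prop :=
  ∀ (p : M) (X : TangentSpace (𝓡 m) p), X ≠ 0 → 0 < warped f gt (F p) (D F p X) (D F p X)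

/-- The section `μ` of `F^* TN` is the future directed unit normal of the hypersurface `F`. -/
structure IsUnitNormal (F : M → ℝ × M) (μ : (p : M) → TN (m := m) (F p)) : Prop where
  normal : ∀ (p : M) (X : TangentSpace (𝓡 m) p), warped f gt (F p) (μ p) (D F p X) = 0
  unit : ∀ p, warped f gt (F p) (μ p) (μ p) = -1
  future : ∀ p, 0 < - warped f gt (F p) (dt (F p)) (μ p)

/-- The gradient function `v = - ḡ(∂_t, μ)`. -/
def gradientFunction (F : M → ℝ × M) (μ : (p : M) → TN (m := m) (F p)) (p : M) : ℝ :=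
  - warped f gt (F p) (dt (F p)) (μ p)

/-- The components `g_{ij}` in the chart `φ` of the induced metric `g = F^* ḡ`. -/
def inducedMatrix (φ : OpenPartialHomeomorph M (EuclideanSpace ℝ (Fin m))) (F : M → ℝ × M)
    (y : EuclideanSpace ℝ (Fin m)) : Matrix (Fin m) (Fin m) ℝ :=
  Matrix.of fun i j => warped f gt (F (φ.symm y))
    (D F (φ.symm y) (frame φ y i)) (D F (φ.symm y) (frame φ y j))

/-- The components, in the coordinates of `N` given by `ψ`, of the second fundamental form
`II(∂_i, ∂_j) = ∇^{F^*TN}_{∂_i} (DF(∂_j)) - DF(∇_{∂_i} ∂_j)`, where `∂_i` belongs to `φ`. -/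
def secondFF (φ ψ : OpenPartialHomeomorph M (EuclideanSpace ℝ (Fin m))) (F : M → ℝ × M)
    (y : EuclideanSpace ℝ (Fin m)) (i j : Fin m) (γ : Fin (m + 1)) : ℝ :=
  pd i (pd j (fun x => localRep φ ψ F x γ)) y
    + ∑ α, ∑ β, christoffel (ambientMatrix f gt ψ) γ α β (localRep φ ψ F y) *
        pd i (fun x => localRep φ ψ F x α) y * pd j (fun x => localRep φ ψ F x β) y
    - ∑ k, christoffel (inducedMatrix f gt φ F) k i j y * pd k (fun x => localRep φ ψ F x γ) y

/-- The components `h_{ij} = ḡ(II(∂_i, ∂_j), μ)` of the scalar second fundamental form. -/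
def scalarFF (φ ψ : OpenPartialHomeomorph M (EuclideanSpace ℝ (Fin m))) (F : M → ℝ × M)
    (μ : (p : M) → TN (m := m) (F p)) (y : EuclideanSpace ℝ (Fin m)) (i j : Fin m) : ℝ :=
  pairing (ambientMatrix f gt ψ) (localRep φ ψ F y) (secondFF f gt φ ψ F y i j)
    (components ψ (F (φ.symm y)) (μ (φ.symm y)))

/-- The mean curvature `H = g^{ij} h_{ij}` at `p`, computed in charts `φ` of `M` at `p` and `ψ` of
`M` at the `M`-component of `F(p)`. -/
def meanCurvature (φ ψ : OpenPartialHomeomorph M (EuclideanSpace ℝ (Fin m))) (F : M → ℝ × M)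
    (μ : (p : M) → TN (m := m) (F p)) (p : M) : ℝ :=
  ∑ i, ∑ j, (inducedMatrix f gt φ F (φ p))⁻¹ i j * scalarFF f gt φ ψ F μ (φ p) i j

/-- The squared norm `‖h‖² = g^{ik} g^{jl} h_{ij} h_{kl}` at `p`, computed in charts. -/
def normSqFF (φ ψ : OpenPartialHomeomorph M (EuclideanSpace ℝ (Fin m))) (F : M → ℝ × M)
    (μ : (p : M) → TN (m := m) (F p)) (p : M) : ℝ :=
  ∑ i, ∑ j, ∑ k, ∑ l,
    (inducedMatrix f gt φ F (φ p))⁻¹ i k * (inducedMatrix f gt φ F (φ p))⁻¹ j l *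
      scalarFF f gt φ ψ F μ (φ p) i j * scalarFF f gt φ ψ F μ (φ p) k l

/-- The Laplacian `(Δ w)(p)` of `w : M → ℝ` with respect to `g = F^* ḡ`, with the sign convention
`Δ w = - div (∇ w)`, computed in the chart `φ`. -/
def laplacianM (φ : OpenPartialHomeomorph M (EuclideanSpace ℝ (Fin m))) (F : M → ℝ × M)
    (w : M → ℝ) (p : M) : ℝ :=
  laplacian (inducedMatrix f gt φ F) (fun y => w (φ.symm y)) (φ p)

/-- The inner product `g(∇ w, ∇ w')(p)` of two gradients with respect to `g = F^* ḡ`, computed in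
the chart `φ`. -/
def gradInner (φ : OpenPartialHomeomorph M (EuclideanSpace ℝ (Fin m))) (F : M → ℝ × M)
    (w w' : M → ℝ) (p : M) : ℝ :=
  pairing (inducedMatrix f gt φ F) (φ p)
    (grad (inducedMatrix f gt φ F) (fun y => w (φ.symm y)) (φ p))
    (grad (inducedMatrix f gt φ F) (fun y => w' (φ.symm y)) (φ p))

/-- The derivative `V(w)(p)` along the vector field `V = g^{ij} ḡ(∂_t, DF(∂_i)) ∂_j` on `M`, for
which `DF(V)` is the tangential part of `∂_t`, computed in the chart `φ`. -/
def tangentialDeriv (φ : OpenPartialHomeomorph M (EuclideanSpace ℝ (Fin m))) (F : M → ℝ × M)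
    (w : M → ℝ) (p : M) : ℝ :=
  ∑ i, ∑ j, (inducedMatrix f gt φ F (φ p))⁻¹ i j *
    warped f gt (F (φ.symm (φ p))) (dt (F (φ.symm (φ p))))
      (D F (φ.symm (φ p)) (frame φ (φ p) i)) *
    pd j (fun y => w (φ.symm y)) (φ p)

/-- The family `F(s)`, `s ∈ [0, T]`, of space-like immersions with future directed unit normals
`μ(s)` solves the prescribed mean curvature flow `∂_s F = -(H - 𝓗) μ`; as usual, the equation is
read in arbitrary local coordinates for the computation of `H`. At `s = 0` and `s = T` the
derivative is one-sided. -/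
structure IsPrescribedMCF (𝓗 : M → ℝ) (T : ℝ) (F : ℝ → M → ℝ × M)
    (μ : (s : ℝ) → (p : M) → TN (m := m) (F s p)) : Prop where
  regular : IsSpatiallyC3 (m := m) T F
  spacelike : ∀ s ∈ Set.Icc 0 T, IsSpacelike f gt (F s)
  unitNormal : ∀ s ∈ Set.Icc 0 T, IsUnitNormal f gt (F s) (μ s)
  flow : ∀ s ∈ Set.Icc 0 T, ∀ p : M, ∀ φ ∈ atlas (EuclideanSpace ℝ (Fin m)) M,
    ∀ ψ ∈ atlas (EuclideanSpace ℝ (Fin m)) M, p ∈ φ.source → (F s p).2 ∈ ψ.source →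
    HasMFDerivWithinAt 𝓘(ℝ, ℝ) (𝓘(ℝ, ℝ).prod (𝓡 m)) (fun σ => F σ p) (Set.Icc 0 T) s
      ((1 : ℝ →L[ℝ] ℝ).smulRight
        (-(meanCurvature f gt φ ψ (F s) (μ s) p - 𝓗 p) • μ s p))

end Hypersurfaces

end GRW

/-!
Fix a chart `φ` of `M` at the point in question and a chart `ψ` of `M` at the `M`-component of its
image. In these charts `N` carries a metric matrix `G`, the immersions become maps `Z(s, y)` into
`ℝ^(m+1)`, the normal becomes a vector `ν(s, y)` with components `ν^α`, and `v = ν^0` because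
`ḡ(∂_t, W) = -W^0`. The geometry of `N` enters only through `∇_X ∂_t = (f'/f) (X - dt(X) ∂_t)`
(`IsWarpedChart.gammaForm_time`) and its consequence `Ric^N(∂_t, ·) = -m (f''/f) dt`
(`IsWarpedChart.ricci_time`).

*Space.* Differentiating `v = -ḡ(∂_t, ν)` twice along the hypersurface gives its Hessian
(`IsHypersurface.hessian_normal_time`) in terms of `h`, of `u = Z^0` and of the time component of
`∇_i ∇_j ν`. Taking the trace, the time component of the rough Laplacian of `ν` remains. Its normal
part is `‖h‖² v`, and its tangential part is given by the traced Codazzi equation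
(`IsHypersurface.codazzi`), which produces `∇H` and `Ric^N(∇u, ν)`; since `∇u = v ν - ∂_t`, the
latter is `Ric^N(ν, ν) v + m (f''/f) v` by the value on `∂_t` found above. Hence the formula
`IsHypersurface.laplacian_normal_time` for `Δ v`, which contains `g(∇u, ∇H)`.

*Time.* If the hypersurface moves with velocity `ρ ν`, differentiating `ḡ(ν, ∂_i Z) = 0` and
`ḡ(ν, ν) = -1` determines the covariant derivative of `ν` in `s`, and
`∂_s v = -ρ (f'/f) (v² - 1) + g(∇u, ∇ρ)` (`IsHypersurface.deriv_normal_time`). With `ρ = -(H - 𝓗)`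
the terms `g(∇u, ∇H)` cancel in the sum, and `V = -∇u`.

*Regularity.* The flow is only assumed `C³` in space, with derivatives jointly continuous, and
differentiable in `s`. Since `v² = 1 + ‖∇u‖²`, the future directed unit normal is a smooth function
of the first order jet of `Z`, and so `v` is `C²`; likewise `H` is a smooth function of the second
order jet, so that `∂_i (ρ ν)` is jointly continuous. A mean value argument (`hasDerivWithinAt_pd`)
then allows `∂_s` and `∂_i` to be exchanged in `∂_s ∂_i Z`, hence the first order jet and with it
`ν` are differentiable in `s`.

The passage from `M` to these coordinates is `IsPrescribedMCF.exists_isLocalFlow`. Both charts stay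
fixed throughout, so the invariance of the coordinate expressions under a change of charts is not
needed.
-/

namespace GRW

set_option linter.unusedSectionVars false

/-! ### Calculus in coordinates -/

section Calculus

variable {ι κ : Type*} [Fintype ι] [DecidableEq ι] [Fintype κ] [DecidableEq κ]

theorem fderiv_eq_sum_pd (w : EuclideanSpace ℝ ι → ℝ) (z v : EuclideanSpace ℝ ι) :
    fderiv ℝ w z v = ∑ α, pd α w z * v α := by
  have h : v = ∑ α, v α • EuclideanSpace.single α (1 : ℝ) := by
    ext β
    simp [Finset.sum_apply, Pi.single_apply]
  conv_lhs => rw [h]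
  simp [pd, map_sum, mul_comm]

theorem hasDerivWithinAt_coord {c : ℝ → EuclideanSpace ℝ ι} {S : Set ℝ} {s : ℝ} {c' : ι → ℝ}
    (hc : ∀ α, HasDerivWithinAt (fun σ => c σ α) (c' α) S s) :
    HasDerivWithinAt c (WithLp.toLp 2 c') S s := by
  rw [hasDerivWithinAt_iff_hasFDerivWithinAt, hasFDerivWithinAt_euclidean]
  intro α
  have := (hc α).hasFDerivWithinAt
  convert! this using 1

theorem hasDerivWithinAt_comp_curve {w : EuclideanSpace ℝ ι → ℝ} {c : ℝ → EuclideanSpace ℝ ι}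
    {S : Set ℝ} {s : ℝ} {c' : ι → ℝ} (hw : DifferentiableAt ℝ w (c s))
    (hc : ∀ α, HasDerivWithinAt (fun σ => c σ α) (c' α) S s) :
    HasDerivWithinAt (fun σ => w (c σ)) (∑ α, pd α w (c s) * c' α) S s := by
  have h2 := hw.hasFDerivAt.comp_hasDerivWithinAt s (hasDerivWithinAt_coord hc)
  rw [fderiv_eq_sum_pd] at h2
  exact h2

theorem hasDerivAt_add_smul_single (y : EuclideanSpace ℝ κ) (i : κ) (t : ℝ) :
    HasDerivAt (fun σ : ℝ => y + σ • EuclideanSpace.single i (1 : ℝ))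
      (EuclideanSpace.single i (1 : ℝ)) t := by
  simpa using ((hasDerivAt_id t).smul_const (EuclideanSpace.single i (1 : ℝ))).const_add y

theorem hasDerivAt_line_of_differentiableAt {w : EuclideanSpace ℝ κ → ℝ} {y : EuclideanSpace ℝ κ}
    (i : κ) {t : ℝ} (hw : DifferentiableAt ℝ w (y + t • EuclideanSpace.single i (1 : ℝ))) :
    HasDerivAt (fun σ : ℝ => w (y + σ • EuclideanSpace.single i (1 : ℝ)))
      (pd i w (y + t • EuclideanSpace.single i (1 : ℝ))) t :=
  hw.hasFDerivAt.comp_hasDerivAt t (hasDerivAt_add_smul_single y i t)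

theorem hasDerivAt_line {w : EuclideanSpace ℝ κ → ℝ} {y : EuclideanSpace ℝ κ} (i : κ)
    (hw : DifferentiableAt ℝ w y) :
    HasDerivAt (fun σ : ℝ => w (y + σ • EuclideanSpace.single i (1 : ℝ))) (pd i w y) 0 := by
  simpa using hasDerivAt_line_of_differentiableAt (y := y) (t := 0) i (by simpa using hw)

theorem pd_eq_of_hasDerivAt_line {w : EuclideanSpace ℝ κ → ℝ} {y : EuclideanSpace ℝ κ} {i : κ}
    {a : ℝ} (hw : DifferentiableAt ℝ w y)
    (h : HasDerivAt (fun σ : ℝ => w (y + σ • EuclideanSpace.single i (1 : ℝ))) a 0) :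
    pd i w y = a :=
  (hasDerivAt_line i hw).unique h

theorem pd_congr {w w' : EuclideanSpace ℝ κ → ℝ} {y : EuclideanSpace ℝ κ} (i : κ)
    (h : w =ᶠ[nhds y] w') : pd i w y = pd i w' y := by
  rw [pd, pd, h.fderiv_eq]

theorem pd_const (i : κ) (a : ℝ) (y : EuclideanSpace ℝ κ) : pd i (fun _ => a) y = 0 := by
  simp [pd]

theorem pd_add {w w' : EuclideanSpace ℝ κ → ℝ} {y : EuclideanSpace ℝ κ} (i : κ)
    (h : DifferentiableAt ℝ w y) (h' : DifferentiableAt ℝ w' y) :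
    pd i (fun x => w x + w' x) y = pd i w y + pd i w' y := by
  simp [pd, fderiv_fun_add h h']

theorem pd_sub {w w' : EuclideanSpace ℝ κ → ℝ} {y : EuclideanSpace ℝ κ} (i : κ)
    (h : DifferentiableAt ℝ w y) (h' : DifferentiableAt ℝ w' y) :
    pd i (fun x => w x - w' x) y = pd i w y - pd i w' y := by
  simp [pd, fderiv_fun_sub h h']

theorem pd_neg (w : EuclideanSpace ℝ κ → ℝ) (y : EuclideanSpace ℝ κ) (i : κ) :
    pd i (fun x => -w x) y = -pd i w y := by
  simp [pd, fderiv_fun_neg]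

theorem pd_mul {w w' : EuclideanSpace ℝ κ → ℝ} {y : EuclideanSpace ℝ κ} (i : κ)
    (h : DifferentiableAt ℝ w y) (h' : DifferentiableAt ℝ w' y) :
    pd i (fun x => w x * w' x) y = pd i w y * w' y + w y * pd i w' y := by
  simp [pd, fderiv_fun_mul h h']
  ring

theorem pd_sum {τ : Type*} (S : Finset τ) {w : τ → EuclideanSpace ℝ κ → ℝ}
    {y : EuclideanSpace ℝ κ} (i : κ) (h : ∀ t ∈ S, DifferentiableAt ℝ (w t) y) :
    pd i (fun x => ∑ t ∈ S, w t x) y = ∑ t ∈ S, pd i (w t) y := by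
  simp [pd, fderiv_fun_sum h]

theorem pd_apply_id (i j : κ) (y : EuclideanSpace ℝ κ) :
    pd i (fun x => x j) y = if j = i then 1 else 0 := by
  have : HasFDerivAt (fun x : EuclideanSpace ℝ κ => x j)
      (EuclideanSpace.proj j : EuclideanSpace ℝ κ →L[ℝ] ℝ) y :=
    (EuclideanSpace.proj j : EuclideanSpace ℝ κ →L[ℝ] ℝ).hasFDerivAt
  rw [pd, this.fderiv]
  simp

theorem contDiffAt_pd {w : EuclideanSpace ℝ κ → ℝ} {y : EuclideanSpace ℝ κ} {n k : ℕ∞ω}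
    (i : κ) (hw : ContDiffAt ℝ n w y) (hk : k + 1 ≤ n) : ContDiffAt ℝ k (pd i w) y :=
  (hw.fderiv_right hk).clm_apply contDiffAt_const

theorem pd_pd_comm {w : EuclideanSpace ℝ κ → ℝ} {y : EuclideanSpace ℝ κ} (i j : κ)
    (hw : ContDiffAt ℝ 2 w y) : pd i (pd j w) y = pd j (pd i w) y := by
  have hd : DifferentiableAt ℝ (fderiv ℝ w) y :=
    (hw.fderiv_right (m := 1) (by norm_num)).differentiableAt (by norm_num)
  have key : ∀ a b : κ, pd a (pd b w) y
      = fderiv ℝ (fderiv ℝ w) y (EuclideanSpace.single a 1) (EuclideanSpace.single b 1) := by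
    intro a b
    unfold pd
    rw [fderiv_clm_apply hd (differentiableAt_const _)]
    simp
  rw [key, key]
  exact (hw.isSymmSndFDerivAt (by simp)).eq _ _

/-- The coordinate vector `∂_i Z` of a parametrized submanifold `Z`. -/
def velocity (Z : EuclideanSpace ℝ κ → EuclideanSpace ℝ ι) (i : κ) (y : EuclideanSpace ℝ κ) :
    ι → ℝ := fun α => pd i (fun x => Z x α) y

theorem velocity_id (i : ι) (y : EuclideanSpace ℝ ι) :
    velocity (fun x : EuclideanSpace ℝ ι => x) i y = Pi.single i 1 := by
  ext α
  simp [velocity, pd_apply_id, Pi.single_apply]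

theorem coord_differentiableAt {Z : EuclideanSpace ℝ κ → EuclideanSpace ℝ ι}
    {y : EuclideanSpace ℝ κ} (hZ : ∀ α, DifferentiableAt ℝ (fun x => Z x α) y) :
    DifferentiableAt ℝ Z y :=
  (differentiableAt_euclidean).2 hZ

theorem coord_contDiffAt {Z : EuclideanSpace ℝ κ → EuclideanSpace ℝ ι} {n : ℕ∞ω}
    {y : EuclideanSpace ℝ κ} (hZ : ∀ α, ContDiffAt ℝ n (fun x => Z x α) y) :
    ContDiffAt ℝ n Z y :=
  (contDiffAt_euclidean).2 hZ

theorem pd_comp {w : EuclideanSpace ℝ ι → ℝ} {Z : EuclideanSpace ℝ κ → EuclideanSpace ℝ ι}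
    {y : EuclideanSpace ℝ κ} (i : κ) (hw : DifferentiableAt ℝ w (Z y))
    (hZ : ∀ α, DifferentiableAt ℝ (fun x => Z x α) y) :
    pd i (fun x => w (Z x)) y = ∑ α, pd α w (Z y) * velocity Z i y α := by
  rw [pd, show (fun x => w (Z x)) = w ∘ Z from rfl,
    fderiv_comp y hw (coord_differentiableAt hZ), ContinuousLinearMap.comp_apply, fderiv_eq_sum_pd]
  refine Finset.sum_congr rfl fun α _ => ?_
  have := (EuclideanSpace.proj α : EuclideanSpace ℝ ι →L[ℝ] ℝ).hasFDerivAt.comp y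
    (coord_differentiableAt hZ).hasFDerivAt
  have e : velocity Z i y α = fderiv ℝ Z y (EuclideanSpace.single i 1) α := by
    rw [velocity, pd, show (fun x => Z x α)
      = (EuclideanSpace.proj α : EuclideanSpace ℝ ι →L[ℝ] ℝ) ∘ Z from rfl, this.fderiv]
    rfl
  rw [e]

end Calculus

/-! ### Bilinearity of the metric and of the Christoffel symbols -/

section Forms

variable {ι : Type*} [Fintype ι] [DecidableEq ι] (G : EuclideanSpace ℝ ι → Matrix ι ι ℝ)
  (z : EuclideanSpace ℝ ι)

theorem pairing_add_left (X X' Y : ι → ℝ) :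
    pairing G z (X + X') Y = pairing G z X Y + pairing G z X' Y := by
  simp only [pairing, Pi.add_apply, ← Finset.sum_add_distrib]
  exact Finset.sum_congr rfl fun i _ => Finset.sum_congr rfl fun j _ => by ring

theorem pairing_add_right (X Y Y' : ι → ℝ) :
    pairing G z X (Y + Y') = pairing G z X Y + pairing G z X Y' := by
  simp only [pairing, Pi.add_apply, ← Finset.sum_add_distrib]
  exact Finset.sum_congr rfl fun i _ => Finset.sum_congr rfl fun j _ => by ring

theorem pairing_smul_left (a : ℝ) (X Y : ι → ℝ) :
    pairing G z (a • X) Y = a * pairing G z X Y := by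
  simp only [pairing, Pi.smul_apply, smul_eq_mul, Finset.mul_sum]
  exact Finset.sum_congr rfl fun i _ => Finset.sum_congr rfl fun j _ => by ring

theorem pairing_smul_right (a : ℝ) (X Y : ι → ℝ) :
    pairing G z X (a • Y) = a * pairing G z X Y := by
  simp only [pairing, Pi.smul_apply, smul_eq_mul, Finset.mul_sum]
  exact Finset.sum_congr rfl fun i _ => Finset.sum_congr rfl fun j _ => by ring

/-- The pairing as a linear map in its first argument. -/
def pairingLeft (Y : ι → ℝ) : (ι → ℝ) →ₗ[ℝ] ℝ where
  toFun X := pairing G z X Y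
  map_add' X X' := pairing_add_left G z X X' Y
  map_smul' a X := pairing_smul_left G z a X Y

/-- The pairing as a linear map in its second argument. -/
def pairingRight (X : ι → ℝ) : (ι → ℝ) →ₗ[ℝ] ℝ where
  toFun Y := pairing G z X Y
  map_add' Y Y' := pairing_add_right G z X Y Y'
  map_smul' a Y := pairing_smul_right G z a X Y

theorem pairing_sub_left (X X' Y : ι → ℝ) :
    pairing G z (X - X') Y = pairing G z X Y - pairing G z X' Y :=
  map_sub (pairingLeft G z Y) X X'

theorem pairing_sub_right (X Y Y' : ι → ℝ) :
    pairing G z X (Y - Y') = pairing G z X Y - pairing G z X Y' :=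
  map_sub (pairingRight G z X) Y Y'

theorem pairing_zero_left (Y : ι → ℝ) : pairing G z 0 Y = 0 := map_zero (pairingLeft G z Y)

theorem pairing_zero_right (X : ι → ℝ) : pairing G z X 0 = 0 := map_zero (pairingRight G z X)

theorem pairing_sum_left {τ : Type*} (S : Finset τ) (X : τ → ι → ℝ) (Y : ι → ℝ) :
    pairing G z (∑ t ∈ S, X t) Y = ∑ t ∈ S, pairing G z (X t) Y :=
  map_sum (pairingLeft G z Y) X S

theorem pairing_sum_right {τ : Type*} (S : Finset τ) (X : ι → ℝ) (Y : τ → ι → ℝ) :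
    pairing G z X (∑ t ∈ S, Y t) = ∑ t ∈ S, pairing G z X (Y t) :=
  map_sum (pairingRight G z X) Y S

variable {G z} in
theorem pairing_comm (hG : (G z).IsSymm) (X Y : ι → ℝ) : pairing G z X Y = pairing G z Y X := by
  rw [pairing, pairing, Finset.sum_comm]
  refine Finset.sum_congr rfl fun i _ => Finset.sum_congr rfl fun j _ => ?_
  rw [hG.apply]
  ring

theorem pairing_single_right (X : ι → ℝ) (β : ι) :
    pairing G z X (Pi.single β 1) = ∑ α, G z α β * X α := by
  simp [pairing, Pi.single_apply]

variable {G z} in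
/-- A metric of nonzero determinant is nondegenerate. -/
theorem eq_zero_of_pairing_eq_zero (hdet : (G z).det ≠ 0) {X : ι → ℝ}
    (h : ∀ Y, pairing G z X Y = 0) : X = 0 := by
  refine Matrix.eq_zero_of_vecMul_eq_zero hdet (funext fun β => ?_)
  have := h (Pi.single β 1)
  rw [pairing_single_right] at this
  simpa [Matrix.vecMul, dotProduct, mul_comm] using this

/-- The vector `Γ^γ_{αβ} X^α Y^β`. -/
def gammaForm (X Y : ι → ℝ) : ι → ℝ :=
  fun γ => ∑ α, ∑ β, christoffel G γ α β z * X α * Y β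

theorem gammaForm_add_right (X Y Y' : ι → ℝ) :
    gammaForm G z X (Y + Y') = gammaForm G z X Y + gammaForm G z X Y' := by
  ext γ
  simp only [gammaForm, Pi.add_apply, ← Finset.sum_add_distrib]
  exact Finset.sum_congr rfl fun i _ => Finset.sum_congr rfl fun j _ => by ring

theorem gammaForm_smul_left (a : ℝ) (X Y : ι → ℝ) :
    gammaForm G z (a • X) Y = a • gammaForm G z X Y := by
  ext γ
  simp only [gammaForm, Pi.smul_apply, smul_eq_mul, Finset.mul_sum]
  exact Finset.sum_congr rfl fun i _ => Finset.sum_congr rfl fun j _ => by ring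

variable {G} in
theorem christoffel_symm (hG : ∀ x, (G x).IsSymm) (γ α β : ι) :
    christoffel G γ α β = christoffel G γ β α := by
  funext x
  simp only [christoffel]
  congr 1
  refine Finset.sum_congr rfl fun l _ => ?_
  have : (fun y => G y α β) = fun y => G y β α := funext fun y => (hG y).apply _ _
  rw [this]
  ring

variable {G} in
theorem gammaForm_comm (hG : ∀ x, (G x).IsSymm) (X Y : ι → ℝ) :
    gammaForm G z X Y = gammaForm G z Y X := by
  ext γ
  simp only [gammaForm]
  rw [Finset.sum_comm]
  refine Finset.sum_congr rfl fun i _ => Finset.sum_congr rfl fun j _ => ?_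
  rw [christoffel_symm hG γ i j]
  ring

variable {G z} in
theorem sum_mul_christoffel (hdet : (G z).det ≠ 0) (γ α β : ι) :
    ∑ δ, G z γ δ * christoffel G δ α β z
      = (1 / 2) * (pd α (fun y => G y β γ) z + pd β (fun y => G y α γ) z
          - pd γ (fun y => G y α β) z) := by
  set K : ι → ℝ := fun l => pd α (fun y => G y β l) z + pd β (fun y => G y α l) z
          - pd l (fun y => G y α β) z with hK
  have h1 : ∀ δ, christoffel G δ α β z = (1 / 2) * (Matrix.mulVec (G z)⁻¹ K) δ := fun δ => rfl
  have h2 : Matrix.mulVec (G z) (Matrix.mulVec (G z)⁻¹ K) = K := by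
    rw [Matrix.mulVec_mulVec, Matrix.mul_nonsing_inv _ (isUnit_iff_ne_zero.2 hdet),
      Matrix.one_mulVec]
  have h3 : ∑ δ, G z γ δ * (Matrix.mulVec (G z)⁻¹ K) δ = K γ := congrFun h2 γ
  simp_rw [h1, mul_left_comm _ (1 / 2 : ℝ), ← Finset.mul_sum, h3]
  rfl

variable {G z} in
/-- The Levi-Civita connection is metric, for the coordinate vector fields. -/
theorem pd_metric (hG : ∀ x, (G x).IsSymm) (hdet : (G z).det ≠ 0) (α β γ : ι) :
    pd α (fun y => G y β γ) z
      = ∑ δ, christoffel G δ α β z * G z δ γ + ∑ δ, christoffel G δ α γ z * G z β δ := by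
  have h1 := sum_mul_christoffel hdet γ α β
  have h2 := sum_mul_christoffel hdet β α γ
  have e1 : ∑ δ, christoffel G δ α β z * G z δ γ = ∑ δ, G z γ δ * christoffel G δ α β z :=
    Finset.sum_congr rfl fun δ _ => by rw [(hG z).apply δ γ]; ring
  have e2 : ∑ δ, christoffel G δ α γ z * G z β δ = ∑ δ, G z β δ * christoffel G δ α γ z :=
    Finset.sum_congr rfl fun δ _ => by ring
  have e3 : (fun y => G y γ β) = fun y => G y β γ := funext fun y => (hG y).apply _ _
  rw [e3] at h2
  rw [e1, e2, h1, h2]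
  ring

variable {G z} in
/-- Metric compatibility of the connection in the direction `V`, for constant `X` and `Y`. -/
theorem sum_pd_metric (hG : ∀ x, (G x).IsSymm) (hdet : (G z).det ≠ 0) (V X Y : ι → ℝ) :
    ∑ α, ∑ β, (∑ κ, pd κ (fun x => G x α β) z * V κ) * X α * Y β
      = pairing G z (gammaForm G z V X) Y + pairing G z X (gammaForm G z V Y) := by
  have hL : ∀ α β, (∑ κ, pd κ (fun x => G x α β) z * V κ) * X α * Y β
      = ∑ κ, ∑ δ, christoffel G δ κ α z * G z δ β * V κ * X α * Y β
        + ∑ κ, ∑ δ, christoffel G δ κ β z * G z α δ * V κ * X α * Y β := by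
    intro α β
    rw [← Finset.sum_add_distrib, Finset.sum_mul, Finset.sum_mul]
    refine Finset.sum_congr rfl fun κ _ => ?_
    rw [pd_metric hG hdet, add_mul, add_mul, add_mul]
    simp only [Finset.sum_mul]
  rw [Finset.sum_congr rfl fun α _ => Finset.sum_congr rfl fun β _ => hL α β]
  simp only [Finset.sum_add_distrib, pairing, gammaForm, Finset.mul_sum, Finset.sum_mul]
  congr 1
  · calc _ = ∑ α, ∑ β, ∑ δ, ∑ κ, christoffel G δ κ α z * G z δ β * V κ * X α * Y β :=
          Finset.sum_congr rfl fun α _ => Finset.sum_congr rfl fun β _ => Finset.sum_comm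
      _ = ∑ α, ∑ δ, ∑ β, ∑ κ, christoffel G δ κ α z * G z δ β * V κ * X α * Y β :=
          Finset.sum_congr rfl fun α _ => Finset.sum_comm
      _ = ∑ δ, ∑ α, ∑ β, ∑ κ, christoffel G δ κ α z * G z δ β * V κ * X α * Y β :=
          Finset.sum_comm
      _ = ∑ δ, ∑ β, ∑ α, ∑ κ, christoffel G δ κ α z * G z δ β * V κ * X α * Y β :=
          Finset.sum_congr rfl fun δ _ => Finset.sum_comm
      _ = ∑ δ, ∑ β, ∑ κ, ∑ α, christoffel G δ κ α z * G z δ β * V κ * X α * Y β :=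
          Finset.sum_congr rfl fun δ _ => Finset.sum_congr rfl fun β _ => Finset.sum_comm
      _ = _ := by
          refine Finset.sum_congr rfl fun δ _ => Finset.sum_congr rfl fun β _ =>
            Finset.sum_congr rfl fun κ _ => Finset.sum_congr rfl fun α _ => ?_
          ring
  · refine Finset.sum_congr rfl fun α _ => ?_
    calc _ = ∑ β, ∑ δ, ∑ κ, christoffel G δ κ β z * G z α δ * V κ * X α * Y β :=
          Finset.sum_congr rfl fun β _ => Finset.sum_comm
      _ = ∑ δ, ∑ β, ∑ κ, christoffel G δ κ β z * G z α δ * V κ * X α * Y β :=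
          Finset.sum_comm
      _ = ∑ δ, ∑ κ, ∑ β, christoffel G δ κ β z * G z α δ * V κ * X α * Y β :=
          Finset.sum_congr rfl fun δ _ => Finset.sum_comm
      _ = _ := by
          refine Finset.sum_congr rfl fun δ _ => Finset.sum_congr rfl fun β _ =>
            Finset.sum_congr rfl fun κ _ => ?_
          ring

end Forms

/-! ### The covariant derivative along a map -/

section Covariant

variable {ι κ : Type*} [Fintype ι] [DecidableEq ι] [Fintype κ] [DecidableEq κ]
  {G : EuclideanSpace ℝ ι → Matrix ι ι ℝ}

/-- Metric compatibility of the connection along a curve `c`, for vector fields `X` and `Y` along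
`c`; the derivatives may be one-sided. -/
theorem hasDerivWithinAt_pairing {c : ℝ → EuclideanSpace ℝ ι} {X Y : ℝ → ι → ℝ} {S : Set ℝ} {s : ℝ}
    {c' X' Y' : ι → ℝ} (hG : ∀ x, (G x).IsSymm) (hdet : (G (c s)).det ≠ 0)
    (hGd : ∀ α β, DifferentiableAt ℝ (fun x => G x α β) (c s))
    (hc : ∀ α, HasDerivWithinAt (fun σ => c σ α) (c' α) S s)
    (hX : ∀ α, HasDerivWithinAt (fun σ => X σ α) (X' α) S s)
    (hY : ∀ α, HasDerivWithinAt (fun σ => Y σ α) (Y' α) S s) :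
    HasDerivWithinAt (fun σ => pairing G (c σ) (X σ) (Y σ))
      (pairing G (c s) (X' + gammaForm G (c s) c' (X s)) (Y s)
        + pairing G (c s) (X s) (Y' + gammaForm G (c s) c' (Y s))) S s := by
  have h : HasDerivWithinAt (fun σ => pairing G (c σ) (X σ) (Y σ))
      (∑ α, ∑ β, (((∑ κ, pd κ (fun x => G x α β) (c s) * c' κ) * X s α + G (c s) α β * X' α)
        * Y s β + G (c s) α β * X s α * Y' β)) S s :=
    HasDerivWithinAt.fun_sum fun α _ => HasDerivWithinAt.fun_sum fun β _ =>
      ((hasDerivWithinAt_comp_curve (hGd α β) hc).mul (hX α)).mul (hY β)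
  convert h using 1
  rw [pairing_add_left, pairing_add_right]
  have e := sum_pd_metric hG hdet c' (X s) (Y s)
  have e2 : ∑ α, ∑ β, (((∑ κ, pd κ (fun x => G x α β) (c s) * c' κ) * X s α + G (c s) α β * X' α)
        * Y s β + G (c s) α β * X s α * Y' β)
      = ∑ α, ∑ β, (∑ κ, pd κ (fun x => G x α β) (c s) * c' κ) * X s α * Y s β
        + pairing G (c s) X' (Y s) + pairing G (c s) (X s) Y' := by
    simp only [pairing, ← Finset.sum_add_distrib]
    exact Finset.sum_congr rfl fun i _ => Finset.sum_congr rfl fun j _ => by ring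
  rw [e2, e]
  ring

variable (G) in
/-- The covariant derivative `∇_{∂_i} W` of a vector field `W` along the map `Z`. -/
def cov (Z : EuclideanSpace ℝ κ → EuclideanSpace ℝ ι) (i : κ)
    (W : EuclideanSpace ℝ κ → ι → ℝ) (y : EuclideanSpace ℝ κ) : ι → ℝ :=
  (fun γ => pd i (fun x => W x γ) y) + gammaForm G (Z y) (velocity Z i y) (W y)

theorem differentiableAt_pairing {Z : EuclideanSpace ℝ κ → EuclideanSpace ℝ ι}
    {X Y : EuclideanSpace ℝ κ → ι → ℝ} {y : EuclideanSpace ℝ κ}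
    (hGd : ∀ α β, DifferentiableAt ℝ (fun x => G x α β) (Z y))
    (hZ : ∀ α, DifferentiableAt ℝ (fun x => Z x α) y)
    (hX : ∀ α, DifferentiableAt ℝ (fun x => X x α) y)
    (hY : ∀ α, DifferentiableAt ℝ (fun x => Y x α) y) :
    DifferentiableAt ℝ (fun x => pairing G (Z x) (X x) (Y x)) y := by
  unfold pairing
  refine DifferentiableAt.fun_sum fun α _ => DifferentiableAt.fun_sum fun β _ => ?_
  exact (((hGd α β).comp y (coord_differentiableAt hZ)).mul (hX α)).mul (hY β)

/-- Metric compatibility of the covariant derivative along a map. -/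
theorem pd_pairing {Z : EuclideanSpace ℝ κ → EuclideanSpace ℝ ι}
    {X Y : EuclideanSpace ℝ κ → ι → ℝ} {y : EuclideanSpace ℝ κ} (i : κ)
    (hG : ∀ x, (G x).IsSymm) (hdet : (G (Z y)).det ≠ 0)
    (hGd : ∀ α β, DifferentiableAt ℝ (fun x => G x α β) (Z y))
    (hZ : ∀ α, DifferentiableAt ℝ (fun x => Z x α) y)
    (hX : ∀ α, DifferentiableAt ℝ (fun x => X x α) y)
    (hY : ∀ α, DifferentiableAt ℝ (fun x => Y x α) y) :
    pd i (fun x => pairing G (Z x) (X x) (Y x)) y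
      = pairing G (Z y) (cov G Z i X y) (Y y) + pairing G (Z y) (X y) (cov G Z i Y y) := by
  refine pd_eq_of_hasDerivAt_line (differentiableAt_pairing hGd hZ hX hY) ?_
  have h0 : y + (0 : ℝ) • EuclideanSpace.single i (1 : ℝ) = y := by simp
  have key := hasDerivWithinAt_pairing (G := G) (S := Set.univ) (s := 0)
    (c := fun σ => Z (y + σ • EuclideanSpace.single i (1 : ℝ)))
    (X := fun σ => X (y + σ • EuclideanSpace.single i (1 : ℝ)))
    (Y := fun σ => Y (y + σ • EuclideanSpace.single i (1 : ℝ)))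
    (c' := velocity Z i y) (X' := fun γ => pd i (fun x => X x γ) y)
    (Y' := fun γ => pd i (fun x => Y x γ) y) hG (by simpa using hdet) (by simpa using hGd)
    (fun α => (hasDerivAt_line i (hZ α)).hasDerivWithinAt)
    (fun α => (hasDerivAt_line i (hX α)).hasDerivWithinAt)
    (fun α => (hasDerivAt_line i (hY α)).hasDerivWithinAt)
  rw [hasDerivWithinAt_univ] at key
  simp only [h0] at key
  exact key

/-- The connection is torsion free. -/
theorem cov_velocity_comm {Z : EuclideanSpace ℝ κ → EuclideanSpace ℝ ι} {y : EuclideanSpace ℝ κ}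
    (hG : ∀ x, (G x).IsSymm) (hZ : ∀ α, ContDiffAt ℝ 2 (fun x => Z x α) y) (i j : κ) :
    cov G Z i (velocity Z j) y = cov G Z j (velocity Z i) y := by
  rw [cov, cov, gammaForm_comm (Z y) hG]
  congr 1
  funext γ
  exact pd_pd_comm i j (hZ γ)

variable (G) in
/-- The derivative `∂_V Γ^δ_{αβ} X^α Y^β` of the Christoffel symbols in the direction `V`. -/
def gammaDeriv (z : EuclideanSpace ℝ ι) (V X Y : ι → ℝ) : ι → ℝ :=
  fun δ => ∑ α, ∑ β, (∑ κ, pd κ (christoffel G δ α β) z * V κ) * X α * Y β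

theorem pd_gammaForm {Z : EuclideanSpace ℝ κ → EuclideanSpace ℝ ι}
    {X Y : EuclideanSpace ℝ κ → ι → ℝ} {y : EuclideanSpace ℝ κ} (i : κ)
    (hΓ : ∀ γ α β, DifferentiableAt ℝ (christoffel G γ α β) (Z y))
    (hZ : ∀ α, DifferentiableAt ℝ (fun x => Z x α) y)
    (hX : ∀ α, DifferentiableAt ℝ (fun x => X x α) y)
    (hY : ∀ α, DifferentiableAt ℝ (fun x => Y x α) y) (δ : ι) :
    pd i (fun x => gammaForm G (Z x) (X x) (Y x) δ) y
      = gammaDeriv G (Z y) (velocity Z i y) (X y) (Y y) δ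
        + gammaForm G (Z y) (fun α => pd i (fun x => X x α) y) (Y y) δ
        + gammaForm G (Z y) (X y) (fun α => pd i (fun x => Y x α) y) δ := by
  have hc : ∀ α β, DifferentiableAt ℝ (fun x => christoffel G δ α β (Z x)) y := fun α β =>
    (hΓ δ α β).comp y (coord_differentiableAt hZ)
  have hd : ∀ α β, DifferentiableAt ℝ (fun x => christoffel G δ α β (Z x) * X x α * Y x β) y :=
    fun α β => ((hc α β).mul (hX α)).mul (hY β)
  simp only [gammaForm, gammaDeriv]
  rw [pd_sum _ _ fun α _ => DifferentiableAt.fun_sum fun β _ => hd α β]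
  simp only [← Finset.sum_add_distrib]
  refine Finset.sum_congr rfl fun α _ => ?_
  rw [pd_sum _ _ fun β _ => hd α β]
  refine Finset.sum_congr rfl fun β _ => ?_
  rw [pd_mul i (w := fun x => christoffel G δ α β (Z x) * X x α) ((hc α β).mul (hX α)) (hY β), pd_mul i (hc α β) (hX α), pd_comp i (hΓ δ α β) hZ]
  ring

theorem differentiableAt_gammaForm {Z : EuclideanSpace ℝ κ → EuclideanSpace ℝ ι}
    {X Y : EuclideanSpace ℝ κ → ι → ℝ} {y : EuclideanSpace ℝ κ}
    (hΓ : ∀ γ α β, DifferentiableAt ℝ (christoffel G γ α β) (Z y))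
    (hZ : ∀ α, DifferentiableAt ℝ (fun x => Z x α) y)
    (hX : ∀ α, DifferentiableAt ℝ (fun x => X x α) y)
    (hY : ∀ α, DifferentiableAt ℝ (fun x => Y x α) y) (δ : ι) :
    DifferentiableAt ℝ (fun x => gammaForm G (Z x) (X x) (Y x) δ) y := by
  unfold gammaForm
  refine DifferentiableAt.fun_sum fun α _ => DifferentiableAt.fun_sum fun β _ => ?_
  exact (((hΓ δ α β).comp y (coord_differentiableAt hZ)).mul (hX α)).mul (hY β)

variable (G) in
/-- The vector `R(X, Y) W`. -/
def riemannVec (z : EuclideanSpace ℝ ι) (X Y W : ι → ℝ) : ι → ℝ :=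
  fun δ => ∑ α, ∑ β, ∑ γ, riemann G α β γ δ z * X α * Y β * W γ

theorem riemannVec_eq (z : EuclideanSpace ℝ ι) (X Y W : ι → ℝ) :
    riemannVec G z X Y W = gammaDeriv G z X Y W - gammaDeriv G z Y X W
      + gammaForm G z X (gammaForm G z Y W) - gammaForm G z Y (gammaForm G z X W) := by
  have hD : ∀ X Y : ι → ℝ, ∀ δ, gammaDeriv G z X Y W δ
      = ∑ α, ∑ β, ∑ γ, pd α (christoffel G δ β γ) z * X α * Y β * W γ := by
    intro X Y δ
    simp only [gammaDeriv, Finset.sum_mul]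
    rw [Finset.sum_comm' (t' := Finset.univ) (s' := fun _ => Finset.univ) (by simp)]
    calc _ = ∑ γ, ∑ α, ∑ β, pd α (christoffel G δ β γ) z * X α * Y β * W γ :=
          Finset.sum_congr rfl fun γ _ => Finset.sum_comm
      _ = ∑ α, ∑ γ, ∑ β, pd α (christoffel G δ β γ) z * X α * Y β * W γ := Finset.sum_comm
      _ = _ := Finset.sum_congr rfl fun α _ => Finset.sum_comm
  have hΓ : ∀ X Y : ι → ℝ, ∀ δ, gammaForm G z X (gammaForm G z Y W) δ
      = ∑ α, ∑ β, ∑ γ, (∑ η, christoffel G η β γ z * christoffel G δ α η z)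
          * X α * Y β * W γ := by
    intro X Y δ
    simp only [gammaForm, Finset.mul_sum, Finset.sum_mul]
    refine Finset.sum_congr rfl fun α _ => ?_
    rw [Finset.sum_comm]
    refine Finset.sum_congr rfl fun β _ => ?_
    rw [Finset.sum_comm]
    refine Finset.sum_congr rfl fun γ _ => Finset.sum_congr rfl fun η _ => ?_
    ring
  have hswap : ∀ A : ι → ι → ι → ℝ, ∑ α, ∑ β, ∑ γ, A α β γ * Y α * X β * W γ
      = ∑ α, ∑ β, ∑ γ, A β α γ * X α * Y β * W γ := by
    intro A
    rw [Finset.sum_comm]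
    refine Finset.sum_congr rfl fun α _ => Finset.sum_congr rfl fun β _ =>
      Finset.sum_congr rfl fun γ _ => ?_
    ring
  ext δ
  simp only [Pi.sub_apply, Pi.add_apply]
  rw [hD X Y, hD Y X, hΓ X Y, hΓ Y X, hswap, hswap]
  simp only [riemannVec, ← Finset.sum_add_distrib, ← Finset.sum_sub_distrib]
  refine Finset.sum_congr rfl fun α _ => Finset.sum_congr rfl fun β _ =>
      Finset.sum_congr rfl fun γ _ => ?_
  rw [riemann, Finset.sum_sub_distrib]
  ring

theorem differentiableAt_cov {Z : EuclideanSpace ℝ κ → EuclideanSpace ℝ ι}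
    {W : EuclideanSpace ℝ κ → ι → ℝ} {y : EuclideanSpace ℝ κ}
    (hΓ : ∀ γ α β, DifferentiableAt ℝ (christoffel G γ α β) (Z y))
    (hZ : ∀ α, ContDiffAt ℝ 2 (fun x => Z x α) y)
    (hW : ∀ α, ContDiffAt ℝ 2 (fun x => W x α) y) (i : κ) (δ : ι) :
    DifferentiableAt ℝ (fun x => cov G Z i W x δ) y := by
  have d1 : ∀ w : EuclideanSpace ℝ κ → ℝ, ContDiffAt ℝ 2 w y → DifferentiableAt ℝ (pd i w) y :=
    fun w hw => (contDiffAt_pd (k := 1) i hw (by norm_num)).differentiableAt (by norm_num)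
  exact (d1 _ (hW δ)).add (differentiableAt_gammaForm hΓ
    (fun α => (hZ α).differentiableAt (by norm_num)) (fun α => d1 _ (hZ α))
    (fun α => (hW α).differentiableAt (by norm_num)) δ)

/-- The commutator of two covariant derivatives along a map is the curvature. -/
theorem cov_cov_sub {Z : EuclideanSpace ℝ κ → EuclideanSpace ℝ ι}
    {W : EuclideanSpace ℝ κ → ι → ℝ} {y : EuclideanSpace ℝ κ}
    (hΓ : ∀ γ α β, DifferentiableAt ℝ (christoffel G γ α β) (Z y))
    (hZ : ∀ α, ContDiffAt ℝ 2 (fun x => Z x α) y)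
    (hW : ∀ α, ContDiffAt ℝ 2 (fun x => W x α) y) (i j : κ) :
    cov G Z i (cov G Z j W) y - cov G Z j (cov G Z i W) y
      = riemannVec G (Z y) (velocity Z i y) (velocity Z j y) (W y) := by
  have d1 : ∀ (i : κ) (w : EuclideanSpace ℝ κ → ℝ), ContDiffAt ℝ 2 w y →
      DifferentiableAt ℝ (pd i w) y :=
    fun i w hw => (contDiffAt_pd (k := 1) i hw (by norm_num)).differentiableAt (by norm_num)
  have hZ1 : ∀ α, DifferentiableAt ℝ (fun x => Z x α) y :=
    fun α => (hZ α).differentiableAt (by norm_num)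
  have hW1 : ∀ α, DifferentiableAt ℝ (fun x => W x α) y :=
    fun α => (hW α).differentiableAt (by norm_num)
  have key : ∀ i j : κ, cov G Z i (cov G Z j W) y
      = (fun γ => pd i (pd j (fun x => W x γ)) y)
        + gammaDeriv G (Z y) (velocity Z i y) (velocity Z j y) (W y)
        + gammaForm G (Z y) (fun α => pd i (pd j (fun x => Z x α)) y) (W y)
        + gammaForm G (Z y) (velocity Z j y) (fun α => pd i (fun x => W x α) y)
        + gammaForm G (Z y) (velocity Z i y) (fun α => pd j (fun x => W x α) y)
        + gammaForm G (Z y) (velocity Z i y) (gammaForm G (Z y) (velocity Z j y) (W y)) := by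
    intro i j
    have e1 : (fun γ => pd i (fun x => cov G Z j W x γ) y)
        = (fun γ => pd i (pd j (fun x => W x γ)) y)
        + gammaDeriv G (Z y) (velocity Z i y) (velocity Z j y) (W y)
        + gammaForm G (Z y) (fun α => pd i (pd j (fun x => Z x α)) y) (W y)
        + gammaForm G (Z y) (velocity Z j y) (fun α => pd i (fun x => W x α) y) := by
      funext γ
      have := pd_add (y := y) i (d1 j _ (hW γ)) (differentiableAt_gammaForm hΓ hZ1
        (fun α => d1 j _ (hZ α)) hW1 γ)
      rw [pd_gammaForm i hΓ hZ1 (fun α => d1 j _ (hZ α)) hW1] at this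
      refine Eq.trans this ?_
      simp only [Pi.add_apply]
      rw [add_assoc, add_assoc, add_assoc]
      rfl
    rw [cov, e1, cov, gammaForm_add_right]
    abel
  have c1 : (fun γ => pd i (pd j (fun x => W x γ)) y) = fun γ => pd j (pd i (fun x => W x γ)) y :=
    funext fun γ => pd_pd_comm i j (hW γ)
  have c2 : (fun γ => pd i (pd j (fun x => Z x γ)) y) = fun γ => pd j (pd i (fun x => Z x γ)) y :=
    funext fun γ => pd_pd_comm i j (hZ γ)
  rw [key i j, key j i, riemannVec_eq, c1, c2]
  abel

end Covariant

/-! ### The inverse metric, the Laplacian and the gradient -/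

section Inverse

variable {κ : Type*} [Fintype κ] [DecidableEq κ]

theorem contDiffAt_matrix_det {E : Type*} [NormedAddCommGroup E] [NormedSpace ℝ E]
    {A : E → Matrix κ κ ℝ} {x : E} {n : ℕ∞ω} (hA : ∀ i j, ContDiffAt ℝ n (fun y => A y i j) x) :
    ContDiffAt ℝ n (fun y => (A y).det) x := by
  simp only [Matrix.det_apply]
  exact ContDiffAt.sum fun σ _ => (contDiffAt_prod fun i _ => hA _ _).const_smul _

theorem contDiffAt_matrix_inv {E : Type*} [NormedAddCommGroup E] [NormedSpace ℝ E]
    {A : E → Matrix κ κ ℝ} {x : E} {n : ℕ∞ω} (hA : ∀ i j, ContDiffAt ℝ n (fun y => A y i j) x)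
    (hdet : (A x).det ≠ 0) (i j : κ) : ContDiffAt ℝ n (fun y => (A y)⁻¹ i j) x := by
  simp only [Matrix.inv_def, Ring.inverse_eq_inv', Matrix.smul_apply, smul_eq_mul]
  refine ((contDiffAt_matrix_det hA).inv hdet).mul ?_
  simp only [Matrix.adjugate_apply]
  refine contDiffAt_matrix_det fun a b => ?_
  by_cases h : a = j
  · simp only [h, Matrix.updateRow_self]
    exact contDiffAt_const
  · simp only [Matrix.updateRow_ne h]
    exact hA a b

theorem inv_apply_symm {A : Matrix κ κ ℝ} (hA : A.IsSymm) (i j : κ) : A⁻¹ i j = A⁻¹ j i := by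
  have : (A⁻¹).transpose = A⁻¹ := by rw [Matrix.transpose_nonsing_inv, hA]
  exact congrFun (congrFun this.symm i) j

theorem sum_inv_mul {A : Matrix κ κ ℝ} (hdet : A.det ≠ 0) (i j : κ) :
    ∑ k, A⁻¹ i k * A k j = if i = j then 1 else 0 := by
  rw [← Matrix.mul_apply, Matrix.nonsing_inv_mul _ (isUnit_iff_ne_zero.2 hdet), Matrix.one_apply]

variable {g : EuclideanSpace ℝ κ → Matrix κ κ ℝ} {y : EuclideanSpace ℝ κ}

theorem pd_inv_metric (hg : ∀ x, (g x).IsSymm) (hdet : (g y).det ≠ 0)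
    (hgd : ∀ i j, ContDiffAt ℝ 1 (fun x => g x i j) y) (k i l : κ) :
    pd k (fun x => (g x)⁻¹ i l) y = -∑ a, (g y)⁻¹ i a * christoffel g l k a y
      - ∑ b, christoffel g i k b y * (g y)⁻¹ b l := by
  set DP : Matrix κ κ ℝ := Matrix.of fun i l => pd k (fun x => (g x)⁻¹ i l) y with hDP
  set Dg : Matrix κ κ ℝ := Matrix.of fun i l => pd k (fun x => g x i l) y with hDg
  set Γ : Matrix κ κ ℝ := Matrix.of fun i l => christoffel g i k l y with hΓ
  have hPd : ∀ i j, DifferentiableAt ℝ (fun x => (g x)⁻¹ i j) y := fun i j =>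
    (contDiffAt_matrix_inv hgd hdet i j).differentiableAt (by norm_num)
  have hgd' : ∀ i j, DifferentiableAt ℝ (fun x => g x i j) y := fun i j =>
    (hgd i j).differentiableAt (by norm_num)
  have hdet' : ∀ᶠ x in nhds y, (g x).det ≠ 0 :=
    (contDiffAt_matrix_det hgd).continuousAt.eventually_ne hdet
  have h1 : DP * g y + (g y)⁻¹ * Dg = 0 := by
    ext i j
    have hc : pd k (fun x => ∑ a, (g x)⁻¹ i a * g x a j) y = 0 := by
      rw [pd_congr k (w' := fun _ => if i = j then 1 else 0)
        (hdet'.mono fun x hx => sum_inv_mul hx i j), pd_const]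
    rw [pd_sum _ _ fun a _ => (hPd i a).fun_mul (hgd' a j)] at hc
    rw [Matrix.add_apply, Matrix.mul_apply, Matrix.mul_apply, ← Finset.sum_add_distrib]
    refine Eq.trans (Finset.sum_congr rfl fun a _ => ?_) hc
    rw [pd_mul k (hPd i a) (hgd' a j)]
    rfl
  have h2 : Dg = Γ.transpose * g y + g y * Γ := by
    ext a b
    rw [Matrix.add_apply, Matrix.mul_apply, Matrix.mul_apply]
    refine (pd_metric hg hdet k a b).trans ?_
    congr 1
    exact Finset.sum_congr rfl fun δ _ => mul_comm _ _
  have hu := isUnit_iff_ne_zero.2 hdet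
  have h3 : DP = -((g y)⁻¹ * Γ.transpose) - Γ * (g y)⁻¹ := by
    have : (DP * g y + (g y)⁻¹ * Dg) * (g y)⁻¹ = 0 := by rw [h1, zero_mul]
    rw [add_mul, Matrix.mul_nonsing_inv_cancel_right _ _ hu, h2, mul_add, add_mul,
      Matrix.nonsing_inv_mul_cancel_left _ _ hu, ← mul_assoc,
      Matrix.mul_nonsing_inv_cancel_right _ _ hu] at this
    rw [eq_sub_iff_add_eq, eq_neg_iff_add_eq_zero, ← this]
    abel
  exact congrFun (congrFun h3 i) l

/-- The Laplacian is minus the trace of the Hessian `∂_i ∂_j w - Γ^k_{ij} ∂_k w`. -/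
theorem laplacian_eq (hg : ∀ x, (g x).IsSymm) (hdet : (g y).det ≠ 0)
    (hgd : ∀ i j, ContDiffAt ℝ 1 (fun x => g x i j) y) {w : EuclideanSpace ℝ κ → ℝ}
    (hw : ContDiffAt ℝ 2 w y) :
    laplacian g w y = -∑ i, ∑ j, (g y)⁻¹ i j
      * (pd i (pd j w) y - ∑ k, christoffel g k i j y * pd k w y) := by
  have hPd : ∀ i j, DifferentiableAt ℝ (fun x => (g x)⁻¹ i j) y := fun i j =>
    (contDiffAt_matrix_inv hgd hdet i j).differentiableAt (by norm_num)
  have hw1 : ∀ j, DifferentiableAt ℝ (pd j w) y := fun j =>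
    (contDiffAt_pd (k := 1) j hw (by norm_num)).differentiableAt (by norm_num)
  rw [laplacian, divergence]
  simp only [Finset.sum_add_distrib]
  rw [← Finset.sum_add_distrib]
  congr 1
  have h1 : ∀ i, pd i (fun x => grad g w x i) y
      = ∑ l, (g y)⁻¹ i l * pd i (pd l w) y
        - ∑ l, ∑ a, (g y)⁻¹ i a * christoffel g l i a y * pd l w y
        - ∑ l, ∑ b, christoffel g i i b y * (g y)⁻¹ b l * pd l w y := by
    intro i
    simp only [grad]
    rw [pd_sum _ _ fun l _ => (hPd i l).fun_mul (hw1 l), ← Finset.sum_sub_distrib,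
      ← Finset.sum_sub_distrib]
    refine Finset.sum_congr rfl fun l _ => ?_
    rw [pd_mul i (hPd i l) (hw1 l), pd_inv_metric hg hdet hgd, sub_mul, neg_mul, Finset.sum_mul,
      Finset.sum_mul]
    ring
  have h2 : ∀ i, ∑ l, ∑ b, christoffel g i i b y * (g y)⁻¹ b l * pd l w y
      = ∑ j, christoffel g i i j y * grad g w y j := by
    intro i
    rw [Finset.sum_comm]
    refine Finset.sum_congr rfl fun b _ => ?_
    rw [grad, Finset.mul_sum]
    exact Finset.sum_congr rfl fun l _ => by ring
  refine Finset.sum_congr rfl fun i _ => ?_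
  rw [h1, h2, sub_add_cancel]
  rw [Finset.sum_comm, ← Finset.sum_sub_distrib]
  refine Finset.sum_congr rfl fun j _ => ?_
  rw [mul_sub, Finset.mul_sum]
  congr 1
  exact Finset.sum_congr rfl fun l _ => by ring

theorem pairing_grad_grad (hg : (g y).IsSymm) (hdet : (g y).det ≠ 0)
    (w w' : EuclideanSpace ℝ κ → ℝ) :
    pairing g y (grad g w y) (grad g w' y)
      = ∑ i, ∑ j, (g y)⁻¹ i j * pd i w y * pd j w' y := by
  have h1 : ∀ X : κ → ℝ, pairing g y X (grad g w' y) = ∑ i, X i * pd i w' y := by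
    intro X
    rw [pairing]
    refine Finset.sum_congr rfl fun i _ => ?_
    have : ∑ j, g y i j * X i * grad g w' y j
        = X i * ((g y).mulVec ((g y)⁻¹.mulVec fun l => pd l w' y)) i := by
      rw [Matrix.mulVec, dotProduct, Finset.mul_sum]
      exact Finset.sum_congr rfl fun j _ => by
        rw [mul_comm (g y i j), mul_assoc]
        rfl
    rw [this, Matrix.mulVec_mulVec, Matrix.mul_nonsing_inv _ (isUnit_iff_ne_zero.2 hdet),
      Matrix.one_mulVec]
  rw [h1, Finset.sum_comm]
  refine Finset.sum_congr rfl fun j _ => ?_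
  rw [grad, Finset.sum_mul]
  exact Finset.sum_congr rfl fun i _ => by rw [inv_apply_symm hg]

end Inverse

/-! ### The connection of a warped product metric -/

section Warped

variable {m : ℕ}

/-- The matrix `G` represents, on the open set `U` of coordinates `(t, x)`, a Lorentzian warped
product metric `-dt² + f(t)² γ_{ab}(x) dx^a dx^b`. That `γ` does not depend on `t` is expressed by
`∂_t G_{ab} = 2 (f' / f) G_{ab}`. -/
structure IsWarpedChart (f : ℝ → ℝ) (U : Set (EuclideanSpace ℝ (Fin (m + 1))))
    (G : EuclideanSpace ℝ (Fin (m + 1)) → Matrix (Fin (m + 1)) (Fin (m + 1)) ℝ) : Prop where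
  f_contDiff : ContDiff ℝ ∞ f
  f_pos : ∀ t, 0 < f t
  isOpen : IsOpen U
  contDiffAt : ∀ z ∈ U, ∀ α β, ContDiffAt ℝ ∞ (fun x => G x α β) z
  symm : ∀ z, (G z).IsSymm
  det_ne_zero : ∀ z ∈ U, (G z).det ≠ 0
  time_time : ∀ z, G z 0 0 = -1
  time_space : ∀ z (a : Fin m), G z 0 a.succ = 0
  pd_time : ∀ z ∈ U, ∀ a b : Fin m, pd 0 (fun x => G x a.succ b.succ) z
    = 2 * (deriv f (z 0) / f (z 0)) * G z a.succ b.succ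

variable {f : ℝ → ℝ} {U : Set (EuclideanSpace ℝ (Fin (m + 1)))}
  {G : EuclideanSpace ℝ (Fin (m + 1)) → Matrix (Fin (m + 1)) (Fin (m + 1)) ℝ}

namespace IsWarpedChart

variable (hW : IsWarpedChart f U G)
include hW

theorem differentiableAt {z} (hz : z ∈ U) (α β) : DifferentiableAt ℝ (fun x => G x α β) z :=
  (hW.contDiffAt z hz α β).differentiableAt (by simp)

theorem apply_zero (z) (β : Fin (m + 1)) : G z 0 β = if β = 0 then -1 else 0 := by
  refine Fin.cases ?_ (fun b => ?_) β
  · simp [hW.time_time]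
  · simp [hW.time_space, Fin.succ_ne_zero]

theorem pd_apply_zero (z) (α β : Fin (m + 1)) : pd α (fun x => G x 0 β) z = 0 := by
  simp_rw [hW.apply_zero]
  exact pd_const _ _ _

theorem pd_apply_zero' (z) (α β : Fin (m + 1)) : pd α (fun x => G x β 0) z = 0 := by
  rw [← hW.pd_apply_zero z α β]
  congr 1
  exact funext fun x => (hW.symm x).apply _ _

theorem pd_zero {z} (hz : z ∈ U) (α β : Fin (m + 1)) : pd 0 (fun x => G x α β) z
    = 2 * (deriv f (z 0) / f (z 0)) * (G z α β + if α = 0 ∧ β = 0 then 1 else 0) := by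
  refine Fin.cases ?_ (fun a => ?_) α
  · rw [hW.pd_apply_zero, hW.apply_zero]
    by_cases h : β = 0 <;> simp [h]
  · refine Fin.cases ?_ (fun b => ?_) β
    · rw [hW.pd_apply_zero', (hW.symm z).apply, hW.apply_zero]
      simp [Fin.succ_ne_zero]
    · rw [hW.pd_time z hz]
      simp [Fin.succ_ne_zero]

theorem pairing_time_left (z) (X : Fin (m + 1) → ℝ) : pairing G z (Pi.single 0 1) X = -X 0 := by
  rw [pairing_comm (hW.symm z), pairing_single_right]
  rw [Finset.sum_congr rfl fun α _ => by rw [(hW.symm z).apply 0 α, hW.apply_zero]]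
  simp

theorem inv_apply_zero {z} (hz : z ∈ U) (γ : Fin (m + 1)) :
    (G z)⁻¹ γ 0 = if γ = 0 then -1 else 0 := by
  have h := sum_inv_mul (hW.det_ne_zero z hz) γ 0
  simp_rw [(hW.symm z).apply 0, hW.apply_zero] at h
  simp only [mul_ite, mul_neg, mul_one, mul_zero, Finset.sum_ite_eq', Finset.mem_univ, if_true] at h
  rw [← neg_neg ((G z)⁻¹ γ 0), h]
  split_ifs <;> simp

theorem christoffel_time {z} (hz : z ∈ U) (γ β : Fin (m + 1)) :
    christoffel G γ 0 β z = if γ = β ∧ β ≠ 0 then deriv f (z 0) / f (z 0) else 0 := by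
  have h1 : ∀ l, (G z)⁻¹ γ l * (pd 0 (fun x => G x β l) z + pd β (fun x => G x 0 l) z
      - pd l (fun x => G x 0 β) z) = 2 * (deriv f (z 0) / f (z 0)) * ((G z)⁻¹ γ l * G z l β)
        + 2 * (deriv f (z 0) / f (z 0)) * (if β = 0 then 1 else 0)
          * ((G z)⁻¹ γ l * (if l = 0 then 1 else 0)) := by
    intro l
    rw [hW.pd_zero hz, hW.pd_apply_zero, hW.pd_apply_zero, (hW.symm z).apply]
    by_cases h : β = 0 <;> by_cases h' : l = 0 <;> simp [h, h'] <;> ring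
  rw [christoffel, Finset.sum_congr rfl fun l _ => h1 l, Finset.sum_add_distrib, ← Finset.mul_sum,
    ← Finset.mul_sum, sum_inv_mul (hW.det_ne_zero z hz)]
  simp only [mul_ite, mul_one, mul_zero, Finset.sum_ite_eq', Finset.mem_univ, if_true,
    hW.inv_apply_zero hz]
  by_cases h : β = 0
  · by_cases h' : γ = 0 <;> simp [h, h']
  · by_cases h' : γ = β <;> simp [h, h']

/-- `∇_X ∂_t = (f' / f) (X - dt(X) ∂_t)`. -/
theorem gammaForm_time {z} (hz : z ∈ U) (X : Fin (m + 1) → ℝ) :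
    gammaForm G z X (Pi.single 0 1)
      = (deriv f (z 0) / f (z 0)) • (X - X 0 • (Pi.single 0 1 : Fin (m + 1) → ℝ)) := by
  rw [gammaForm_comm z hW.symm]
  ext γ
  have : gammaForm G z (Pi.single 0 1) X γ = ∑ β, christoffel G γ 0 β z * X β := by
    simp [gammaForm, Pi.single_apply]
  rw [this, Finset.sum_congr rfl fun β _ => by rw [hW.christoffel_time hz]]
  by_cases h : γ = 0
  · subst h
    have : ∀ β : Fin (m + 1), ¬(0 = β ∧ β ≠ 0) := fun β hβ => hβ.2 hβ.1.symm
    simp [this]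
  · rw [Finset.sum_eq_single γ]
    · simp [h]
    · intro β _ hβ
      simp [hβ.symm]
    · simp

/-- The time component of `∇_X Y` differs from the derivative of the time component of `Y` by the
second fundamental form of the slices `t = const`. -/
theorem gammaForm_apply_zero {z} (hz : z ∈ U) (X Y : Fin (m + 1) → ℝ) :
    gammaForm G z X Y 0 = (deriv f (z 0) / f (z 0)) * (pairing G z X Y + X 0 * Y 0) := by
  have h := sum_pd_metric hW.symm (hW.det_ne_zero z hz) X (Pi.single 0 1) Y
  rw [hW.gammaForm_time hz, hW.pairing_time_left, pairing_smul_left, pairing_sub_left,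
    pairing_smul_left, hW.pairing_time_left, Finset.sum_eq_single 0] at h
  · simp only [hW.pd_apply_zero, zero_mul, Finset.sum_const_zero] at h
    linarith
  · intro α _ hα
    simp [hα]
  · simp

theorem contDiffAt_christoffel {z} (hz : z ∈ U) (γ α β) :
    ContDiffAt ℝ ∞ (christoffel G γ α β) z := by
  have hp : ∀ i α β, ContDiffAt ℝ ∞ (pd i (fun x => G x α β)) z := fun i α β =>
    contDiffAt_pd i (hW.contDiffAt z hz α β) (by simp)
  unfold christoffel
  refine contDiffAt_const.mul (ContDiffAt.sum fun l _ => ?_)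
  exact (contDiffAt_matrix_inv (hW.contDiffAt z hz) (hW.det_ne_zero z hz) _ _).mul
    (((hp _ _ _).add (hp _ _ _)).sub (hp _ _ _))

theorem hasDerivAt_logDeriv (t : ℝ) : HasDerivAt (fun t => deriv f t / f t)
    (deriv (deriv f) t / f t - (deriv f t / f t) ^ 2) t := by
  have h1 : HasDerivAt f (deriv f t) t :=
    ((hW.f_contDiff.differentiable (by simp)) t).hasDerivAt
  have h2 : HasDerivAt (deriv f) (deriv (deriv f) t) t := by
    have : ContDiff ℝ ∞ (deriv f) := (contDiff_infty_iff_deriv.1 hW.f_contDiff).2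
    exact ((this.differentiable (by simp)) t).hasDerivAt
  have h0 := (hW.f_pos t).ne'
  exact (h2.fun_div h1 h0).congr_deriv (by field_simp)

theorem pd_logDeriv {κ : Type*} [Fintype κ] [DecidableEq κ] {u : EuclideanSpace ℝ κ → ℝ}
    {y : EuclideanSpace ℝ κ} (hu : DifferentiableAt ℝ u y) (i : κ) :
    pd i (fun x => deriv f (u x) / f (u x)) y
      = (deriv (deriv f) (u y) / f (u y) - (deriv f (u y) / f (u y)) ^ 2) * pd i u y := by
  have h := (hW.hasDerivAt_logDeriv (u y)).comp_hasFDerivAt y hu.hasFDerivAt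
  rw [pd, show (fun x => deriv f (u x) / f (u x)) = (fun t => deriv f t / f t) ∘ u from rfl,
    h.fderiv]
  simp [pd]

theorem differentiableAt_logDeriv {E : Type*} [NormedAddCommGroup E] [NormedSpace ℝ E]
    {u : E → ℝ} {y : E} (hu : DifferentiableAt ℝ u y) :
    DifferentiableAt ℝ (fun x => deriv f (u x) / f (u x)) y :=
  (hW.hasDerivAt_logDeriv (u y)).differentiableAt.comp y hu

/-- The trace of the connection in a spatial direction does not depend on time: it is
`½ G^{δl} ∂_β G_{δl}`, in which the powers of `f` cancel. -/
theorem pd_time_sum_christoffel {z} (hz : z ∈ U) {β : Fin (m + 1)} (hβ : β ≠ 0) :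
    pd 0 (fun x => ∑ δ, christoffel G δ δ β x) z = 0 := by
  have hev : ∀ᶠ x in nhds z, x ∈ U := hW.isOpen.mem_nhds hz
  have h1 : (fun x => ∑ δ, christoffel G δ δ β x)
      = fun x => ∑ δ, ∑ l, (1 / 2) * ((G x)⁻¹ δ l * pd β (fun x => G x δ l) x) := by
    funext x
    have e1 : ∀ δ, christoffel G δ δ β x
        = ∑ l, (1 / 2) * ((G x)⁻¹ δ l * pd δ (fun x => G x β l) x)
          + ∑ l, (1 / 2) * ((G x)⁻¹ δ l * pd β (fun x => G x δ l) x)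
          - ∑ l, (1 / 2) * ((G x)⁻¹ δ l * pd l (fun x => G x δ β) x) := by
      intro δ
      rw [christoffel, Finset.mul_sum, ← Finset.sum_add_distrib, ← Finset.sum_sub_distrib]
      exact Finset.sum_congr rfl fun l _ => by ring
    rw [Finset.sum_congr rfl fun δ _ => e1 δ, Finset.sum_sub_distrib, Finset.sum_add_distrib]
    -- the first and the last derivative in `Γ^δ_{δβ}` cancel by the symmetry of `G` and `G⁻¹`
    have e2 : ∑ δ, ∑ l, (1 / 2) * ((G x)⁻¹ δ l * pd l (fun x => G x δ β) x)
        = ∑ δ, ∑ l, (1 / 2) * ((G x)⁻¹ δ l * pd δ (fun x => G x β l) x) := by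
      rw [Finset.sum_comm]
      refine Finset.sum_congr rfl fun δ _ => Finset.sum_congr rfl fun l _ => ?_
      rw [inv_apply_symm (hW.symm x) l δ,
        show (fun x => G x l β) = fun x => G x β l from funext fun x => (hW.symm x).apply _ _]
    rw [e2]
    ring
  have hPd : ∀ i j, DifferentiableAt ℝ (fun x => (G x)⁻¹ i j) z := fun i j =>
    (contDiffAt_matrix_inv (hW.contDiffAt z hz) (hW.det_ne_zero z hz) i j).differentiableAt
      (by simp)
  have hpd : ∀ i j, DifferentiableAt ℝ (pd β (fun x => G x i j)) z := fun i j =>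
    (contDiffAt_pd (k := 1) β (hW.contDiffAt z hz i j) (by norm_cast)).differentiableAt (by simp)
  -- for spatial `δ`, `l`, `∂_β G_{δl}` scales like `f²` in `t`, and `(G⁻¹)^{δl}` like `f⁻²`;
  -- all other terms vanish
  have h2 : ∀ δ l, pd 0 (fun x => (1 / 2) * ((G x)⁻¹ δ l * pd β (fun x => G x δ l) x)) z = 0 := by
    intro δ l
    rw [pd_mul 0 (differentiableAt_const _) ((hPd δ l).fun_mul (hpd δ l)), pd_const,
      pd_mul 0 (hPd δ l) (hpd δ l)]
    have e1 : pd 0 (pd β (fun x => G x δ l)) z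
        = 2 * (deriv f (z 0) / f (z 0)) * pd β (fun x => G x δ l) z := by
      rw [pd_pd_comm 0 β ((hW.contDiffAt z hz δ l).of_le (by norm_cast)),
        pd_congr β (hev.mono fun x hx => hW.pd_zero hx δ l)]
      have d0 : DifferentiableAt ℝ (fun x : EuclideanSpace ℝ (Fin (m + 1)) => x 0) z := by fun_prop
      have d1 := hW.differentiableAt_logDeriv d0
      rw [pd_mul β (d1.const_mul 2) ((hW.differentiableAt hz δ l).add_const _),
        pd_mul β (differentiableAt_const _) d1, pd_const, hW.pd_logDeriv d0, pd_apply_id,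
        pd_add β (hW.differentiableAt hz δ l) (differentiableAt_const _), pd_const]
      simp [hβ.symm]
    rw [e1, pd_inv_metric hW.symm (hW.det_ne_zero z hz)
      (fun i j => (hW.contDiffAt z hz i j).of_le (by norm_cast))]
    have e2 : ∑ a, (G z)⁻¹ δ a * christoffel G l 0 a z
        = if l = 0 then 0 else (G z)⁻¹ δ l * (deriv f (z 0) / f (z 0)) := by
      rw [Finset.sum_congr rfl fun a _ => by rw [hW.christoffel_time hz], Finset.sum_eq_single l]
      · by_cases h : l = 0 <;> simp [h]
      · intro a _ ha
        simp [ha.symm]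
      · simp
    have e3 : ∑ a, christoffel G δ 0 a z * (G z)⁻¹ a l
        = if δ = 0 then 0 else (deriv f (z 0) / f (z 0)) * (G z)⁻¹ δ l := by
      rw [Finset.sum_congr rfl fun a _ => by rw [hW.christoffel_time hz], Finset.sum_eq_single δ]
      · by_cases h : δ = 0 <;> simp [h]
      · intro a _ ha
        simp [ha.symm]
      · simp
    rw [e2, e3]
    by_cases hl : l = 0
    · simp [hl, hW.pd_apply_zero']
    · by_cases hd : δ = 0
      · simp [hd, hW.pd_apply_zero]
      · simp only [hl, hd, if_false]
        ring
  have hdiff : ∀ δ l, DifferentiableAt ℝ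
      (fun x => (1 / 2) * ((G x)⁻¹ δ l * pd β (fun x => G x δ l) x)) z := fun δ l =>
    ((hPd δ l).mul (hpd δ l)).const_mul _
  rw [h1, pd_sum _ _ fun δ _ => DifferentiableAt.fun_sum fun l _ => hdiff δ l]
  refine Finset.sum_eq_zero fun δ _ => ?_
  rw [pd_sum _ _ fun l _ => hdiff δ l]
  exact Finset.sum_eq_zero fun l _ => h2 δ l

/-- `Ric(∂_t, ·) = -m (f'' / f) dt`: the time direction is an eigenvector of the Ricci tensor. -/
theorem ricci_time {z} (hz : z ∈ U) (β : Fin (m + 1)) :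
    ricci G 0 β z = if β = 0 then -(m * (deriv (deriv f) (z 0) / f (z 0))) else 0 := by
  have hev : ∀ᶠ x in nhds z, x ∈ U := hW.isOpen.mem_nhds hz
  have d0 : DifferentiableAt ℝ (fun x : EuclideanSpace ℝ (Fin (m + 1)) => x 0) z := by fun_prop
  set η := deriv f (z 0) / f (z 0) with hη
  have hcd : ∀ γ α β, DifferentiableAt ℝ (christoffel G γ α β) z := fun γ α β =>
    (hW.contDiffAt_christoffel hz γ α β).differentiableAt (by simp)
  have h1 : ∀ δ, pd δ (christoffel G δ 0 β) z = 0 := by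
    intro δ
    rw [pd_congr δ (hev.mono fun x hx => hW.christoffel_time hx δ β)]
    by_cases h : δ = β ∧ β ≠ 0
    · simp only [h, true_and, ne_eq, not_false_eq_true, if_true]
      rw [hW.pd_logDeriv d0, pd_apply_id, if_neg (Ne.symm h.2), mul_zero]
    · simp only [h, if_false]
      exact pd_const _ _ _
  have h3 : ∀ δ, ∑ η, christoffel G η 0 β z * christoffel G δ δ η z
      = if β = 0 then 0 else η * christoffel G δ δ β z := by
    intro δ
    rw [Finset.sum_congr rfl fun a _ => by rw [hW.christoffel_time hz], Finset.sum_eq_single β]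
    · by_cases h : β = 0 <;> simp [h, hη]
    · intro a _ ha
      simp [ha]
    · simp
  have h4 : ∀ δ, ∑ η, christoffel G η δ β z * christoffel G δ 0 η z
      = η * christoffel G δ δ β z := by
    intro δ
    rw [Finset.sum_eq_single δ, hW.christoffel_time hz δ δ]
    · by_cases h : δ = 0
      · subst h
        rw [hW.christoffel_time hz]
        by_cases h' : β = 0
        · simp [h']
        · simp [Ne.symm h']
      · simp [h, hη, mul_comm]
    · intro a _ ha
      rw [hW.christoffel_time hz δ a]
      simp [ha.symm]
    · simp
  -- what remains of `Ric_{0β}`; for `β ≠ 0` the last two terms cancel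
  have h5 : ricci G 0 β z = -pd 0 (fun x => ∑ δ, christoffel G δ δ β x) z
      + (if β = 0 then 0 else η * ∑ δ, christoffel G δ δ β z)
      - η * ∑ δ, christoffel G δ δ β z := by
    rw [ricci, pd_sum _ _ fun δ _ => hcd δ δ β]
    simp only [riemann, Finset.sum_sub_distrib, Finset.sum_add_distrib]
    rw [Finset.sum_congr rfl fun δ _ => h1 δ, Finset.sum_congr rfl fun δ _ => h3 δ,
      Finset.sum_congr rfl fun δ _ => h4 δ, ← Finset.mul_sum, Finset.sum_const_zero]
    by_cases h : β = 0
    · simp [h, sub_eq_add_neg]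
    · simp [h, ← Finset.mul_sum]
  rw [h5]
  by_cases h : β = 0
  · subst h
    -- `Γ^δ_{δ0} = m f' / f`, whose `t`-derivative and product with `f' / f` add up to `m f'' / f`
    have h6 : ∀ x ∈ U, ∑ δ, christoffel G δ δ 0 x = m * (deriv f (x 0) / f (x 0)) := by
      intro x hx
      rw [Finset.sum_congr rfl fun δ _ => by rw [christoffel_symm hW.symm, hW.christoffel_time hx],
        Fin.sum_univ_succ]
      simp [Fin.succ_ne_zero]
    rw [pd_congr 0 (hev.mono h6), h6 z hz,
      pd_mul 0 (differentiableAt_const _) (hW.differentiableAt_logDeriv d0), pd_const,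
      hW.pd_logDeriv d0, pd_apply_id]
    simp only [if_true, ← hη]
    ring
  · rw [hW.pd_time_sum_christoffel hz h]
    simp [h]

end IsWarpedChart

end Warped

/-! ### Symmetries of the curvature and the Ricci tensor -/

section Curvature

variable {ι : Type*} [Fintype ι] [DecidableEq ι] (G : EuclideanSpace ℝ ι → Matrix ι ι ℝ)
  (z : EuclideanSpace ℝ ι)

/-- The linear map `X ↦ R(X, Y) W`. -/
def riemannLeft (Y W : ι → ℝ) : (ι → ℝ) →ₗ[ℝ] (ι → ℝ) where
  toFun X := riemannVec G z X Y W
  map_add' X X' := by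
    ext δ
    simp only [riemannVec, Pi.add_apply, ← Finset.sum_add_distrib]
    exact Finset.sum_congr rfl fun _ _ => Finset.sum_congr rfl fun _ _ =>
      Finset.sum_congr rfl fun _ _ => by ring
  map_smul' a X := by
    ext δ
    simp only [riemannVec, Pi.smul_apply, smul_eq_mul, Finset.mul_sum, RingHom.id_apply]
    exact Finset.sum_congr rfl fun _ _ => Finset.sum_congr rfl fun _ _ =>
      Finset.sum_congr rfl fun _ _ => by ring

/-- The Ricci tensor `Ric(X, Y)` of vectors given by their components. -/
def ricciForm (X Y : ι → ℝ) : ℝ := ∑ α, ∑ β, ricci G α β z * X α * Y β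

theorem ricciForm_eq_trace (X Y : ι → ℝ) :
    ricciForm G z X Y = ∑ δ, riemannLeft G z X Y (Pi.single δ 1) δ := by
  have h : ∀ δ, riemannLeft G z X Y (Pi.single δ 1) δ
      = ∑ α, ∑ β, riemann G δ α β δ z * X α * Y β := by
    intro δ
    simp only [riemannLeft, riemannVec, LinearMap.coe_mk, AddHom.coe_mk]
    rw [Finset.sum_eq_single δ]
    · simp
    · intro b _ hb
      simp [hb]
    · simp
  simp only [h, ricciForm, ricci, Finset.sum_mul]
  calc _ = ∑ α, ∑ δ, ∑ β, riemann G δ α β δ z * X α * Y β :=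
        Finset.sum_congr rfl fun α _ => Finset.sum_comm
    _ = _ := Finset.sum_comm

/-- The Ricci tensor as a linear map in its first argument. -/
def ricciLeft (Y : ι → ℝ) : (ι → ℝ) →ₗ[ℝ] ℝ where
  toFun X := ricciForm G z X Y
  map_add' X X' := by
    simp only [ricciForm, Pi.add_apply, ← Finset.sum_add_distrib]
    exact Finset.sum_congr rfl fun _ _ => Finset.sum_congr rfl fun _ _ => by ring
  map_smul' a X := by
    simp only [ricciForm, Pi.smul_apply, smul_eq_mul, Finset.mul_sum, RingHom.id_apply]
    exact Finset.sum_congr rfl fun _ _ => Finset.sum_congr rfl fun _ _ => by ring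

variable {G z} in
/-- `R(X, Y)` is skew-adjoint: this is the symmetry of the second derivatives of `x ↦ G_x(W, W)` for
a vector `W` with constant components. -/
theorem pairing_riemannVec_self {U : Set (EuclideanSpace ℝ ι)} (hU : IsOpen U) (hz : z ∈ U)
    (hG : ∀ x, (G x).IsSymm) (hdet : ∀ x ∈ U, (G x).det ≠ 0)
    (hGd : ∀ x ∈ U, ∀ α β, ContDiffAt ℝ 2 (fun x => G x α β) x)
    (hΓ : ∀ x ∈ U, ∀ γ α β, DifferentiableAt ℝ (christoffel G γ α β) x) (X Y W : ι → ℝ) :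
    pairing G z (riemannVec G z X Y W) W = 0 := by
  have hGd1 : ∀ x ∈ U, ∀ α β, DifferentiableAt ℝ (fun x => G x α β) x := fun x hx α β =>
    (hGd x hx α β).differentiableAt (by norm_num)
  set I : EuclideanSpace ℝ ι → EuclideanSpace ℝ ι := fun x => x with hI
  have hId : ∀ x, ∀ α, ContDiffAt ℝ 2 (fun x => I x α) x := fun x α => by
    simp only [hI]
    fun_prop
  have hId1 : ∀ x, ∀ α, DifferentiableAt ℝ (fun x => I x α) x := fun x α =>
    (hId x α).differentiableAt (by norm_num)
  set w : EuclideanSpace ℝ ι → ι → ℝ := fun _ => W with hw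
  have hwd : ∀ x, ∀ α, ContDiffAt ℝ 2 (fun x => w x α) x := fun x α => contDiffAt_const
  have hwd1 : ∀ x, ∀ α, DifferentiableAt ℝ (fun x => w x α) x := fun x α =>
    differentiableAt_const _
  have hcd : ∀ i δ, DifferentiableAt ℝ (fun x => cov G I i w x δ) z := fun i δ =>
    differentiableAt_cov (hΓ z hz) (hId z) (hwd z) i δ
  set q : EuclideanSpace ℝ ι → ℝ := fun x => pairing G (I x) (w x) (w x) with hq
  have h1 : ∀ β, ∀ x ∈ U, pd β q x = 2 * pairing G (I x) (cov G I β w x) (w x) := by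
    intro β x hx
    rw [hq, pd_pairing β hG (hdet x hx) (hGd1 x hx) (hId1 x) (hwd1 x) (hwd1 x),
      pairing_comm (hG _) (w x)]
    ring
  have h2 : ∀ α β, pd α (pd β q) z = 2 * (pairing G z (cov G I α (cov G I β w) z) W
      + pairing G z (cov G I β w z) (cov G I α w z)) := by
    intro α β
    have hev : ∀ᶠ x in nhds z, x ∈ U := hU.mem_nhds hz
    rw [pd_congr α (hev.mono (h1 β)),
      pd_mul α (differentiableAt_const _) (differentiableAt_pairing (hGd1 z hz) (hId1 z) (hcd β)
        (hwd1 z)), pd_const,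
      pd_pairing α hG (hdet z hz) (hGd1 z hz) (hId1 z) (hcd β) (hwd1 z)]
    simp [hI, hw]
  have hqd : ContDiffAt ℝ 2 q z := by
    simp only [hq, pairing, hw, hI]
    exact ContDiffAt.sum fun α _ => ContDiffAt.sum fun β _ =>
      ((hGd z hz α β).mul contDiffAt_const).mul contDiffAt_const
  have h3 : ∀ α β, pairing G z (riemannVec G z (Pi.single α 1) (Pi.single β 1) W) W = 0 := by
    intro α β
    have e := cov_cov_sub (hΓ z hz) (hId z) (hwd z) α β
    rw [hI, velocity_id, velocity_id] at e
    have e2 := pd_pd_comm α β hqd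
    rw [h2, h2, pairing_comm (hG z) (cov G I α w z)] at e2
    rw [← e, pairing_sub_left]
    linarith
  have h4 : riemannVec G z X Y W
      = ∑ α, ∑ β, (X α * Y β) • riemannVec G z (Pi.single α 1) (Pi.single β 1) W := by
    have e : ∀ α β δ, riemannVec G z (Pi.single α 1) (Pi.single β 1) W δ
        = ∑ γ, riemann G α β γ δ z * W γ := by
      intro α β δ
      simp only [riemannVec]
      rw [Finset.sum_eq_single α, Finset.sum_eq_single β]
      · simp
      · intro b _ hb
        simp [hb]
      · simp
      · intro b _ hb
        simp [hb]
      · simp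
    ext δ
    simp only [Finset.sum_apply, Pi.smul_apply, smul_eq_mul, e, Finset.mul_sum]
    simp only [riemannVec]
    exact Finset.sum_congr rfl fun _ _ => Finset.sum_congr rfl fun _ _ =>
      Finset.sum_congr rfl fun _ _ => by ring
  rw [h4, pairing_sum_left]
  refine Finset.sum_eq_zero fun α _ => ?_
  rw [pairing_sum_left]
  refine Finset.sum_eq_zero fun β _ => ?_
  rw [pairing_smul_left, h3, mul_zero]

end Curvature

/-! ### Space-like hypersurfaces in coordinates -/

section Hypersurface

variable {m : ℕ}

theorem contDiffAt_pairing {ι E : Type*} [Fintype ι] [DecidableEq ι] [NormedAddCommGroup E]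
    [NormedSpace ℝ E] {G : EuclideanSpace ℝ ι → Matrix ι ι ℝ} {Z : E → EuclideanSpace ℝ ι}
    {X Y : E → ι → ℝ} {y : E} {n : ℕ∞ω}
    (hG : ∀ α β, ContDiffAt ℝ n (fun x => G x α β) (Z y)) (hZ : ContDiffAt ℝ n Z y)
    (hX : ∀ α, ContDiffAt ℝ n (fun x => X x α) y) (hY : ∀ α, ContDiffAt ℝ n (fun x => Y x α) y) :
    ContDiffAt ℝ n (fun x => pairing G (Z x) (X x) (Y x)) y := by
  unfold pairing
  exact ContDiffAt.sum fun α _ => ContDiffAt.sum fun β _ =>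
    (((hG α β).comp y hZ).mul (hX α)).mul (hY β)

/-- The vectors `X i` form a basis, with Gram matrix `γ`, of a nondegenerate hyperplane at the point
`z`, and `n` is a normal of it with `G(n, n) = -1`. -/
structure IsFrame (G : EuclideanSpace ℝ (Fin (m + 1)) → Matrix (Fin (m + 1)) (Fin (m + 1)) ℝ)
    (z : EuclideanSpace ℝ (Fin (m + 1))) (γ : Matrix (Fin m) (Fin m) ℝ)
    (X : Fin m → Fin (m + 1) → ℝ) (n : Fin (m + 1) → ℝ) : Prop where
  ambient_symm : (G z).IsSymm
  ambient_det : (G z).det ≠ 0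
  symm : γ.IsSymm
  apply : ∀ i j, γ i j = pairing G z (X i) (X j)
  det_ne_zero : γ.det ≠ 0
  normal : ∀ i, pairing G z n (X i) = 0
  unit : pairing G z n n = -1

namespace IsFrame

variable {G : EuclideanSpace ℝ (Fin (m + 1)) → Matrix (Fin (m + 1)) (Fin (m + 1)) ℝ}
  {z : EuclideanSpace ℝ (Fin (m + 1))} {γ : Matrix (Fin m) (Fin m) ℝ}
  {X : Fin m → Fin (m + 1) → ℝ} {n : Fin (m + 1) → ℝ} (hF : IsFrame G z γ X n)

include hF

theorem linearIndependent :
    LinearIndependent ℝ (Fin.cons n X : Fin (m + 1) → Fin (m + 1) → ℝ) := by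
  rw [Fintype.linearIndependent_iff]
  intro c hc
  rw [Fin.sum_univ_succ] at hc
  simp only [Fin.cons_zero, Fin.cons_succ] at hc
  have hsucc : ∀ i : Fin m, c i.succ = 0 := by
    have h : Matrix.vecMul (fun i : Fin m => c i.succ) γ = 0 := by
      ext j
      have h2 := congrArg (fun Y => pairing G z Y (X j)) hc
      simp only [pairing_add_left, pairing_smul_left, pairing_sum_left, hF.normal,
        pairing_zero_left, mul_zero, zero_add, ← hF.apply] at h2
      simpa [Matrix.vecMul, dotProduct] using h2
    exact fun i => congrFun (Matrix.eq_zero_of_vecMul_eq_zero hF.det_ne_zero h) i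
  have hzero : c 0 = 0 := by
    have h2 := congrArg (fun Y => pairing G z n Y) hc
    simp only [pairing_add_right, pairing_smul_right, pairing_sum_right, hF.normal,
      pairing_zero_right, hF.unit, mul_zero, Finset.sum_const_zero] at h2
    linarith
  exact fun i => Fin.cases hzero hsucc i

/-- Every vector is the sum of its tangential and its normal part. -/
theorem decomposition (Y : Fin (m + 1) → ℝ) :
    Y = ∑ i, (∑ j, γ⁻¹ i j * pairing G z Y (X j)) • X i - pairing G z Y n • n := by
  have hsym := hF.ambient_symm
  rw [← sub_eq_zero]
  refine eq_zero_of_pairing_eq_zero hF.ambient_det ?_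
  set R := Y - (∑ i, (∑ j, γ⁻¹ i j * pairing G z Y (X j)) • X i - pairing G z Y n • n) with hR
  have h0 : pairing G z R n = 0 := by
    rw [hR, pairing_sub_left, pairing_sub_left, pairing_sum_left, pairing_smul_left, hF.unit]
    simp only [pairing_smul_left]
    rw [Finset.sum_eq_zero fun i _ => by rw [pairing_comm hsym, hF.normal, mul_zero]]
    ring
  have h1 : ∀ l, pairing G z R (X l) = 0 := by
    intro l
    rw [hR, pairing_sub_left, pairing_sub_left, pairing_sum_left, pairing_smul_left, hF.normal]
    simp only [pairing_smul_left, ← hF.apply, Finset.sum_mul]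
    rw [Finset.sum_comm]
    have : ∀ j, ∑ i, γ⁻¹ i j * pairing G z Y (X j) * γ i l
        = pairing G z Y (X j) * if j = l then 1 else 0 := by
      intro j
      rw [← sum_inv_mul hF.det_ne_zero, Finset.mul_sum]
      exact Finset.sum_congr rfl fun i _ => by rw [inv_apply_symm hF.symm i j]; ring
    simp [this]
  have hspan := hF.linearIndependent.span_eq_top_of_card_eq_finrank' (by simp)
  have h2 : pairingRight G z R = 0 := by
    refine LinearMap.ext_on_range hspan fun i => ?_
    refine Fin.cases ?_ (fun i => ?_) i
    · exact h0
    · exact h1 i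
  exact fun X => LinearMap.congr_fun h2 X

variable {f : ℝ → ℝ} {U : Set (EuclideanSpace ℝ (Fin (m + 1)))} (hW : IsWarpedChart f U G)

include hW

/-- The decomposition `∂_t = v n - ∇u`, where `v` is the time component of the normal. -/
theorem time_decomposition :
    ∑ i, (∑ j, γ⁻¹ i j * X j 0) • X i = n 0 • n - (Pi.single 0 1 : Fin (m + 1) → ℝ) := by
  have h := hF.decomposition (Pi.single 0 1)
  simp_rw [hW.pairing_time_left, mul_neg, Finset.sum_neg_distrib, neg_smul,
    Finset.sum_neg_distrib] at h
  conv_rhs => rw [h]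
  abel

/-- `v² = 1 + ‖∇u‖²`. -/
theorem normal_time_sq : n 0 ^ 2 = 1 + ∑ i, ∑ j, γ⁻¹ i j * X i 0 * X j 0 := by
  have h := congrFun (hF.time_decomposition hW) 0
  simp only [Finset.sum_apply, Pi.smul_apply, smul_eq_mul, Pi.sub_apply, Pi.single_eq_same,
    Finset.sum_mul] at h
  have e : ∀ i j, γ⁻¹ i j * X j 0 * X i 0 = γ⁻¹ i j * X i 0 * X j 0 := fun i j => by ring
  rw [Finset.sum_congr rfl fun i _ => Finset.sum_congr rfl fun j _ => e i j] at h
  linarith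

end IsFrame

/-- The map `Z`, on the open set `Ω`, is a parametrized hypersurface of the region `U` with the
metric `G`; `ν` is its unit normal, with `G(ν, ν) = -1`, and `g` its first fundamental form. -/
structure IsHypersurface (U : Set (EuclideanSpace ℝ (Fin (m + 1))))
    (G : EuclideanSpace ℝ (Fin (m + 1)) → Matrix (Fin (m + 1)) (Fin (m + 1)) ℝ)
    (Ω : Set (EuclideanSpace ℝ (Fin m)))
    (g : EuclideanSpace ℝ (Fin m) → Matrix (Fin m) (Fin m) ℝ)
    (Z : EuclideanSpace ℝ (Fin m) → EuclideanSpace ℝ (Fin (m + 1)))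
    (ν : EuclideanSpace ℝ (Fin m) → Fin (m + 1) → ℝ) : Prop where
  isOpen : IsOpen Ω
  mem : ∀ y ∈ Ω, Z y ∈ U
  contDiffAt : ∀ y ∈ Ω, ∀ α, ContDiffAt ℝ 3 (fun x => Z x α) y
  contDiffAt_normal : ∀ y ∈ Ω, ∀ α, ContDiffAt ℝ 2 (fun x => ν x α) y
  normal : ∀ y ∈ Ω, ∀ i, pairing G (Z y) (ν y) (velocity Z i y) = 0
  unit : ∀ y ∈ Ω, pairing G (Z y) (ν y) (ν y) = -1
  symm : ∀ y, (g y).IsSymm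
  apply : ∀ y ∈ Ω, ∀ i j, g y i j = pairing G (Z y) (velocity Z i y) (velocity Z j y)
  det_ne_zero : ∀ y ∈ Ω, (g y).det ≠ 0

/-- The scalar second fundamental form `h_{ij} = G(∇_{∂_i} ∂_j Z, ν)`. -/
def secondForm (G : EuclideanSpace ℝ (Fin (m + 1)) → Matrix (Fin (m + 1)) (Fin (m + 1)) ℝ)
    (Z : EuclideanSpace ℝ (Fin m) → EuclideanSpace ℝ (Fin (m + 1)))
    (ν : EuclideanSpace ℝ (Fin m) → Fin (m + 1) → ℝ) (i j : Fin m)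
    (y : EuclideanSpace ℝ (Fin m)) : ℝ :=
  pairing G (Z y) (cov G Z i (velocity Z j) y) (ν y)

/-- The mean curvature `H = g^{ij} h_{ij}`. -/
def meanCurv (G : EuclideanSpace ℝ (Fin (m + 1)) → Matrix (Fin (m + 1)) (Fin (m + 1)) ℝ)
    (g : EuclideanSpace ℝ (Fin m) → Matrix (Fin m) (Fin m) ℝ)
    (Z : EuclideanSpace ℝ (Fin m) → EuclideanSpace ℝ (Fin (m + 1)))
    (ν : EuclideanSpace ℝ (Fin m) → Fin (m + 1) → ℝ) (y : EuclideanSpace ℝ (Fin m)) : ℝ :=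
  ∑ i, ∑ j, (g y)⁻¹ i j * secondForm G Z ν i j y

variable {f : ℝ → ℝ} {U : Set (EuclideanSpace ℝ (Fin (m + 1)))}
  {G : EuclideanSpace ℝ (Fin (m + 1)) → Matrix (Fin (m + 1)) (Fin (m + 1)) ℝ}
  {Ω : Set (EuclideanSpace ℝ (Fin m))}
  {g : EuclideanSpace ℝ (Fin m) → Matrix (Fin m) (Fin m) ℝ}
  {Z : EuclideanSpace ℝ (Fin m) → EuclideanSpace ℝ (Fin (m + 1))}
  {ν : EuclideanSpace ℝ (Fin m) → Fin (m + 1) → ℝ}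
  {y : EuclideanSpace ℝ (Fin m)}

namespace IsHypersurface

variable (hW : IsWarpedChart f U G) (hS : IsHypersurface U G Ω g Z ν)

include hW hS

theorem isFrame (hy : y ∈ Ω) :
    IsFrame G (Z y) (g y) (fun i => velocity Z i y) (ν y) where
  ambient_symm := hW.symm _
  ambient_det := hW.det_ne_zero _ (hS.mem y hy)
  symm := hS.symm y
  apply := hS.apply y hy
  det_ne_zero := hS.det_ne_zero y hy
  normal := hS.normal y hy
  unit := hS.unit y hy

theorem decomposition (hy : y ∈ Ω) (Y : Fin (m + 1) → ℝ) :
    Y = ∑ i, (∑ j, (g y)⁻¹ i j * pairing G (Z y) Y (velocity Z j y)) • velocity Z i y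
      - pairing G (Z y) Y (ν y) • ν y :=
  (hS.isFrame hW hy).decomposition Y

/-- The trace of an endomorphism, computed in the basis of the coordinate vectors and the normal. -/
theorem trace_eq (hy : y ∈ Ω) (A : (Fin (m + 1) → ℝ) →ₗ[ℝ] (Fin (m + 1) → ℝ)) :
    ∑ δ, A (Pi.single δ 1) δ
      = ∑ i, ∑ j, (g y)⁻¹ i j * pairing G (Z y) (A (velocity Z i y)) (velocity Z j y)
        - pairing G (Z y) (A (ν y)) (ν y) := by
  have h : ∀ W X : Fin (m + 1) → ℝ,
      ∑ δ, pairing G (Z y) (Pi.single δ 1) X * W δ = pairing G (Z y) W X := by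
    intro W X
    conv_rhs => rw [pi_eq_sum_univ' W]
    rw [pairing_sum_left]
    refine Finset.sum_congr rfl fun δ _ => ?_
    rw [pairing_smul_left, mul_comm]
  have h1 : ∀ δ, A (Pi.single δ 1) δ
      = ∑ i, ∑ j, (g y)⁻¹ i j * (pairing G (Z y) (Pi.single δ 1) (velocity Z j y)
          * A (velocity Z i y) δ) - pairing G (Z y) (Pi.single δ 1) (ν y) * A (ν y) δ := by
    intro δ
    conv_lhs => rw [decomposition hW hS hy (Pi.single δ 1)]
    simp only [map_sub, map_sum, map_smul, Pi.sub_apply, Finset.sum_apply, Pi.smul_apply,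
      smul_eq_mul, Finset.sum_mul, mul_assoc]
  rw [Finset.sum_congr rfl fun δ _ => h1 δ, Finset.sum_sub_distrib, h, Finset.sum_comm]
  congr 1
  refine Finset.sum_congr rfl fun i _ => ?_
  rw [Finset.sum_comm]
  refine Finset.sum_congr rfl fun j _ => ?_
  rw [← Finset.mul_sum, h]

omit hW in
theorem differentiableAt (hy : y ∈ Ω) (α) : DifferentiableAt ℝ (fun x => Z x α) y :=
  (hS.contDiffAt y hy α).differentiableAt (by norm_num)

omit hW in
theorem contDiffAt_velocity (hy : y ∈ Ω) (i α) :
    ContDiffAt ℝ 2 (fun x => velocity Z i x α) y :=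
  contDiffAt_pd i (hS.contDiffAt y hy α) (by norm_num)

omit hW in
theorem differentiableAt_velocity (hy : y ∈ Ω) (i α) :
    DifferentiableAt ℝ (fun x => velocity Z i x α) y :=
  (hS.contDiffAt_velocity hy i α).differentiableAt (by norm_num)

omit hW in
theorem differentiableAt_normal (hy : y ∈ Ω) (α) : DifferentiableAt ℝ (fun x => ν x α) y :=
  (hS.contDiffAt_normal y hy α).differentiableAt (by norm_num)

theorem differentiableAt_christoffel (hy : y ∈ Ω) (γ α β) :
    DifferentiableAt ℝ (christoffel G γ α β) (Z y) :=
  (hW.contDiffAt_christoffel (hS.mem y hy) γ α β).differentiableAt (by simp)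

theorem differentiableAt_cov_normal (hy : y ∈ Ω) (i α) :
    DifferentiableAt ℝ (fun x => cov G Z i ν x α) y :=
  differentiableAt_cov (hS.differentiableAt_christoffel hW hy)
    (fun α => (hS.contDiffAt y hy α).of_le (by norm_num)) (hS.contDiffAt_normal y hy) i α

omit hW in
theorem eventually_mem (hy : y ∈ Ω) : ∀ᶠ x in nhds y, x ∈ Ω := hS.isOpen.mem_nhds hy

theorem contDiffAt_metric (hy : y ∈ Ω) (i j) : ContDiffAt ℝ 2 (fun x => g x i j) y := by
  refine ContDiffAt.congr_of_eventuallyEq ?_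
    ((hS.eventually_mem hy).mono fun x hx => hS.apply x hx i j)
  exact contDiffAt_pairing (fun α β => (hW.contDiffAt _ (hS.mem y hy) α β).of_le (by norm_cast))
    (coord_contDiffAt fun α => (hS.contDiffAt y hy α).of_le (by norm_num))
    (hS.contDiffAt_velocity hy i) (hS.contDiffAt_velocity hy j)

/-- Metric compatibility along the hypersurface. -/
theorem pd_pairing (hy : y ∈ Ω) (i : Fin m) {X Y : EuclideanSpace ℝ (Fin m) → Fin (m + 1) → ℝ}
    (hX : ∀ α, DifferentiableAt ℝ (fun x => X x α) y)
    (hY : ∀ α, DifferentiableAt ℝ (fun x => Y x α) y) :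
    pd i (fun x => pairing G (Z x) (X x) (Y x)) y
      = pairing G (Z y) (cov G Z i X y) (Y y) + pairing G (Z y) (X y) (cov G Z i Y y) :=
  GRW.pd_pairing i hW.symm (hW.det_ne_zero _ (hS.mem y hy))
    (fun α β => hW.differentiableAt (hS.mem y hy) α β) (hS.differentiableAt hy) hX hY

theorem secondForm_symm (hy : y ∈ Ω) (i j : Fin m) :
    secondForm G Z ν i j y = secondForm G Z ν j i y := by
  rw [secondForm, cov_velocity_comm hW.symm
    fun α => (hS.contDiffAt y hy α).of_le (by norm_num)]
  rfl

theorem pairing_cov_normal_normal (hy : y ∈ Ω) (i : Fin m) :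
    pairing G (Z y) (cov G Z i ν y) (ν y) = 0 := by
  have h := hS.pd_pairing hW hy i (hS.differentiableAt_normal hy) (hS.differentiableAt_normal hy)
  rw [pd_congr i ((hS.eventually_mem hy).mono hS.unit), pd_const,
    pairing_comm (hW.symm _) (ν y)] at h
  linarith

/-- The Weingarten equation. -/
theorem pairing_cov_normal_velocity (hy : y ∈ Ω) (i j : Fin m) :
    pairing G (Z y) (cov G Z i ν y) (velocity Z j y) = -secondForm G Z ν i j y := by
  have h := hS.pd_pairing hW hy i (hS.differentiableAt_normal hy)
    (hS.differentiableAt_velocity hy j)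
  rw [pd_congr i ((hS.eventually_mem hy).mono fun x hx => hS.normal x hx j), pd_const,
    pairing_comm (hW.symm _) (ν y)] at h
  rw [secondForm]
  linarith

/-- The Gauss formula for the tangential part of `∇_{∂_i} ∂_j Z`. -/
theorem christoffel_eq (hy : y ∈ Ω) (k i j : Fin m) : christoffel g k i j y
    = ∑ l, (g y)⁻¹ k l * pairing G (Z y) (cov G Z i (velocity Z j) y) (velocity Z l y) := by
  have h : ∀ a b c, pd a (fun x => g x b c) y
      = pairing G (Z y) (cov G Z a (velocity Z b) y) (velocity Z c y)
        + pairing G (Z y) (velocity Z b y) (cov G Z a (velocity Z c) y) := by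
    intro a b c
    rw [pd_congr a ((hS.eventually_mem hy).mono fun x hx => hS.apply x hx b c)]
    exact hS.pd_pairing hW hy a (hS.differentiableAt_velocity hy b)
      (hS.differentiableAt_velocity hy c)
  have hc : ∀ a b, cov G Z a (velocity Z b) y = cov G Z b (velocity Z a) y := fun a b =>
    cov_velocity_comm hW.symm (fun α => (hS.contDiffAt y hy α).of_le (by norm_num)) a b
  rw [christoffel, Finset.mul_sum]
  refine Finset.sum_congr rfl fun l _ => ?_
  rw [h, h, h, hc j i, hc l i, hc l j, pairing_comm (hW.symm _) (velocity Z i y),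
    pairing_comm (hW.symm _) (velocity Z j y)]
  ring

theorem pairing_cov_normal (hy : y ∈ Ω) (c : Fin m) (Y : Fin (m + 1) → ℝ) :
    pairing G (Z y) (cov G Z c ν y) Y
      = -∑ q, secondForm G Z ν c q y
          * ∑ l, (g y)⁻¹ q l * pairing G (Z y) Y (velocity Z l y) := by
  conv_lhs => rw [decomposition hW hS hy Y]
  rw [pairing_sub_right, pairing_smul_right, pairing_cov_normal_normal hW hS hy, pairing_sum_right,
    mul_zero, sub_zero, ← Finset.sum_neg_distrib]
  refine Finset.sum_congr rfl fun q _ => ?_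
  rw [pairing_smul_right, pairing_cov_normal_velocity hW hS hy]
  ring

theorem pairing_cov_normal_cov (hy : y ∈ Ω) (c a b : Fin m) :
    pairing G (Z y) (cov G Z c ν y) (cov G Z a (velocity Z b) y)
      = -∑ q, secondForm G Z ν c q y * christoffel g q a b y := by
  rw [pairing_cov_normal hW hS hy]
  simp_rw [christoffel_eq hW hS hy]

/-- `g^{ij} G(∇_i ν, ∇_j ν) = ‖h‖²`. -/
theorem sum_pairing_cov_normal (hy : y ∈ Ω) :
    ∑ i, ∑ j, (g y)⁻¹ i j * pairing G (Z y) (cov G Z i ν y) (cov G Z j ν y)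
      = ∑ i, ∑ j, ∑ k, ∑ l, (g y)⁻¹ i k * (g y)⁻¹ j l * secondForm G Z ν i j y
          * secondForm G Z ν k l y := by
  refine Finset.sum_congr rfl fun i _ => ?_
  rw [Finset.sum_comm]
  refine Finset.sum_congr rfl fun k _ => ?_
  rw [pairing_cov_normal hW hS hy, mul_neg, Finset.mul_sum, ← Finset.sum_neg_distrib]
  refine Finset.sum_congr rfl fun j _ => ?_
  rw [Finset.mul_sum, Finset.mul_sum, ← Finset.sum_neg_distrib]
  refine Finset.sum_congr rfl fun l _ => ?_
  rw [pairing_cov_normal_velocity hW hS hy]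
  ring

end IsHypersurface

end Hypersurface

/-! ### The Laplacian of the time component of the normal -/

section Laplacian

variable {m : ℕ} {f : ℝ → ℝ} {U : Set (EuclideanSpace ℝ (Fin (m + 1)))}
  {G : EuclideanSpace ℝ (Fin (m + 1)) → Matrix (Fin (m + 1)) (Fin (m + 1)) ℝ}
  {Ω : Set (EuclideanSpace ℝ (Fin m))}
  {g : EuclideanSpace ℝ (Fin m) → Matrix (Fin m) (Fin m) ℝ}
  {Z : EuclideanSpace ℝ (Fin m) → EuclideanSpace ℝ (Fin (m + 1))}
  {ν : EuclideanSpace ℝ (Fin m) → Fin (m + 1) → ℝ}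
  {y : EuclideanSpace ℝ (Fin m)}

namespace IsHypersurface

variable (hW : IsWarpedChart f U G) (hS : IsHypersurface U G Ω g Z ν)

include hW hS

theorem differentiableAt_secondForm (hy : y ∈ Ω) (i j : Fin m) :
    DifferentiableAt ℝ (secondForm G Z ν i j) y := by
  have hd : DifferentiableAt ℝ (fun x => -pairing G (Z x) (cov G Z i ν x) (velocity Z j x)) y :=
    (differentiableAt_pairing (fun α β => hW.differentiableAt (hS.mem y hy) α β)
      (hS.differentiableAt hy) (hS.differentiableAt_cov_normal hW hy i)
      (hS.differentiableAt_velocity hy j)).neg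
  refine hd.congr_of_eventuallyEq ((hS.eventually_mem hy).mono fun x hx => ?_)
  simp only [hS.pairing_cov_normal_velocity hW hx, neg_neg]

/-- The derivative of the second fundamental form in terms of `∇_i ∇_j ν`: the curvature enters when
the covariant derivatives `∇_k` and `∇_i` of the normal are exchanged. -/
theorem pd_secondForm (hy : y ∈ Ω) (k i j : Fin m) : pd k (secondForm G Z ν i j) y
    = -(pairing G (Z y) (cov G Z i (cov G Z j ν) y) (velocity Z k y)
          - ∑ q, christoffel g q i j y * pairing G (Z y) (cov G Z q ν y) (velocity Z k y))
      + ∑ q, christoffel g q i k y * secondForm G Z ν j q y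
      + ∑ q, christoffel g q k j y * secondForm G Z ν i q y
      + pairing G (Z y) (riemannVec G (Z y) (velocity Z i y) (velocity Z k y) (ν y))
          (velocity Z j y) := by
  have hcd := fun i => hS.differentiableAt_cov_normal hW hy i
  have hvd := fun j => hS.differentiableAt_velocity hy j
  have h1 : pd k (secondForm G Z ν i j) y
      = -(pairing G (Z y) (cov G Z k (cov G Z i ν) y) (velocity Z j y)
        + pairing G (Z y) (cov G Z i ν y) (cov G Z k (velocity Z j) y)) := by
    rw [← hS.pd_pairing hW hy k (hcd i) (hvd j), ← pd_neg]
    refine pd_congr k ((hS.eventually_mem hy).mono fun x hx => ?_)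
    simp only [hS.pairing_cov_normal_velocity hW hx, neg_neg]
  -- both sides are `-∂_i h_{kj} = -∂_i h_{jk}`
  have h2 : pairing G (Z y) (cov G Z i (cov G Z k ν) y) (velocity Z j y)
        + pairing G (Z y) (cov G Z k ν y) (cov G Z i (velocity Z j) y)
      = pairing G (Z y) (cov G Z i (cov G Z j ν) y) (velocity Z k y)
        + pairing G (Z y) (cov G Z j ν y) (cov G Z i (velocity Z k) y) := by
    rw [← hS.pd_pairing hW hy i (hcd k) (hvd j), ← hS.pd_pairing hW hy i (hcd j) (hvd k)]
    refine pd_congr i ((hS.eventually_mem hy).mono fun x hx => ?_)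
    simp only [hS.pairing_cov_normal_velocity hW hx, hS.secondForm_symm hW hx k j]
  -- the exchange of `∇_k` and `∇_i`
  have h3 : cov G Z k (cov G Z i ν) y = cov G Z i (cov G Z k ν) y
      - riemannVec G (Z y) (velocity Z i y) (velocity Z k y) (ν y) := by
    rw [← cov_cov_sub (hS.differentiableAt_christoffel hW hy)
      (fun α => (hS.contDiffAt y hy α).of_le (by norm_num)) (hS.contDiffAt_normal y hy)]
    abel
  have e : ∀ c a b : Fin m, pairing G (Z y) (cov G Z c ν y) (cov G Z a (velocity Z b) y)
      = -∑ q, christoffel g q a b y * secondForm G Z ν c q y := by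
    intro c a b
    rw [hS.pairing_cov_normal_cov hW hy]
    simp_rw [mul_comm]
  have e2 : ∑ q, christoffel g q i j y * pairing G (Z y) (cov G Z q ν y) (velocity Z k y)
      = -∑ q, christoffel g q i j y * secondForm G Z ν k q y := by
    rw [← Finset.sum_neg_distrib]
    refine Finset.sum_congr rfl fun q _ => ?_
    rw [hS.pairing_cov_normal_velocity hW hy, hS.secondForm_symm hW hy q k]
    ring
  rw [e, e] at h2
  rw [h1, h3, pairing_sub_left, e, e2]
  linarith

/-- `Ric(X, ν)` is a trace over tangent vectors alone: `G(R(ν, X) ν, ν) = 0` removes the normal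
direction. -/
theorem ricciForm_eq_sum (hy : y ∈ Ω) (X : Fin (m + 1) → ℝ) : ricciForm G (Z y) X (ν y)
    = ∑ i, ∑ j, (g y)⁻¹ i j * pairing G (Z y)
        (riemannVec G (Z y) (velocity Z i y) X (ν y)) (velocity Z j y) := by
  rw [ricciForm_eq_trace, hS.trace_eq hW hy]
  have : pairing G (Z y) (riemannLeft G (Z y) X (ν y) (ν y)) (ν y) = 0 :=
    pairing_riemannVec_self hW.isOpen (hS.mem y hy) hW.symm hW.det_ne_zero
      (fun x hx α β => (hW.contDiffAt x hx α β).of_le (by norm_cast))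
      (fun x hx γ α β => (hW.contDiffAt_christoffel hx γ α β).differentiableAt (by simp)) _ _ _
  rw [this, sub_zero]
  rfl

/-- The traced Codazzi equation. -/
theorem codazzi (hy : y ∈ Ω) (k : Fin m) :
    ∑ i, ∑ j, (g y)⁻¹ i j * (pairing G (Z y) (cov G Z i (cov G Z j ν) y) (velocity Z k y)
        - ∑ q, christoffel g q i j y * pairing G (Z y) (cov G Z q ν y) (velocity Z k y))
      = -pd k (meanCurv G g Z ν) y + ricciForm G (Z y) (velocity Z k y) (ν y) := by
  have hgd : ∀ i j, ContDiffAt ℝ 1 (fun x => g x i j) y := fun i j =>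
    (hS.contDiffAt_metric hW hy i j).of_le (by norm_num)
  have hPd : ∀ i j, DifferentiableAt ℝ (fun x => (g x)⁻¹ i j) y := fun i j =>
    (contDiffAt_matrix_inv hgd (hS.det_ne_zero y hy) i j).differentiableAt (by norm_num)
  have hhd := fun i j => hS.differentiableAt_secondForm hW hy i j
  have h1 : pd k (meanCurv G g Z ν) y = ∑ i, ∑ j,
      (pd k (fun x => (g x)⁻¹ i j) y * secondForm G Z ν i j y
        + (g y)⁻¹ i j * pd k (secondForm G Z ν i j) y) := by
    unfold meanCurv
    rw [pd_sum _ _ fun i _ => DifferentiableAt.fun_sum fun j _ => (hPd i j).fun_mul (hhd i j)]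
    refine Finset.sum_congr rfl fun i _ => ?_
    rw [pd_sum _ _ fun j _ => (hPd i j).fun_mul (hhd i j)]
    exact Finset.sum_congr rfl fun j _ => pd_mul k (hPd i j) (hhd i j)
  -- the derivative of the inverse metric cancels the Christoffel terms of `∂_k h_{ij}`
  have h2 : ∑ i, ∑ j, pd k (fun x => (g x)⁻¹ i j) y * secondForm G Z ν i j y
      = -∑ i, ∑ j, (g y)⁻¹ i j * (∑ q, christoffel g q i k y * secondForm G Z ν j q y)
        - ∑ i, ∑ j, (g y)⁻¹ i j * (∑ q, christoffel g q k j y * secondForm G Z ν i q y) := by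
    have e1 : ∀ i j, pd k (fun x => (g x)⁻¹ i j) y * secondForm G Z ν i j y
        = -∑ b, (g y)⁻¹ b j * (christoffel g i b k y * secondForm G Z ν j i y)
          - ∑ a, (g y)⁻¹ i a * (christoffel g j k a y * secondForm G Z ν i j y) := by
      intro i j
      rw [pd_inv_metric hS.symm (hS.det_ne_zero y hy) hgd, sub_mul, neg_mul, Finset.sum_mul,
        Finset.sum_mul]
      have s1 : ∀ a, (g y)⁻¹ i a * christoffel g j k a y * secondForm G Z ν i j y
          = (g y)⁻¹ i a * (christoffel g j k a y * secondForm G Z ν i j y) := fun a => by ring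
      have s2 : ∀ b, christoffel g i k b y * (g y)⁻¹ b j * secondForm G Z ν i j y
          = (g y)⁻¹ b j * (christoffel g i b k y * secondForm G Z ν j i y) := fun b => by
        rw [christoffel_symm hS.symm i k b, hS.secondForm_symm hW hy i j]
        ring
      rw [Finset.sum_congr rfl fun a _ => s1 a, Finset.sum_congr rfl fun a _ => s2 a]
      ring
    have e2 : ∑ i, ∑ j, ∑ b, (g y)⁻¹ b j * (christoffel g i b k y * secondForm G Z ν j i y)
        = ∑ i, ∑ j, (g y)⁻¹ i j * ∑ q, christoffel g q i k y * secondForm G Z ν j q y := by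
      simp only [Finset.mul_sum]
      calc _ = ∑ j, ∑ i, ∑ b, (g y)⁻¹ b j * (christoffel g i b k y * secondForm G Z ν j i y) :=
            Finset.sum_comm
        _ = ∑ j, ∑ b, ∑ i, (g y)⁻¹ b j * (christoffel g i b k y * secondForm G Z ν j i y) :=
            Finset.sum_congr rfl fun j _ => Finset.sum_comm
        _ = _ := Finset.sum_comm
    have e3 : ∑ i, ∑ j, ∑ a, (g y)⁻¹ i a * (christoffel g j k a y * secondForm G Z ν i j y)
        = ∑ i, ∑ j, (g y)⁻¹ i j * ∑ q, christoffel g q k j y * secondForm G Z ν i q y := by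
      simp only [Finset.mul_sum]
      exact Finset.sum_congr rfl fun i _ => Finset.sum_comm
    rw [← e2, ← e3, ← Finset.sum_neg_distrib, ← Finset.sum_sub_distrib]
    refine Finset.sum_congr rfl fun i _ => ?_
    rw [← Finset.sum_neg_distrib, ← Finset.sum_sub_distrib]
    exact Finset.sum_congr rfl fun j _ => e1 i j
  simp_rw [h1, Finset.sum_add_distrib, h2, hS.pd_secondForm hW hy, mul_add, Finset.sum_add_distrib,
    mul_neg, Finset.sum_neg_distrib, ← hS.ricciForm_eq_sum hW hy]
  ring

/-- The time component of a covariant derivative. -/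
theorem pd_time_component (hy : y ∈ Ω) (i : Fin m) (W : EuclideanSpace ℝ (Fin m) → Fin (m + 1) → ℝ) :
    pd i (fun x => W x 0) y = cov G Z i W y 0
      - deriv f (Z y 0) / f (Z y 0) * (pairing G (Z y) (velocity Z i y) (W y)
          + velocity Z i y 0 * W y 0) := by
  simp only [cov, Pi.add_apply, hW.gammaForm_apply_zero (hS.mem y hy)]
  ring

theorem time_component (hy : y ∈ Ω) (Y : Fin (m + 1) → ℝ) :
    Y 0 = ∑ i, (∑ j, (g y)⁻¹ i j * pairing G (Z y) Y (velocity Z j y)) * velocity Z i y 0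
      - pairing G (Z y) Y (ν y) * ν y 0 := by
  conv_lhs => rw [decomposition hW hS hy Y]
  simp [Finset.sum_apply]

theorem pd_normal_time (hy : y ∈ Ω) (j : Fin m) : pd j (fun x => ν x 0) y
    = cov G Z j ν y 0 - deriv f (Z y 0) / f (Z y 0) * (velocity Z j y 0 * ν y 0) := by
  rw [hS.pd_time_component hW hy j ν,
    pairing_comm (hW.symm _) (velocity Z j y), hS.normal y hy]
  ring

/-- The Hessian of the height function `u = Z^0`. -/
theorem hessian_height (hy : y ∈ Ω) (i j : Fin m) :
    pd i (fun x => velocity Z j x 0) y - ∑ k, christoffel g k i j y * velocity Z k y 0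
      = -(secondForm G Z ν i j y * ν y 0)
        - deriv f (Z y 0) / f (Z y 0) * (g y i j + velocity Z i y 0 * velocity Z j y 0) := by
  rw [hS.pd_time_component hW hy i (velocity Z j), ← hS.apply y hy,
    hS.time_component hW hy (cov G Z i (velocity Z j) y)]
  simp_rw [← hS.christoffel_eq hW hy]
  rw [← secondForm]
  ring

/-- The Hessian of `v = ν^0`. -/
theorem hessian_normal_time (hy : y ∈ Ω) (i j : Fin m) :
    pd i (pd j (fun x => ν x 0)) y - ∑ k, christoffel g k i j y * pd k (fun x => ν x 0) y
      = (cov G Z i (cov G Z j ν) y 0 - ∑ k, christoffel g k i j y * cov G Z k ν y 0)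
        + deriv f (Z y 0) / f (Z y 0) * secondForm G Z ν i j y
        - deriv f (Z y 0) / f (Z y 0) * (velocity Z i y 0 * pd j (fun x => ν x 0) y)
        - deriv f (Z y 0) / f (Z y 0) * (velocity Z j y 0 * pd i (fun x => ν x 0) y)
        - deriv (deriv f) (Z y 0) / f (Z y 0) * (velocity Z i y 0 * velocity Z j y 0) * ν y 0
        + deriv f (Z y 0) / f (Z y 0) * (secondForm G Z ν i j y * ν y 0
          + deriv f (Z y 0) / f (Z y 0) * (g y i j + velocity Z i y 0 * velocity Z j y 0))
          * ν y 0 := by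
  have hu := hS.differentiableAt hy 0
  have hη := hW.differentiableAt_logDeriv hu
  have hvj := hS.differentiableAt_velocity hy j 0
  have hν := hS.differentiableAt_normal hy 0
  have h1 : pd i (pd j (fun x => ν x 0)) y = pd i (fun x => cov G Z j ν x 0) y
      - ((deriv (deriv f) (Z y 0) / f (Z y 0) - (deriv f (Z y 0) / f (Z y 0)) ^ 2)
          * velocity Z i y 0 * (velocity Z j y 0 * ν y 0)
        + deriv f (Z y 0) / f (Z y 0) * (pd i (fun x => velocity Z j x 0) y * ν y 0
          + velocity Z j y 0 * pd i (fun x => ν x 0) y)) := by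
    rw [pd_congr i ((hS.eventually_mem hy).mono fun x hx => hS.pd_normal_time hW hx j),
      pd_sub i (hS.differentiableAt_cov_normal hW hy j 0) (hη.fun_mul (hvj.fun_mul hν)),
      pd_mul i hη (hvj.fun_mul hν), pd_mul i hvj hν, hW.pd_logDeriv hu]
    rfl
  have h2 := hS.pd_time_component hW hy i (cov G Z j ν)
  rw [pairing_comm (hW.symm _) (velocity Z i y), hS.pairing_cov_normal_velocity hW hy,
    hS.secondForm_symm hW hy j i] at h2
  have h3 : ∑ k, christoffel g k i j y * pd k (fun x => ν x 0) y
      = ∑ k, christoffel g k i j y * cov G Z k ν y 0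
        - deriv f (Z y 0) / f (Z y 0) * ν y 0
          * ∑ k, christoffel g k i j y * velocity Z k y 0 := by
    rw [Finset.mul_sum, ← Finset.sum_sub_distrib]
    refine Finset.sum_congr rfl fun k _ => ?_
    rw [hS.pd_normal_time hW hy]
    ring
  have h4 := hS.hessian_height hW hy i j
  have h5 := hS.pd_normal_time hW hy j
  rw [sub_eq_iff_eq_add] at h4
  rw [h1, h2, h3, h4, h5]
  ring

end IsHypersurface

end Laplacian

section Evolution

variable {m : ℕ} {f : ℝ → ℝ} {U : Set (EuclideanSpace ℝ (Fin (m + 1)))}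
  {G : EuclideanSpace ℝ (Fin (m + 1)) → Matrix (Fin (m + 1)) (Fin (m + 1)) ℝ}
  {Ω : Set (EuclideanSpace ℝ (Fin m))}
  {g : EuclideanSpace ℝ (Fin m) → Matrix (Fin m) (Fin m) ℝ}
  {Z : EuclideanSpace ℝ (Fin m) → EuclideanSpace ℝ (Fin (m + 1))}
  {ν : EuclideanSpace ℝ (Fin m) → Fin (m + 1) → ℝ}
  {y : EuclideanSpace ℝ (Fin m)}

theorem IsWarpedChart.ricciForm_time_left (hW : IsWarpedChart f U G)
    {z : EuclideanSpace ℝ (Fin (m + 1))} (hz : z ∈ U) (Y : Fin (m + 1) → ℝ) :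
    ricciForm G z (Pi.single 0 1) Y = -(m * (deriv (deriv f) (z 0) / f (z 0))) * Y 0 := by
  rw [ricciForm, Finset.sum_eq_single 0]
  · rw [Finset.sum_eq_single 0]
    · simp [hW.ricci_time hz]
    · intro β _ hβ
      simp [hW.ricci_time hz, hβ]
    · simp
  · intro α _ hα
    simp [hα]
  · simp

namespace IsHypersurface

variable (hW : IsWarpedChart f U G) (hS : IsHypersurface U G Ω g Z ν)

include hW hS

/-- The time component of the rough Laplacian `g^{ij} (∇_i ∇_j ν - Γ^k_{ij} ∇_k ν)` of the normal:
the Codazzi equation for its tangential part, `G(∇_i ∇_j ν, ν) = -G(∇_i ν, ∇_j ν)` for its normal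
part. -/
theorem rough_laplacian_normal_time (hy : y ∈ Ω) :
    ∑ i, ∑ j, (g y)⁻¹ i j * (cov G Z i (cov G Z j ν) y 0
        - ∑ k, christoffel g k i j y * cov G Z k ν y 0)
      = -∑ i, ∑ j, (g y)⁻¹ i j * velocity Z i y 0 * pd j (meanCurv G g Z ν) y
        + ricciForm G (Z y) (ν y) (ν y) * ν y 0
        + m * (deriv (deriv f) (Z y 0) / f (Z y 0)) * ν y 0
        + (∑ i, ∑ j, ∑ k, ∑ l, (g y)⁻¹ i k * (g y)⁻¹ j l * secondForm G Z ν i j y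
          * secondForm G Z ν k l y) * ν y 0 := by
  -- the tangential components of `∇_i ∇_j ν - Γ^k_{ij} ∇_k ν`
  set C : Fin m → Fin m → Fin m → ℝ := fun i j b =>
    pairing G (Z y) (cov G Z i (cov G Z j ν) y) (velocity Z b y)
      - ∑ q, christoffel g q i j y * pairing G (Z y) (cov G Z q ν y) (velocity Z b y) with hC
  have h1 : ∀ i j, pairing G (Z y) (cov G Z i (cov G Z j ν) y) (ν y)
      = -pairing G (Z y) (cov G Z i ν y) (cov G Z j ν y) := by
    intro i j
    have h := hS.pd_pairing hW hy i (hS.differentiableAt_cov_normal hW hy j)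
      (hS.differentiableAt_normal hy)
    rw [pd_congr i ((hS.eventually_mem hy).mono fun x hx => hS.pairing_cov_normal_normal hW hx j),
      pd_const, pairing_comm (hW.symm _) (cov G Z j ν y)] at h
    linarith
  have h2 : ∀ i j, cov G Z i (cov G Z j ν) y 0 - ∑ k, christoffel g k i j y * cov G Z k ν y 0
      = ∑ a, ∑ b, (g y)⁻¹ a b * velocity Z a y 0 * C i j b
        + pairing G (Z y) (cov G Z i ν y) (cov G Z j ν y) * ν y 0 := by
    intro i j
    have e1 : ∀ k, cov G Z k ν y 0 = ∑ a, ∑ b, (g y)⁻¹ a b * velocity Z a y 0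
        * pairing G (Z y) (cov G Z k ν y) (velocity Z b y) := by
      intro k
      rw [hS.time_component hW hy (cov G Z k ν y), hS.pairing_cov_normal_normal hW hy, zero_mul,
        sub_zero]
      refine Finset.sum_congr rfl fun a _ => ?_
      rw [Finset.sum_mul]
      exact Finset.sum_congr rfl fun b _ => by ring
    have e2 : ∑ k, christoffel g k i j y * cov G Z k ν y 0
        = ∑ a, ∑ b, (g y)⁻¹ a b * velocity Z a y 0 * ∑ q, christoffel g q i j y
          * pairing G (Z y) (cov G Z q ν y) (velocity Z b y) := by
      simp_rw [e1, Finset.mul_sum]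
      rw [Finset.sum_comm]
      refine Finset.sum_congr rfl fun a _ => ?_
      rw [Finset.sum_comm]
      exact Finset.sum_congr rfl fun b _ => Finset.sum_congr rfl fun q _ => by ring
    rw [e2, hS.time_component hW hy (cov G Z i (cov G Z j ν) y), h1]
    simp only [hC, mul_sub, Finset.sum_sub_distrib, Finset.sum_mul]
    have e3 : ∀ a b, (g y)⁻¹ a b * pairing G (Z y) (cov G Z i (cov G Z j ν) y) (velocity Z b y)
        * velocity Z a y 0 = (g y)⁻¹ a b * velocity Z a y 0
          * pairing G (Z y) (cov G Z i (cov G Z j ν) y) (velocity Z b y) := fun a b => by ring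
    rw [Finset.sum_congr rfl fun a _ => Finset.sum_congr rfl fun b _ => e3 a b]
    ring
  have h3 : ∑ i, ∑ j, (g y)⁻¹ i j * ∑ a, ∑ b, (g y)⁻¹ a b * velocity Z a y 0 * C i j b
      = ∑ a, ∑ b, (g y)⁻¹ a b * velocity Z a y 0 * ∑ i, ∑ j, (g y)⁻¹ i j * C i j b := by
    simp only [Finset.mul_sum]
    calc _ = ∑ i, ∑ a, ∑ j, ∑ b, (g y)⁻¹ i j * ((g y)⁻¹ a b * velocity Z a y 0 * C i j b) :=
          Finset.sum_congr rfl fun i _ => Finset.sum_comm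
      _ = ∑ a, ∑ i, ∑ j, ∑ b, (g y)⁻¹ i j * ((g y)⁻¹ a b * velocity Z a y 0 * C i j b) :=
          Finset.sum_comm
      _ = ∑ a, ∑ i, ∑ b, ∑ j, (g y)⁻¹ i j * ((g y)⁻¹ a b * velocity Z a y 0 * C i j b) :=
          Finset.sum_congr rfl fun a _ => Finset.sum_congr rfl fun i _ => Finset.sum_comm
      _ = ∑ a, ∑ b, ∑ i, ∑ j, (g y)⁻¹ i j * ((g y)⁻¹ a b * velocity Z a y 0 * C i j b) :=
          Finset.sum_congr rfl fun a _ => Finset.sum_comm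
      _ = _ := by
          refine Finset.sum_congr rfl fun a _ => Finset.sum_congr rfl fun b _ =>
            Finset.sum_congr rfl fun i _ => Finset.sum_congr rfl fun j _ => ?_
          ring
  -- `Ric(∇u, ν)`, by `∇u = v ν - ∂_t` and the value of `Ric(∂_t, ν)`
  have h4 : ∑ a, ∑ b, (g y)⁻¹ a b * velocity Z a y 0
        * ricciForm G (Z y) (velocity Z b y) (ν y)
      = ricciForm G (Z y) (ν y) (ν y) * ν y 0
        + m * (deriv (deriv f) (Z y 0) / f (Z y 0)) * ν y 0 := by
    have e := congrArg (ricciLeft G (Z y) (ν y)) ((hS.isFrame hW hy).time_decomposition hW)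
    rw [map_sum, map_sub, map_smul] at e
    simp only [map_smul, smul_eq_mul] at e
    have e2 : ricciLeft G (Z y) (ν y) (Pi.single 0 1) = _ :=
      hW.ricciForm_time_left (hS.mem y hy) (ν y)
    rw [e2] at e
    rw [Finset.sum_comm]
    refine Eq.trans (Finset.sum_congr rfl fun b _ => ?_) (e.trans ?_)
    · rw [Finset.sum_mul]
      refine Finset.sum_congr rfl fun a _ => ?_
      rw [inv_apply_symm (hS.symm y) a b]
      rfl
    · change ν y 0 * ricciForm G (Z y) (ν y) (ν y) - _ = _
      ring
  simp_rw [h2, mul_add, Finset.sum_add_distrib]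
  rw [h3, Finset.sum_congr rfl fun a _ => Finset.sum_congr rfl fun b _ => by
    rw [hS.codazzi hW hy b, mul_add]]
  simp_rw [Finset.sum_add_distrib, mul_neg, Finset.sum_neg_distrib]
  rw [h4, ← hS.sum_pairing_cov_normal hW hy]
  simp_rw [Finset.sum_mul, mul_assoc]
  ring

/-- The Laplacian of the gradient function `v = ν^0` of a space-like hypersurface. -/
theorem laplacian_normal_time (hy : y ∈ Ω) : laplacian g (fun x => ν x 0) y
    = -(∑ i, ∑ j, ∑ k, ∑ l, (g y)⁻¹ i k * (g y)⁻¹ j l * secondForm G Z ν i j y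
          * secondForm G Z ν k l y) * ν y 0
      - ricciForm G (Z y) (ν y) (ν y) * ν y 0
      + ∑ i, ∑ j, (g y)⁻¹ i j * velocity Z i y 0 * pd j (meanCurv G g Z ν) y
      - deriv f (Z y 0) / f (Z y 0) * meanCurv G g Z ν y
      - deriv f (Z y 0) / f (Z y 0) * meanCurv G g Z ν y * ν y 0 ^ 2
      + 2 * (deriv f (Z y 0) / f (Z y 0))
        * ∑ i, ∑ j, (g y)⁻¹ i j * velocity Z i y 0 * pd j (fun x => ν x 0) y
      - m * (deriv (deriv f) (Z y 0) / f (Z y 0)) * ν y 0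
      - (deriv f (Z y 0) / f (Z y 0)) ^ 2
        * (∑ i, ∑ j, (g y)⁻¹ i j * velocity Z i y 0 * velocity Z j y 0) * ν y 0
      + deriv (deriv f) (Z y 0) / f (Z y 0)
        * (∑ i, ∑ j, (g y)⁻¹ i j * velocity Z i y 0 * velocity Z j y 0) * ν y 0
      - m * (deriv f (Z y 0) / f (Z y 0)) ^ 2 * ν y 0 := by
  have hgd : ∀ i j, ContDiffAt ℝ 1 (fun x => g x i j) y := fun i j =>
    (hS.contDiffAt_metric hW hy i j).of_le (by norm_num)
  rw [laplacian_eq hS.symm (hS.det_ne_zero y hy) hgd (hS.contDiffAt_normal y hy 0)]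
  set η := deriv f (Z y 0) / f (Z y 0)
  set ζ := deriv (deriv f) (Z y 0) / f (Z y 0)
  have h1 : ∀ i j, (g y)⁻¹ i j * (pd i (pd j (fun x => ν x 0)) y
        - ∑ k, christoffel g k i j y * pd k (fun x => ν x 0) y)
      = (g y)⁻¹ i j * (cov G Z i (cov G Z j ν) y 0
          - ∑ k, christoffel g k i j y * cov G Z k ν y 0)
        + (η + η * ν y 0 ^ 2) * ((g y)⁻¹ i j * secondForm G Z ν i j y)
        - η * ((g y)⁻¹ i j * velocity Z i y 0 * pd j (fun x => ν x 0) y)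
        - η * ((g y)⁻¹ i j * velocity Z j y 0 * pd i (fun x => ν x 0) y)
        + (η ^ 2 * ν y 0 - ζ * ν y 0) * ((g y)⁻¹ i j * velocity Z i y 0 * velocity Z j y 0)
        + η ^ 2 * ν y 0 * ((g y)⁻¹ i j * g y i j) := by
    intro i j
    rw [hS.hessian_normal_time hW hy]
    ring
  have h2 : ∑ i, ∑ j, (g y)⁻¹ i j * g y i j = m := by
    have : ∀ i, ∑ j, (g y)⁻¹ i j * g y i j = 1 := by
      intro i
      rw [Finset.sum_congr rfl fun j _ => by rw [← (hS.symm y).apply i j],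
        sum_inv_mul (hS.det_ne_zero y hy), if_pos rfl]
    simp [this]
  have h3 : ∑ i, ∑ j, (g y)⁻¹ i j * velocity Z j y 0 * pd i (fun x => ν x 0) y
      = ∑ i, ∑ j, (g y)⁻¹ i j * velocity Z i y 0 * pd j (fun x => ν x 0) y := by
    rw [Finset.sum_comm]
    exact Finset.sum_congr rfl fun i _ => Finset.sum_congr rfl fun j _ => by
      rw [inv_apply_symm (hS.symm y)]
  rw [Finset.sum_congr rfl fun i _ => Finset.sum_congr rfl fun j _ => h1 i j]
  simp only [Finset.sum_add_distrib, Finset.sum_sub_distrib, ← Finset.mul_sum]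
  rw [hS.rough_laplacian_normal_time hW hy, h2, h3, ← meanCurv]
  ring

/-! ### The time derivative of the normal -/

/-- The time derivative of `ν^0` when the hypersurface moves with velocity `ρ ν`: here `c`, `N` and
`X i` are the evolutions of a point of the hypersurface, of the normal and of the coordinate vectors
at that point, and the derivatives may be one-sided. -/
theorem deriv_normal_time (hy : y ∈ Ω) {S : Set ℝ} {s : ℝ} (hs : s ∈ S)
    (hSd : UniqueDiffWithinAt ℝ S s) {c : ℝ → EuclideanSpace ℝ (Fin (m + 1))}
    {N : ℝ → Fin (m + 1) → ℝ} {X : Fin m → ℝ → Fin (m + 1) → ℝ} {N' : Fin (m + 1) → ℝ}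
    {ρ : EuclideanSpace ℝ (Fin m) → ℝ} (hρ : DifferentiableAt ℝ ρ y)
    (hcs : c s = Z y) (hNs : N s = ν y) (hXs : ∀ i, X i s = velocity Z i y)
    (hc : ∀ α, HasDerivWithinAt (fun σ => c σ α) (ρ y * ν y α) S s)
    (hN : ∀ α, HasDerivWithinAt (fun σ => N σ α) (N' α) S s)
    (hX : ∀ i α, HasDerivWithinAt (fun σ => X i σ α) (pd i (fun x => ρ x * ν x α) y) S s)
    (hNX : ∀ σ ∈ S, ∀ i, pairing G (c σ) (N σ) (X i σ) = 0)
    (hNN : ∀ σ ∈ S, pairing G (c σ) (N σ) (N σ) = -1) :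
    N' 0 = -(ρ y * (deriv f (Z y 0) / f (Z y 0)) * (ν y 0 ^ 2 - 1))
      + ∑ i, ∑ j, (g y)⁻¹ i j * velocity Z i y 0 * pd j ρ y := by
  have hz := hS.mem y hy
  have hdet : (G (c s)).det ≠ 0 := hcs ▸ hW.det_ne_zero _ hz
  have hGd : ∀ α β, DifferentiableAt ℝ (fun x => G x α β) (c s) := fun α β =>
    hcs ▸ hW.differentiableAt hz α β
  have hcomm := pairing_comm (hW.symm (Z y))
  -- `DN` is the covariant derivative of the normal in `s`
  set DN : Fin (m + 1) → ℝ := N' + gammaForm G (Z y) (fun α => ρ y * ν y α) (ν y) with hDN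
  -- the covariant derivative of `∂_i Z` in `s` is `∇_i (ρ ν)`
  have hDX : ∀ i, (fun α => pd i (fun x => ρ x * ν x α) y)
        + gammaForm G (Z y) (fun α => ρ y * ν y α) (velocity Z i y)
      = pd i ρ y • ν y + ρ y • cov G Z i ν y := by
    intro i
    have e1 : (fun α => ρ y * ν y α) = ρ y • ν y := rfl
    have e2 : (fun α => pd i (fun x => ρ x * ν x α) y)
        = pd i ρ y • ν y + ρ y • (fun α => pd i (fun x => ν x α) y) := by
      funext α
      rw [pd_mul i hρ (hS.differentiableAt_normal hy α)]
      rfl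
    rw [e1, e2, gammaForm_smul_left, gammaForm_comm _ hW.symm (ν y), cov, smul_add, add_assoc]
  have h1 : ∀ i, pairing G (Z y) DN (velocity Z i y) = pd i ρ y := by
    intro i
    have h := hasDerivWithinAt_pairing hW.symm hdet hGd hc hN (hX i)
    have h0 := hSd.eq_deriv _ h
      ((hasDerivWithinAt_const s S (0 : ℝ)).congr (fun σ hσ => hNX σ hσ i) (hNX s hs i))
    rw [hcs, hNs, hXs, hDX, pairing_add_right, pairing_smul_right, pairing_smul_right, hS.unit y hy,
      hcomm (ν y) (cov G Z i ν y), hS.pairing_cov_normal_normal hW hy] at h0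
    linarith
  have h2 : pairing G (Z y) DN (ν y) = 0 := by
    have h := hasDerivWithinAt_pairing hW.symm hdet hGd hc hN hN
    have h0 := hSd.eq_deriv _ h
      ((hasDerivWithinAt_const s S (-1 : ℝ)).congr hNN (hNN s hs))
    rw [hcs, hNs, hcomm (ν y), ← hDN] at h0
    linarith
  have h3 := hS.time_component hW hy DN
  simp_rw [h1, h2] at h3
  have h4 : DN 0 = N' 0 + gammaForm G (Z y) (ρ y • ν y) (ν y) 0 := rfl
  rw [gammaForm_smul_left, Pi.smul_apply, hW.gammaForm_apply_zero hz, hS.unit y hy, h3,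
    smul_eq_mul] at h4
  simp_rw [Finset.sum_mul] at h4
  have h5 : ∀ i j, (g y)⁻¹ i j * pd j ρ y * velocity Z i y 0
      = (g y)⁻¹ i j * velocity Z i y 0 * pd j ρ y := fun i j => by ring
  rw [Finset.sum_congr rfl fun i _ => Finset.sum_congr rfl fun j _ => h5 i j] at h4
  linear_combination -h4

end IsHypersurface

end Evolution

/-! ### Exchanging time and space derivatives -/

section Exchange

variable {κ : Type*} [Fintype κ] [DecidableEq κ]

/-- If `∂_s w = w'` on `S × Ω` and the spatial derivative `∂_i w'` is jointly continuous, then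
`∂_s ∂_i w = ∂_i w'`. No regularity of `w` in `s` is needed: the difference quotients of `w` in
the direction `i` satisfy a mean value inequality in `s`, which passes to the limit. -/
theorem hasDerivWithinAt_pd {S : Set ℝ} {Ω : Set (EuclideanSpace ℝ κ)} (hS : Convex ℝ S)
    (hΩ : IsOpen Ω) {w w' : ℝ → EuclideanSpace ℝ κ → ℝ} (i : κ) {s₀ : ℝ} (hs₀ : s₀ ∈ S)
    {y₀ : EuclideanSpace ℝ κ} (hy₀ : y₀ ∈ Ω)
    (hw : ∀ s ∈ S, ∀ y ∈ Ω, HasDerivWithinAt (fun σ => w σ y) (w' s y) S s)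
    (hd : ∀ s ∈ S, ∀ y ∈ Ω, DifferentiableAt ℝ (w s) y)
    (hd' : ∀ s ∈ S, ∀ y ∈ Ω, DifferentiableAt ℝ (w' s) y)
    (hc : ContinuousWithinAt (fun q : ℝ × EuclideanSpace ℝ κ => pd i (w' q.1) q.2) (S ×ˢ Ω)
      (s₀, y₀)) :
    HasDerivWithinAt (fun σ => pd i (w σ) y₀) (pd i (w' s₀) y₀) S s₀ := by
  set e : EuclideanSpace ℝ κ := EuclideanSpace.single i (1 : ℝ) with he
  set a := pd i (w' s₀) y₀ with ha
  rw [hasDerivWithinAt_iff_isLittleO, Asymptotics.isLittleO_iff]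
  intro ε hε
  obtain ⟨δ₁, hδ₁, h1⟩ := Metric.continuousWithinAt_iff.1 hc ε hε
  obtain ⟨δ₂, hδ₂, h2⟩ := Metric.isOpen_iff.1 hΩ y₀ hy₀
  set δ := min δ₁ δ₂ with hδ
  have hδ0 : 0 < δ := lt_min hδ₁ hδ₂
  have hdist : ∀ t : ℝ, |t| < δ → dist (y₀ + t • e) y₀ < δ := by
    intro t ht
    rw [dist_eq_norm, add_sub_cancel_left, norm_smul, he, PiLp.norm_single]
    simpa using ht
  have hmem : ∀ t : ℝ, |t| < δ → y₀ + t • e ∈ Ω := fun t ht =>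
    h2 ((hdist t ht).trans_le (min_le_right _ _))
  have hest : ∀ s ∈ S, |s - s₀| < δ → ∀ t : ℝ, |t| < δ →
      |pd i (w' s) (y₀ + t • e) - a| ≤ ε := by
    intro s hs hss t ht
    have := h1 (x := (s, y₀ + t • e)) ⟨hs, hmem t ht⟩ (by
      rw [Prod.dist_eq, max_lt_iff]
      exact ⟨(Real.dist_eq s s₀ ▸ hss).trans_le (min_le_left _ _),
        (hdist t ht).trans_le (min_le_left _ _)⟩)
    rw [Real.dist_eq] at this
    exact this.le
  -- the mean value theorem in the direction `i`, for the right hand side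
  have hslope : ∀ s ∈ S, |s - s₀| < δ → ∀ t : ℝ, 0 < t → t < δ →
      |(w' s (y₀ + t • e) - w' s y₀) / t - a| ≤ ε := by
    intro s hs hss t ht0 ht
    have hline : ∀ x ∈ Set.Icc 0 t, HasDerivAt (fun σ : ℝ => w' s (y₀ + σ • e))
        (pd i (w' s) (y₀ + x • e)) x := fun x hx =>
      hasDerivAt_line_of_differentiableAt i (hd' s hs _ (hmem x (by
        rw [abs_of_nonneg hx.1]
        exact hx.2.trans_lt ht)))
    obtain ⟨x, hx, hxe⟩ := exists_hasDerivAt_eq_slope (fun σ : ℝ => w' s (y₀ + σ • e))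
      (fun x => pd i (w' s) (y₀ + x • e)) ht0
      (fun x hx => (hline x hx).continuousAt.continuousWithinAt)
      (fun x hx => hline x ⟨hx.1.le, hx.2.le⟩)
    simp only [zero_smul, add_zero, sub_zero] at hxe
    rw [← hxe]
    exact hest s hs hss x (by
      rw [abs_of_pos hx.1]
      exact hx.2.trans ht)
  have hconv : Convex ℝ (S ∩ Metric.ball s₀ δ) := hS.inter (convex_ball _ _)
  -- the mean value inequality in `s` for the difference quotients of `w`, uniformly in `t`
  have hquot : ∀ σ ∈ S, |σ - s₀| < δ → ∀ t : ℝ, 0 < t → t < δ →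
      |(w σ (y₀ + t • e) - w σ y₀) / t - (w s₀ (y₀ + t • e) - w s₀ y₀) / t - (σ - s₀) * a|
        ≤ ε * |σ - s₀| := by
    intro σ hσ hσs t ht0 ht
    have hder : ∀ x ∈ S ∩ Metric.ball s₀ δ, HasDerivWithinAt
        (fun x => (w x (y₀ + t • e) - w x y₀) / t - x * a)
        ((w' x (y₀ + t • e) - w' x y₀) / t - a) (S ∩ Metric.ball s₀ δ) x := by
      intro x hx
      have e1 := hw x hx.1 _ (hmem t (by rwa [abs_of_pos ht0]))
      have e2 := hw x hx.1 _ hy₀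
      have e3 := ((e1.fun_sub e2).div_const t).fun_sub ((hasDerivWithinAt_id x S).mul_const a)
      simp only [id, one_mul] at e3
      exact e3.mono Set.inter_subset_left
    have hb : ∀ x ∈ S ∩ Metric.ball s₀ δ, ‖(w' x (y₀ + t • e) - w' x y₀) / t - a‖ ≤ ε :=
      fun x hx => hslope x hx.1 (by simpa [Real.dist_eq] using hx.2) t ht0 ht
    have := hconv.norm_image_sub_le_of_norm_hasDerivWithin_le hder hb
      (x := s₀) (y := σ) ⟨hs₀, Metric.mem_ball_self hδ0⟩
      ⟨hσ, by simpa [Real.dist_eq] using hσs⟩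
    rw [Real.norm_eq_abs, Real.norm_eq_abs] at this
    convert this using 2
    ring
  have hlim : ∀ σ ∈ S, Filter.Tendsto (fun t : ℝ => (w σ (y₀ + t • e) - w σ y₀) / t)
      (nhdsWithin 0 (Set.Ioi 0)) (nhds (pd i (w σ) y₀)) := by
    intro σ hσ
    have h := (hasDerivAt_line i (hd σ hσ y₀ hy₀)).tendsto_slope_zero_right
    refine h.congr fun t => ?_
    simp only [zero_add, zero_smul, add_zero, smul_eq_mul]
    ring
  have hnear : ∀ᶠ σ in nhdsWithin s₀ S, |σ - s₀| < δ :=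
    nhdsWithin_le_nhds (Metric.ball_mem_nhds s₀ hδ0)
  filter_upwards [hnear, self_mem_nhdsWithin] with σ hσs hσ
  have htend := (((hlim σ hσ).sub (hlim s₀ hs₀)).sub_const ((σ - s₀) * a)).abs
  refine le_of_tendsto htend ?_
  have : Set.Ioo 0 δ ∈ nhdsWithin (0 : ℝ) (Set.Ioi 0) := Ioo_mem_nhdsGT hδ0
  filter_upwards [this] with t ht
  exact hquot σ hσ hσs t ht.1 ht.2

/-- The spatial derivative of `Θ ∘ j` is jointly continuous when `Θ` is `C¹` and `j` and its spatial
derivative are jointly continuous. -/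
theorem continuousOn_pd_comp {J : Type*} [NormedAddCommGroup J] [NormedSpace ℝ J]
    {D : Set (ℝ × EuclideanSpace ℝ κ)} {Θ : J → ℝ} {j j' : ℝ → EuclideanSpace ℝ κ → J} (i : κ)
    (hΘ : ∀ q ∈ D, ContDiffAt ℝ 1 Θ (j q.1 q.2))
    (hj : ContinuousOn (fun q : ℝ × EuclideanSpace ℝ κ => j q.1 q.2) D)
    (hj' : ContinuousOn (fun q : ℝ × EuclideanSpace ℝ κ => j' q.1 q.2) D)
    (hjd : ∀ q ∈ D, DifferentiableAt ℝ (j q.1) q.2)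
    (hjl : ∀ q ∈ D, HasDerivAt (fun σ : ℝ => j q.1 (q.2 + σ • EuclideanSpace.single i (1 : ℝ)))
      (j' q.1 q.2) 0) :
    ContinuousOn (fun q : ℝ × EuclideanSpace ℝ κ => pd i (fun x => Θ (j q.1 x)) q.2) D := by
  have h1 : ∀ q ∈ D, pd i (fun x => Θ (j q.1 x)) q.2
      = fderiv ℝ Θ (j q.1 q.2) (j' q.1 q.2) := by
    intro q hq
    have hΘd : DifferentiableAt ℝ Θ (j q.1 q.2) := (hΘ q hq).differentiableAt (by norm_num)
    refine pd_eq_of_hasDerivAt_line (hΘd.comp q.2 (hjd q hq)) ?_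
    have h0 : q.2 + (0 : ℝ) • EuclideanSpace.single i (1 : ℝ) = q.2 := by simp
    have hf : HasFDerivAt Θ (fderiv ℝ Θ (j q.1 q.2))
        (j q.1 (q.2 + (0 : ℝ) • EuclideanSpace.single i (1 : ℝ))) := by
      rw [h0]
      exact hΘd.hasFDerivAt
    exact hf.comp_hasDerivAt (0 : ℝ) (hjl q hq)
  refine ContinuousOn.congr ?_ h1
  intro q hq
  have hf : ContinuousAt (fderiv ℝ Θ) (j q.1 q.2) :=
    ((hΘ q hq).fderiv_right (m := 0) (by norm_num)).continuousAt
  have hc : ContinuousWithinAt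
      (fun q : ℝ × EuclideanSpace ℝ κ => fderiv ℝ Θ (j q.1 q.2)) D q :=
    ContinuousAt.comp_continuousWithinAt (f := fun q : ℝ × EuclideanSpace ℝ κ => j q.1 q.2) hf
      (hj q hq)
  exact hc.clm_apply (hj' q hq)

end Exchange

/-! ### The normal and the mean curvature as smooth functions of jets -/

section Jets

variable {m : ℕ}

/-- First order jets `(Z, ∂_i Z)` of maps into `ℝ^(m+1)`. -/
abbrev JetOne (m : ℕ) : Type := EuclideanSpace ℝ (Fin (m + 1)) × (Fin m → Fin (m + 1) → ℝ)

/-- Second order jets `((Z, ∂_i Z), ∂_i ∂_j Z)` of maps into `ℝ^(m+1)`. -/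
abbrev JetTwo (m : ℕ) : Type := JetOne m × (Fin m → Fin m → Fin (m + 1) → ℝ)

variable (G : EuclideanSpace ℝ (Fin (m + 1)) → Matrix (Fin (m + 1)) (Fin (m + 1)) ℝ)

/-- The first fundamental form `g_{ij}` as a function of the jet. -/
def jetMetric (p : JetOne m) : Matrix (Fin m) (Fin m) ℝ :=
  Matrix.of fun i j => pairing G p.1 (p.2 i) (p.2 j)

/-- The gradient function `v = √(1 + ‖∇u‖²)` as a function of the jet. -/
def jetGradient (p : JetOne m) : ℝ :=
  Real.sqrt (1 + ∑ i, ∑ j, (jetMetric G p)⁻¹ i j * p.2 i 0 * p.2 j 0)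

/-- The future directed unit normal `ν = v⁻¹ (∂_t + ∇u)` as a function of the jet. -/
def jetNormal (p : JetOne m) : Fin (m + 1) → ℝ :=
  (jetGradient G p)⁻¹ • ((Pi.single 0 1 : Fin (m + 1) → ℝ)
    + ∑ i, (∑ j, (jetMetric G p)⁻¹ i j * p.2 j 0) • p.2 i)

/-- The mean curvature as a function of the jet; the tangential part of `∂_i ∂_j Z` is irrelevant. -/
def jetMeanCurv (q : JetTwo m) : ℝ :=
  ∑ i, ∑ j, (jetMetric G q.1)⁻¹ i j
    * pairing G q.1.1 (q.2 i j + gammaForm G q.1.1 (q.1.2 i) (q.1.2 j)) (jetNormal G q.1)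

/-- The first order jet of `Z` at `y`. -/
def jetOne (Z : EuclideanSpace ℝ (Fin m) → EuclideanSpace ℝ (Fin (m + 1)))
    (y : EuclideanSpace ℝ (Fin m)) : JetOne m := (Z y, fun i => velocity Z i y)

/-- The second order jet of `Z` at `y`. -/
def jetTwo (Z : EuclideanSpace ℝ (Fin m) → EuclideanSpace ℝ (Fin (m + 1)))
    (y : EuclideanSpace ℝ (Fin m)) : JetTwo m :=
  (jetOne Z y, fun i j α => pd i (fun x => velocity Z j x α) y)

variable {G} {f : ℝ → ℝ} {U : Set (EuclideanSpace ℝ (Fin (m + 1)))} (hW : IsWarpedChart f U G)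

include hW

theorem contDiffAt_jetMetric {p : JetOne m} (hp : p.1 ∈ U) (i j : Fin m) :
    ContDiffAt ℝ ∞ (fun p => jetMetric G p i j) p :=
  contDiffAt_pairing (fun α β => hW.contDiffAt _ hp α β) contDiffAt_fst
    (fun α => by fun_prop) (fun α => by fun_prop)

theorem contDiffAt_inv_jetMetric {p : JetOne m} (hp : p.1 ∈ U) (hdet : (jetMetric G p).det ≠ 0)
    (i j : Fin m) : ContDiffAt ℝ ∞ (fun p => (jetMetric G p)⁻¹ i j) p :=
  contDiffAt_matrix_inv (contDiffAt_jetMetric hW hp) hdet i j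

theorem contDiffAt_jetGradient {p : JetOne m} (hp : p.1 ∈ U) (hdet : (jetMetric G p).det ≠ 0)
    (hpos : 0 < jetGradient G p) : ContDiffAt ℝ ∞ (jetGradient G) p := by
  refine ContDiffAt.sqrt (contDiffAt_const.add ?_) (Real.sqrt_pos.1 hpos).ne'
  refine ContDiffAt.sum fun i _ => ContDiffAt.sum fun j _ => ?_
  exact ((contDiffAt_inv_jetMetric hW hp hdet i j).mul (by fun_prop)).mul (by fun_prop)

theorem contDiffAt_jetNormal {p : JetOne m} (hp : p.1 ∈ U) (hdet : (jetMetric G p).det ≠ 0)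
    (hpos : 0 < jetGradient G p) (α : Fin (m + 1)) :
    ContDiffAt ℝ ∞ (fun p => jetNormal G p α) p := by
  simp only [jetNormal, Pi.smul_apply, Pi.add_apply, Finset.sum_apply, smul_eq_mul]
  refine ((contDiffAt_jetGradient hW hp hdet hpos).inv hpos.ne').mul (contDiffAt_const.add ?_)
  refine ContDiffAt.sum fun i _ => ContDiffAt.mul (ContDiffAt.sum fun j _ => ?_) (by fun_prop)
  exact (contDiffAt_inv_jetMetric hW hp hdet i j).mul (by fun_prop)

theorem contDiffAt_jetMeanCurv {q : JetTwo m} (hp : q.1.1 ∈ U) (hdet : (jetMetric G q.1).det ≠ 0)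
    (hpos : 0 < jetGradient G q.1) : ContDiffAt ℝ ∞ (jetMeanCurv G) q := by
  refine ContDiffAt.sum fun i _ => ContDiffAt.sum fun j _ => ContDiffAt.mul ?_ ?_
  · exact (contDiffAt_inv_jetMetric hW hp hdet i j).comp q contDiffAt_fst
  · refine contDiffAt_pairing (Z := fun q : JetTwo m => q.1.1)
      (fun α β => hW.contDiffAt _ hp α β) (by fun_prop) (fun α => ?_)
      (fun α => (contDiffAt_jetNormal hW hp hdet hpos α).comp q contDiffAt_fst)
    simp only [Pi.add_apply, gammaForm]
    refine ContDiffAt.add (by fun_prop) (ContDiffAt.sum fun γ _ => ContDiffAt.sum fun β _ => ?_)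
    have hc : ContDiffAt ℝ ∞ (fun q : JetTwo m => christoffel G α γ β q.1.1) q :=
      ContDiffAt.comp (g := christoffel G α γ β) (f := fun q : JetTwo m => q.1.1) q
        (hW.contDiffAt_christoffel hp α γ β) (by fun_prop)
    exact (hc.mul (by fun_prop)).mul (by fun_prop)

variable {p : JetOne m} {γ : Matrix (Fin m) (Fin m) ℝ} {n : Fin (m + 1) → ℝ}
  (hF : IsFrame G p.1 γ p.2 n)

omit hW in
include hF in
theorem IsFrame.eq_jetMetric : γ = jetMetric G p := by
  ext i j
  exact hF.apply i j

include hF in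
theorem IsFrame.eq_jetGradient (hn : 0 < n 0) : n 0 = jetGradient G p := by
  have h := hF.normal_time_sq hW
  rw [hF.eq_jetMetric] at h
  rw [jetGradient, ← h, Real.sqrt_sq hn.le]

include hF in
/-- The future directed unit normal is unique. -/
theorem IsFrame.eq_jetNormal (hn : 0 < n 0) : n = jetNormal G p := by
  have h := hF.time_decomposition hW
  rw [hF.eq_jetMetric] at h
  rw [jetNormal, h, ← hF.eq_jetGradient hW hn, add_sub_cancel, smul_smul, inv_mul_cancel₀ hn.ne',
    one_smul]

end Jets

/-! ### The prescribed mean curvature flow in coordinates -/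

section LocalFlow

variable {m : ℕ}

/-- A prescribed mean curvature flow, read in fixed charts on an open set `Ω` of parameters and a
convex set `S` of times. -/
structure IsLocalFlow (U : Set (EuclideanSpace ℝ (Fin (m + 1))))
    (G : EuclideanSpace ℝ (Fin (m + 1)) → Matrix (Fin (m + 1)) (Fin (m + 1)) ℝ)
    (S : Set ℝ) (Ω : Set (EuclideanSpace ℝ (Fin m)))
    (g : ℝ → EuclideanSpace ℝ (Fin m) → Matrix (Fin m) (Fin m) ℝ)
    (Z : ℝ → EuclideanSpace ℝ (Fin m) → EuclideanSpace ℝ (Fin (m + 1)))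
    (ν : ℝ → EuclideanSpace ℝ (Fin m) → Fin (m + 1) → ℝ)
    (𝓗 : EuclideanSpace ℝ (Fin m) → ℝ) : Prop where
  isOpen : IsOpen Ω
  convex : Convex ℝ S
  uniqueDiffOn : UniqueDiffOn ℝ S
  mem : ∀ s ∈ S, ∀ y ∈ Ω, Z s y ∈ U
  contDiffAt : ∀ s ∈ S, ∀ y ∈ Ω, ∀ α, ContDiffAt ℝ 3 (fun x => Z s x α) y
  continuousOn : ∀ α, ContinuousOn
    (fun q : ℝ × EuclideanSpace ℝ (Fin m) => Z q.1 q.2 α) (S ×ˢ Ω)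
  continuousOn_velocity : ∀ i α, ContinuousOn
    (fun q : ℝ × EuclideanSpace ℝ (Fin m) => velocity (Z q.1) i q.2 α) (S ×ˢ Ω)
  continuousOn_pd_velocity : ∀ j i α, ContinuousOn
    (fun q : ℝ × EuclideanSpace ℝ (Fin m) => pd j (fun x => velocity (Z q.1) i x α) q.2) (S ×ˢ Ω)
  continuousOn_pd_pd_velocity : ∀ k j i α, ContinuousOn (fun q : ℝ × EuclideanSpace ℝ (Fin m) =>
    pd k (pd j (fun x => velocity (Z q.1) i x α)) q.2) (S ×ˢ Ω)
  symm : ∀ s ∈ S, ∀ y, (g s y).IsSymm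
  apply : ∀ s ∈ S, ∀ y ∈ Ω, ∀ i j,
    g s y i j = pairing G (Z s y) (velocity (Z s) i y) (velocity (Z s) j y)
  det_ne_zero : ∀ s ∈ S, ∀ y ∈ Ω, (g s y).det ≠ 0
  normal : ∀ s ∈ S, ∀ y ∈ Ω, ∀ i, pairing G (Z s y) (ν s y) (velocity (Z s) i y) = 0
  unit : ∀ s ∈ S, ∀ y ∈ Ω, pairing G (Z s y) (ν s y) (ν s y) = -1
  future : ∀ s ∈ S, ∀ y ∈ Ω, 0 < ν s y 0
  prescribed_contDiffAt : ∀ y ∈ Ω, ContDiffAt ℝ 1 𝓗 y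
  flow : ∀ s ∈ S, ∀ y ∈ Ω, ∀ α, HasDerivWithinAt (fun σ => Z σ y α)
    (-(meanCurv G (g s) (Z s) (ν s) y - 𝓗 y) * ν s y α) S s

variable {f : ℝ → ℝ} {U : Set (EuclideanSpace ℝ (Fin (m + 1)))}
  {G : EuclideanSpace ℝ (Fin (m + 1)) → Matrix (Fin (m + 1)) (Fin (m + 1)) ℝ}
  {S : Set ℝ} {Ω : Set (EuclideanSpace ℝ (Fin m))}
  {g : ℝ → EuclideanSpace ℝ (Fin m) → Matrix (Fin m) (Fin m) ℝ}
  {Z : ℝ → EuclideanSpace ℝ (Fin m) → EuclideanSpace ℝ (Fin (m + 1))}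
  {ν : ℝ → EuclideanSpace ℝ (Fin m) → Fin (m + 1) → ℝ}
  {𝓗 : EuclideanSpace ℝ (Fin m) → ℝ} {s : ℝ} {y : EuclideanSpace ℝ (Fin m)}

namespace IsLocalFlow

variable (hW : IsWarpedChart f U G) (hL : IsLocalFlow U G S Ω g Z ν 𝓗)

include hL

theorem contDiffAt_velocity (hs : s ∈ S) (hy : y ∈ Ω) (i α) :
    ContDiffAt ℝ 2 (fun x => velocity (Z s) i x α) y :=
  contDiffAt_pd i (hL.contDiffAt s hs y hy α) (by norm_num)

theorem contDiffAt_jetOne (hs : s ∈ S) (hy : y ∈ Ω) : ContDiffAt ℝ 2 (jetOne (Z s)) y :=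
  (coord_contDiffAt fun α => (hL.contDiffAt s hs y hy α).of_le (by norm_num)).prodMk
    (contDiffAt_pi.2 fun i => contDiffAt_pi.2 fun α => hL.contDiffAt_velocity hs hy i α)

theorem contDiffAt_jetTwo (hs : s ∈ S) (hy : y ∈ Ω) : ContDiffAt ℝ 1 (jetTwo (Z s)) y :=
  ((hL.contDiffAt_jetOne hs hy).of_le (by norm_num)).prodMk
    (contDiffAt_pi.2 fun i => contDiffAt_pi.2 fun j => contDiffAt_pi.2 fun α =>
      contDiffAt_pd i (hL.contDiffAt_velocity hs hy j α) (by norm_num))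

include hW

theorem isFrame (hs : s ∈ S) (hy : y ∈ Ω) :
    IsFrame G (jetOne (Z s) y).1 (g s y) (jetOne (Z s) y).2 (ν s y) where
  ambient_symm := hW.symm _
  ambient_det := hW.det_ne_zero _ (hL.mem s hs y hy)
  symm := hL.symm s hs y
  apply := hL.apply s hs y hy
  det_ne_zero := hL.det_ne_zero s hs y hy
  normal := hL.normal s hs y hy
  unit := hL.unit s hs y hy

theorem normal_eq (hs : s ∈ S) (hy : y ∈ Ω) : ν s y = jetNormal G (jetOne (Z s) y) :=
  (hL.isFrame hW hs hy).eq_jetNormal hW (hL.future s hs y hy)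

theorem jetMetric_det_ne_zero (hs : s ∈ S) (hy : y ∈ Ω) :
    (jetMetric G (jetOne (Z s) y)).det ≠ 0 := by
  rw [← (hL.isFrame hW hs hy).eq_jetMetric]
  exact hL.det_ne_zero s hs y hy

theorem jetGradient_pos (hs : s ∈ S) (hy : y ∈ Ω) : 0 < jetGradient G (jetOne (Z s) y) := by
  rw [← (hL.isFrame hW hs hy).eq_jetGradient hW (hL.future s hs y hy)]
  exact hL.future s hs y hy

theorem contDiffAt_jetNormal (hs : s ∈ S) (hy : y ∈ Ω) (α : Fin (m + 1)) :
    ContDiffAt ℝ ∞ (fun p => jetNormal G p α) (jetOne (Z s) y) :=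
  GRW.contDiffAt_jetNormal hW (hL.mem s hs y hy) (hL.jetMetric_det_ne_zero hW hs hy)
    (hL.jetGradient_pos hW hs hy) α

theorem contDiffAt_jetMeanCurv (hs : s ∈ S) (hy : y ∈ Ω) :
    ContDiffAt ℝ ∞ (jetMeanCurv G) (jetTwo (Z s) y) :=
  GRW.contDiffAt_jetMeanCurv hW (hL.mem s hs y hy) (hL.jetMetric_det_ne_zero hW hs hy)
    (hL.jetGradient_pos hW hs hy)

omit hW in
theorem eventually_mem (hy : y ∈ Ω) : ∀ᶠ x in nhds y, x ∈ Ω := hL.isOpen.mem_nhds hy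

/-- The normal has the regularity of the first order jet of `Z`. -/
theorem contDiffAt_normal (hs : s ∈ S) (hy : y ∈ Ω) (α : Fin (m + 1)) :
    ContDiffAt ℝ 2 (fun x => ν s x α) y := by
  refine ContDiffAt.congr_of_eventuallyEq ?_ ((hL.eventually_mem hy).mono fun x hx =>
    congrFun (hL.normal_eq hW hs hx) α)
  exact ((hL.contDiffAt_jetNormal hW hs hy α).of_le (by norm_cast)).comp y
    (hL.contDiffAt_jetOne hs hy)

theorem isHypersurface (hs : s ∈ S) : IsHypersurface U G Ω (g s) (Z s) (ν s) where
  isOpen := hL.isOpen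
  mem := hL.mem s hs
  contDiffAt := hL.contDiffAt s hs
  contDiffAt_normal := fun _ hy => hL.contDiffAt_normal hW hs hy
  normal := hL.normal s hs
  unit := hL.unit s hs
  symm := hL.symm s hs
  apply := hL.apply s hs
  det_ne_zero := hL.det_ne_zero s hs

theorem meanCurv_eq (hs : s ∈ S) (hy : y ∈ Ω) :
    meanCurv G (g s) (Z s) (ν s) y = jetMeanCurv G (jetTwo (Z s) y) := by
  rw [meanCurv, jetMeanCurv, (hL.isFrame hW hs hy).eq_jetMetric]
  simp only [secondForm, hL.normal_eq hW hs hy]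
  rfl

theorem differentiableAt_meanCurv (hs : s ∈ S) (hy : y ∈ Ω) :
    DifferentiableAt ℝ (meanCurv G (g s) (Z s) (ν s)) y := by
  have h : ContDiffAt ℝ 1 (fun x => jetMeanCurv G (jetTwo (Z s) x)) y :=
    ((hL.contDiffAt_jetMeanCurv hW hs hy).of_le (by norm_cast)).comp y (hL.contDiffAt_jetTwo hs hy)
  exact (h.differentiableAt (by norm_num)).congr_of_eventuallyEq
    ((hL.eventually_mem hy).mono fun x hx => hL.meanCurv_eq hW hs hx)

omit hW in
theorem continuousOn_jetOne : ContinuousOn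
    (fun q : ℝ × EuclideanSpace ℝ (Fin m) => jetOne (Z q.1) q.2) (S ×ˢ Ω) :=
  ((PiLp.continuous_toLp 2 _).comp_continuousOn (continuousOn_pi.2 hL.continuousOn)).prodMk
    (continuousOn_pi.2 fun i => continuousOn_pi.2 fun α => hL.continuousOn_velocity i α)

omit hW in
theorem continuousOn_jetTwo : ContinuousOn
    (fun q : ℝ × EuclideanSpace ℝ (Fin m) => jetTwo (Z q.1) q.2) (S ×ˢ Ω) :=
  hL.continuousOn_jetOne.prodMk (continuousOn_pi.2 fun j => continuousOn_pi.2 fun i =>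
    continuousOn_pi.2 fun α => hL.continuousOn_pd_velocity j i α)

omit hW in
theorem hasDerivAt_jetOne_line (hs : s ∈ S) (hy : y ∈ Ω) (i : Fin m) :
    HasDerivAt (fun σ : ℝ => jetOne (Z s) (y + σ • EuclideanSpace.single i (1 : ℝ)))
      ((WithLp.toLp 2 (velocity (Z s) i y), fun j α => pd i (fun x => velocity (Z s) j x α) y) :
        JetOne m) 0 := by
  refine HasDerivAt.prodMk ?_ (hasDerivAt_pi.2 fun j => hasDerivAt_pi.2 fun α =>
    hasDerivAt_line i ((hL.contDiffAt_velocity hs hy j α).differentiableAt (by norm_num)))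
  rw [← hasDerivWithinAt_univ]
  exact hasDerivWithinAt_coord fun α =>
    (hasDerivAt_line i ((hL.contDiffAt s hs y hy α).differentiableAt (by norm_num))).hasDerivWithinAt

theorem continuousOn_pd_normal (i : Fin m) (α : Fin (m + 1)) : ContinuousOn
    (fun q : ℝ × EuclideanSpace ℝ (Fin m) => pd i (fun x => ν q.1 x α) q.2) (S ×ˢ Ω) := by
  refine ContinuousOn.congr (f := fun q : ℝ × EuclideanSpace ℝ (Fin m) =>
    pd i (fun x => jetNormal G (jetOne (Z q.1) x) α) q.2) ?_ fun q hq => pd_congr i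
      ((hL.eventually_mem hq.2).mono fun x hx => congrFun (hL.normal_eq hW hq.1 hx) α)
  refine continuousOn_pd_comp (Θ := fun p => jetNormal G p α) (j := fun s x => jetOne (Z s) x)
    (j' := fun s y =>
      (WithLp.toLp 2 (velocity (Z s) i y), fun j α => pd i (fun x => velocity (Z s) j x α) y)) i
    (fun q hq => (hL.contDiffAt_jetNormal hW hq.1 hq.2 α).of_le (by norm_cast))
    hL.continuousOn_jetOne ?_
    (fun q hq => (hL.contDiffAt_jetOne hq.1 hq.2).differentiableAt (by norm_num))
    (fun q hq => hL.hasDerivAt_jetOne_line hq.1 hq.2 i)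
  exact ((PiLp.continuous_toLp 2 _).comp_continuousOn
    (continuousOn_pi.2 (hL.continuousOn_velocity i))).prodMk
    (continuousOn_pi.2 fun j => continuousOn_pi.2 fun α => hL.continuousOn_pd_velocity i j α)

theorem continuousOn_pd_meanCurv (i : Fin m) : ContinuousOn
    (fun q : ℝ × EuclideanSpace ℝ (Fin m) =>
      pd i (meanCurv G (g q.1) (Z q.1) (ν q.1)) q.2) (S ×ˢ Ω) := by
  refine ContinuousOn.congr (f := fun q : ℝ × EuclideanSpace ℝ (Fin m) =>
    pd i (fun x => jetMeanCurv G (jetTwo (Z q.1) x)) q.2) ?_ fun q hq => pd_congr i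
      ((hL.eventually_mem hq.2).mono fun x hx => hL.meanCurv_eq hW hq.1 hx)
  refine continuousOn_pd_comp (Θ := jetMeanCurv G) (j := fun s x => jetTwo (Z s) x)
    (j' := fun s y =>
      ((WithLp.toLp 2 (velocity (Z s) i y), fun j α => pd i (fun x => velocity (Z s) j x α) y),
        fun k j α => pd i (pd k (fun x => velocity (Z s) j x α)) y)) i
    (fun q hq => (hL.contDiffAt_jetMeanCurv hW hq.1 hq.2).of_le (by norm_cast))
    hL.continuousOn_jetTwo ?_
    (fun q hq => (hL.contDiffAt_jetTwo hq.1 hq.2).differentiableAt (by norm_num)) ?_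
  · exact (((PiLp.continuous_toLp 2 _).comp_continuousOn
      (continuousOn_pi.2 (hL.continuousOn_velocity i))).prodMk
      (continuousOn_pi.2 fun j => continuousOn_pi.2 fun α =>
        hL.continuousOn_pd_velocity i j α)).prodMk
      (continuousOn_pi.2 fun k => continuousOn_pi.2 fun j => continuousOn_pi.2 fun α =>
        hL.continuousOn_pd_pd_velocity i k j α)
  · intro q hq
    exact (hL.hasDerivAt_jetOne_line hq.1 hq.2 i).prodMk
      (hasDerivAt_pi.2 fun k => hasDerivAt_pi.2 fun j => hasDerivAt_pi.2 fun α =>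
        hasDerivAt_line i ((contDiffAt_pd (k := 1) k (hL.contDiffAt_velocity hq.1 hq.2 j α)
          (by norm_num)).differentiableAt (by norm_num)))

theorem continuousOn_meanCurv : ContinuousOn
    (fun q : ℝ × EuclideanSpace ℝ (Fin m) => meanCurv G (g q.1) (Z q.1) (ν q.1) q.2)
    (S ×ˢ Ω) := by
  refine ContinuousOn.congr (f := fun q : ℝ × EuclideanSpace ℝ (Fin m) =>
    jetMeanCurv G (jetTwo (Z q.1) q.2)) (fun q hq => ?_) fun q hq => hL.meanCurv_eq hW hq.1 hq.2
  exact ContinuousAt.comp_continuousWithinAt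
    (f := fun q : ℝ × EuclideanSpace ℝ (Fin m) => jetTwo (Z q.1) q.2)
    (hL.contDiffAt_jetMeanCurv hW hq.1 hq.2).continuousAt (hL.continuousOn_jetTwo q hq)

theorem continuousOn_normal (α : Fin (m + 1)) : ContinuousOn
    (fun q : ℝ × EuclideanSpace ℝ (Fin m) => ν q.1 q.2 α) (S ×ˢ Ω) := by
  refine ContinuousOn.congr (f := fun q : ℝ × EuclideanSpace ℝ (Fin m) =>
    jetNormal G (jetOne (Z q.1) q.2) α) (fun q hq => ?_)
    fun q hq => congrFun (hL.normal_eq hW hq.1 hq.2) α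
  exact ContinuousAt.comp_continuousWithinAt
    (f := fun q : ℝ × EuclideanSpace ℝ (Fin m) => jetOne (Z q.1) q.2)
    (hL.contDiffAt_jetNormal hW hq.1 hq.2 α).continuousAt (hL.continuousOn_jetOne q hq)

theorem differentiableAt_speed (hs : s ∈ S) (hy : y ∈ Ω) : DifferentiableAt ℝ
    (fun x => -(meanCurv G (g s) (Z s) (ν s) x - 𝓗 x)) y :=
  ((hL.differentiableAt_meanCurv hW hs hy).sub
    ((hL.prescribed_contDiffAt y hy).differentiableAt (by norm_num))).neg

theorem pd_speed (hs : s ∈ S) (hy : y ∈ Ω) (i : Fin m) :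
    pd i (fun x => -(meanCurv G (g s) (Z s) (ν s) x - 𝓗 x)) y
      = -(pd i (meanCurv G (g s) (Z s) (ν s)) y - pd i 𝓗 y) := by
  rw [pd_neg, pd_sub i (hL.differentiableAt_meanCurv hW hs hy)
    ((hL.prescribed_contDiffAt y hy).differentiableAt (by norm_num))]

/-- `∂_s ∂_i Z = ∂_i (-(H - 𝓗) ν)`. -/
theorem hasDerivWithinAt_velocity (hs : s ∈ S) (hy : y ∈ Ω) (i : Fin m) (α : Fin (m + 1)) :
    HasDerivWithinAt (fun σ => velocity (Z σ) i y α)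
      (pd i (fun x => -(meanCurv G (g s) (Z s) (ν s) x - 𝓗 x) * ν s x α) y) S s := by
  have hνd : ∀ s ∈ S, ∀ y ∈ Ω, DifferentiableAt ℝ (fun x => ν s x α) y := fun s hs y hy =>
    (hL.contDiffAt_normal hW hs hy α).differentiableAt (by norm_num)
  refine hasDerivWithinAt_pd (w := fun s x => Z s x α)
    (w' := fun s x => -(meanCurv G (g s) (Z s) (ν s) x - 𝓗 x) * ν s x α)
    hL.convex hL.isOpen i hs hy (fun s hs y hy => hL.flow s hs y hy α)
    (fun s hs y hy => (hL.contDiffAt s hs y hy α).differentiableAt (by norm_num))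
    (fun s hs y hy => (hL.differentiableAt_speed hW hs hy).fun_mul (hνd s hs y hy)) ?_
  have hsnd : Set.MapsTo Prod.snd (S ×ˢ Ω) Ω := fun q hq => hq.2
  have h𝓗 : ContinuousOn (fun q : ℝ × EuclideanSpace ℝ (Fin m) => 𝓗 q.2) (S ×ˢ Ω) :=
    ContinuousOn.comp (fun y hy => (hL.prescribed_contDiffAt y hy).continuousAt.continuousWithinAt)
      continuousOn_snd hsnd
  have hd𝓗 : ContinuousOn (fun q : ℝ × EuclideanSpace ℝ (Fin m) => pd i 𝓗 q.2) (S ×ˢ Ω) :=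
    ContinuousOn.comp (fun y hy => (contDiffAt_pd (k := 0) i (hL.prescribed_contDiffAt y hy)
      (by norm_num)).continuousAt.continuousWithinAt) continuousOn_snd hsnd
  have hcont : ContinuousOn (fun q : ℝ × EuclideanSpace ℝ (Fin m) =>
      -(pd i (meanCurv G (g q.1) (Z q.1) (ν q.1)) q.2 - pd i 𝓗 q.2) * ν q.1 q.2 α
      + -(meanCurv G (g q.1) (Z q.1) (ν q.1) q.2 - 𝓗 q.2) * pd i (fun x => ν q.1 x α) q.2)
      (S ×ˢ Ω) :=
    (((hL.continuousOn_pd_meanCurv hW i).sub hd𝓗).neg.mul (hL.continuousOn_normal hW α)).add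
      (((hL.continuousOn_meanCurv hW).sub h𝓗).neg.mul (hL.continuousOn_pd_normal hW i α))
  refine (hcont.congr fun q hq => ?_) (s, y) ⟨hs, hy⟩
  rw [pd_mul i (hL.differentiableAt_speed hW hq.1 hq.2) (hνd q.1 hq.1 q.2 hq.2),
    hL.pd_speed hW hq.1 hq.2]

/-- The normal is differentiable in `s`, as a smooth function of the first order jet of `Z`. -/
theorem exists_hasDerivWithinAt_normal (hs : s ∈ S) (hy : y ∈ Ω) : ∃ N' : Fin (m + 1) → ℝ,
    ∀ α, HasDerivWithinAt (fun σ => ν σ y α) (N' α) S s := by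
  have hjet : DifferentiableWithinAt ℝ (fun σ => jetOne (Z σ) y) S s := by
    refine DifferentiableWithinAt.prodMk ?_ (differentiableWithinAt_pi.2 fun i =>
      differentiableWithinAt_pi.2 fun α =>
        (hL.hasDerivWithinAt_velocity hW hs hy i α).differentiableWithinAt)
    exact (hasDerivWithinAt_coord fun α => hL.flow s hs y hy α).differentiableWithinAt
  have hν : ∀ α, DifferentiableWithinAt ℝ (fun σ => ν σ y α) S s := by
    intro α
    have hd : DifferentiableAt ℝ (fun p => jetNormal G p α) (jetOne (Z s) y) :=
      (hL.contDiffAt_jetNormal hW hs hy α).differentiableAt (by simp)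
    have h0 : DifferentiableWithinAt ℝ (fun σ => jetNormal G (jetOne (Z σ) y) α) S s :=
      DifferentiableAt.comp_differentiableWithinAt (g := fun p => jetNormal G p α)
        (f := fun σ => jetOne (Z σ) y) s hd hjet
    exact h0.congr (fun σ hσ => congrFun (hL.normal_eq hW hσ hy) α)
      (congrFun (hL.normal_eq hW hs hy) α)
  exact ⟨fun α => derivWithin (fun σ => ν σ y α) S s, fun α => (hν α).hasDerivWithinAt⟩

/-- The evolution equation of the gradient function `v = ν^0` in coordinates. -/
theorem evolution (hs : s ∈ S) (hy : y ∈ Ω) : ∃ v' : ℝ,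
    HasDerivWithinAt (fun σ => ν σ y 0) v' S s ∧
    v' + laplacian (g s) (fun x => ν s x 0) y
      = -(∑ i, ∑ j, ∑ k, ∑ l, (g s y)⁻¹ i k * (g s y)⁻¹ j l * secondForm G (Z s) (ν s) i j y
          * secondForm G (Z s) (ν s) k l y) * ν s y 0
        - ricciForm G (Z s y) (ν s y) (ν s y) * ν s y 0
        - 2 * (deriv f (Z s y 0) / f (Z s y 0)) * meanCurv G (g s) (Z s) (ν s) y
        + deriv f (Z s y 0) / f (Z s y 0) * 𝓗 y
        + ∑ i, ∑ j, (g s y)⁻¹ i j * velocity (Z s) i y 0 * pd j 𝓗 y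
        - deriv f (Z s y 0) / f (Z s y 0) * 𝓗 y * ν s y 0 ^ 2
        + 2 * (deriv f (Z s y 0) / f (Z s y 0))
          * ∑ i, ∑ j, (g s y)⁻¹ i j * velocity (Z s) i y 0 * pd j (fun x => ν s x 0) y
        - m * (deriv (deriv f) (Z s y 0) / f (Z s y 0)) * ν s y 0
        - (deriv f (Z s y 0) / f (Z s y 0)) ^ 2
          * (∑ i, ∑ j, (g s y)⁻¹ i j * velocity (Z s) i y 0 * velocity (Z s) j y 0) * ν s y 0
        + deriv (deriv f) (Z s y 0) / f (Z s y 0)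
          * (∑ i, ∑ j, (g s y)⁻¹ i j * velocity (Z s) i y 0 * velocity (Z s) j y 0) * ν s y 0
        - m * (deriv f (Z s y 0) / f (Z s y 0)) ^ 2 * ν s y 0 := by
  obtain ⟨N', hN'⟩ := hL.exists_hasDerivWithinAt_normal hW hs hy
  refine ⟨N' 0, hN' 0, ?_⟩
  have hS := hL.isHypersurface hW hs
  have h1 := hS.deriv_normal_time hW hy hs (hL.uniqueDiffOn s hs)
    (c := fun σ => Z σ y) (N := fun σ => ν σ y) (X := fun i σ => velocity (Z σ) i y)
    (hL.differentiableAt_speed hW hs hy) rfl rfl (fun _ => rfl) (hL.flow s hs y hy) hN'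
    (fun i α => hL.hasDerivWithinAt_velocity hW hs hy i α)
    (fun σ hσ i => hL.normal σ hσ y hy i) (fun σ hσ => hL.unit σ hσ y hy)
  have h2 : ∀ i j, (g s y)⁻¹ i j * velocity (Z s) i y 0
        * pd j (fun x => -(meanCurv G (g s) (Z s) (ν s) x - 𝓗 x)) y
      = (g s y)⁻¹ i j * velocity (Z s) i y 0 * pd j 𝓗 y
        - (g s y)⁻¹ i j * velocity (Z s) i y 0 * pd j (meanCurv G (g s) (Z s) (ν s)) y := by
    intro i j
    rw [hL.pd_speed hW hs hy]
    ring
  rw [Finset.sum_congr rfl fun i _ => Finset.sum_congr rfl fun j _ => h2 i j] at h1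
  simp only [Finset.sum_sub_distrib] at h1
  rw [h1, hS.laplacian_normal_time hW hy]
  ring

end IsLocalFlow

end LocalFlow

/-! ### Charts of `M` and their coordinate frames -/

section Charts

variable {m : ℕ} {M : Type*} [TopologicalSpace M] [ChartedSpace (EuclideanSpace ℝ (Fin m)) M]
  [IsManifold (𝓡 m) ∞ M]
  {φ ψ : OpenPartialHomeomorph M (EuclideanSpace ℝ (Fin m))}

theorem contMDiffAt_chart (hφ : φ ∈ atlas (EuclideanSpace ℝ (Fin m)) M) {p : M}
    (hp : p ∈ φ.source) : ContMDiffAt (𝓡 m) (𝓡 m) ∞ φ p :=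
  contMDiffAt_of_mem_maximalAtlas (IsManifold.subset_maximalAtlas hφ) hp

theorem contMDiffAt_chart_symm (hφ : φ ∈ atlas (EuclideanSpace ℝ (Fin m)) M)
    {y : EuclideanSpace ℝ (Fin m)} (hy : y ∈ φ.target) :
    ContMDiffAt (𝓡 m) (𝓡 m) ∞ φ.symm y :=
  contMDiffAt_symm_of_mem_maximalAtlas (IsManifold.subset_maximalAtlas hφ) hy

/-- The coordinate fields `∂_i` are smooth sections of `TM` along `φ.symm`, being the images of
constant fields under the tangent map of `φ.symm`. -/
theorem contMDiffAt_frame (hφ : φ ∈ atlas (EuclideanSpace ℝ (Fin m)) M) (i : Fin m)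
    {y : EuclideanSpace ℝ (Fin m)} (hy : y ∈ φ.target) :
    ContMDiffAt (𝓡 m) (𝓡 m).tangent ∞
      (fun x => (⟨φ.symm x, frame φ x i⟩ : TangentBundle (𝓡 m) M)) y := by
  have h1 : ContMDiffOn (𝓡 m) (𝓡 m) ∞ φ.symm φ.target := fun x hx =>
    (contMDiffAt_chart_symm hφ hx).contMDiffWithinAt
  have h2 := h1.contMDiffOn_tangentMapWithin (m := ∞) (by simp) φ.open_target.uniqueMDiffOn
  have h3 : ContMDiffAt (𝓡 m) (𝓡 m).tangent ∞ (fun x => (⟨x, EuclideanSpace.single i (1 : ℝ)⟩ :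
      TangentBundle (𝓡 m) (EuclideanSpace ℝ (Fin m)))) y := by
    exact contMDiffAt_vectorSpace_iff_contDiffAt.2 contDiffAt_const
  have h4 := (h2 _ (by exact hy)).comp_of_eq (x := y) (s := φ.target) h3.contMDiffWithinAt
    (by intro x hx; exact hx) rfl
  have h5 := h4.contMDiffAt (φ.open_target.mem_nhds hy)
  refine h5.congr_of_eventuallyEq ?_
  filter_upwards [φ.open_target.mem_nhds hy] with x hx
  simp only [Function.comp, tangentMapWithin, frame]
  rw [mfderivWithin_of_isOpen φ.open_target hx]

theorem contDiffAt_inner_frame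
    (gt : Bundle.ContMDiffRiemannianMetric (𝓡 m) ∞ (EuclideanSpace ℝ (Fin m))
      (fun x : M => TangentSpace (𝓡 m) x)) (hφ : φ ∈ atlas (EuclideanSpace ℝ (Fin m)) M)
    (i j : Fin m) {y : EuclideanSpace ℝ (Fin m)} (hy : y ∈ φ.target) :
    ContDiffAt ℝ ∞ (fun x => gt.inner (φ.symm x) (frame φ x i) (frame φ x j)) y := by
  rw [← contMDiffAt_iff_contDiffAt]
  have : ContMDiffAt (𝓡 m) ((𝓡 m).prod 𝓘(ℝ)) ∞
      (fun x ↦ Bundle.TotalSpace.mk' ℝ (E := Bundle.Trivial M ℝ) (φ.symm x)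
        (gt.inner (φ.symm x) (frame φ x i) (frame φ x j))) y := by
    apply ContMDiffAt.clm_bundle_apply₂ (F₁ := EuclideanSpace ℝ (Fin m))
      (F₂ := EuclideanSpace ℝ (Fin m))
    · exact ContMDiffAt.comp y gt.contMDiff.contMDiffAt (contMDiffAt_chart_symm hφ hy)
    · exact contMDiffAt_frame hφ i hy
    · exact contMDiffAt_frame hφ j hy
  simp only [Bundle.contMDiffAt_totalSpace] at this
  exact this.2

theorem componentsM_frame (hφ : φ ∈ atlas (EuclideanSpace ℝ (Fin m)) M) (i : Fin m)
    {y : EuclideanSpace ℝ (Fin m)} (hy : y ∈ φ.target) :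
    componentsM φ (φ.symm y) (frame φ y i) = EuclideanSpace.single i 1 := by
  have h := (mdifferentiable_of_mem_atlas (I := 𝓡 m) hφ).comp_symm_deriv hy
  exact DFunLike.congr_fun h (EuclideanSpace.single i (1 : ℝ))

theorem map_eq_sum_smul (L : EuclideanSpace ℝ (Fin m) →L[ℝ] EuclideanSpace ℝ (Fin m))
    (v : EuclideanSpace ℝ (Fin m)) : L v = ∑ i, v i • L (EuclideanSpace.single i 1) := by
  have h : v = ∑ i, v i • EuclideanSpace.single i (1 : ℝ) := by
    ext β
    simp [Finset.sum_apply, Pi.single_apply]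
  conv_lhs => rw [h]
  simp

theorem sum_componentsM_smul_frame (hφ : φ ∈ atlas (EuclideanSpace ℝ (Fin m)) M)
    {y : EuclideanSpace ℝ (Fin m)} (hy : y ∈ φ.target) (X : TangentSpace (𝓡 m) (φ.symm y)) :
    ∑ i, componentsM φ (φ.symm y) X i • frame φ y i = X := by
  have h := (mdifferentiable_of_mem_atlas (I := 𝓡 m) hφ).symm_comp_deriv (φ.map_target hy)
  have h1 := DFunLike.congr_fun h X
  rw [φ.right_inv hy] at h1
  exact (map_eq_sum_smul (mfderiv (𝓡 m) (𝓡 m) φ.symm y) (componentsM φ (φ.symm y) X)).symm.trans h1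

theorem eq_zero_of_sum_smul_frame_eq_zero (hφ : φ ∈ atlas (EuclideanSpace ℝ (Fin m)) M)
    {y : EuclideanSpace ℝ (Fin m)} (hy : y ∈ φ.target) {c : Fin m → ℝ}
    (h : ∑ i, c i • frame φ y i = 0) : c = 0 := by
  have h1 : mfderiv (𝓡 m) (𝓡 m) φ (φ.symm y) (∑ i, c i • frame φ y i) = 0 := by
    rw [h, map_zero]
  rw [map_sum] at h1
  have h2 : ∑ i, c i • EuclideanSpace.single i (1 : ℝ) = 0 := by
    refine Eq.trans (Finset.sum_congr rfl fun i _ => ?_) h1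
    rw [map_smul]
    exact congrArg (c i • ·) (componentsM_frame hφ i hy).symm
  ext β
  have := congrArg (fun v : EuclideanSpace ℝ (Fin m) => v β) h2
  simpa [Finset.sum_apply, Pi.single_apply] using this

end Charts

/-! ### The ambient metric in coordinates -/

section Ambient

variable {m : ℕ} {M : Type*} [TopologicalSpace M] [ChartedSpace (EuclideanSpace ℝ (Fin m)) M]
  [IsManifold (𝓡 m) ∞ M]
  {ψ : OpenPartialHomeomorph M (EuclideanSpace ℝ (Fin m))}

theorem chartNInv_chartN {n : ℝ × M} (hn : n.2 ∈ ψ.source) : chartNInv ψ (chartN ψ n) = n :=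
  Prod.ext rfl (ψ.left_inv hn)

theorem contDiff_spaceCoord : ContDiff ℝ ∞ (spaceCoord (m := m)) := by
  rw [contDiff_euclidean]
  intro a
  exact contDiff_piLp_apply (i := a.succ) (p := 2)

theorem isOpen_spaceCoord_preimage :
    IsOpen {z : EuclideanSpace ℝ (Fin (m + 1)) | spaceCoord z ∈ ψ.target} :=
  ψ.open_target.preimage contDiff_spaceCoord.continuous

variable (f : ℝ → ℝ)
  (gt : Bundle.ContMDiffRiemannianMetric (𝓡 m) ∞ (EuclideanSpace ℝ (Fin m))
    (fun x : M => TangentSpace (𝓡 m) x))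

theorem warped_comm (n : ℝ × M) (X Y : TN (m := m) n) : warped f gt n X Y = warped f gt n Y X := by
  rw [warped, warped, gt.symm, mul_comm (timePart n X)]

theorem ambientMatrix_zero_zero (z : EuclideanSpace ℝ (Fin (m + 1))) :
    ambientMatrix f gt ψ z 0 0 = -1 := by
  change -((1 : ℝ) * 1) + f (z 0) ^ 2 * gt.inner (ψ.symm (spaceCoord z)) 0 0 = -1
  rw [map_zero]
  simp

theorem ambientMatrix_zero_succ (z : EuclideanSpace ℝ (Fin (m + 1))) (a : Fin m) :
    ambientMatrix f gt ψ z 0 a.succ = 0 := by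
  change -((1 : ℝ) * 0) + f (z 0) ^ 2
    * gt.inner (ψ.symm (spaceCoord z)) 0 (frame ψ (spaceCoord z) a) = 0
  rw [map_zero]
  simp

theorem ambientMatrix_succ_succ (z : EuclideanSpace ℝ (Fin (m + 1))) (a b : Fin m) :
    ambientMatrix f gt ψ z a.succ b.succ = f (z 0) ^ 2
      * gt.inner (ψ.symm (spaceCoord z)) (frame ψ (spaceCoord z) a) (frame ψ (spaceCoord z) b) := by
  change -((0 : ℝ) * 0) + _ = _
  rw [mul_zero, neg_zero, zero_add]
  rfl

theorem ambientMatrix_isSymm (z : EuclideanSpace ℝ (Fin (m + 1))) :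
    (ambientMatrix f gt ψ z).IsSymm :=
  Matrix.IsSymm.ext fun _ _ => warped_comm f gt _ _ _

/-- The metric of `N` in coordinates. -/
theorem warped_eq_pairing (hψ : ψ ∈ atlas (EuclideanSpace ℝ (Fin m)) M) {n : ℝ × M}
    (hn : n.2 ∈ ψ.source) (W W' : TN (m := m) n) :
    warped f gt n W W'
      = pairing (ambientMatrix f gt ψ) (chartN ψ n) (components ψ n W) (components ψ n W') := by
  suffices h : ∀ z, spaceCoord z ∈ ψ.target → ∀ W W' : TN (m := m) (chartNInv ψ z),
      warped f gt _ W W'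
        = pairing (ambientMatrix f gt ψ) z (components ψ _ W) (components ψ _ W') by
    have hz : spaceCoord (chartN ψ n) ∈ ψ.target := ψ.map_source hn
    have h' := h (chartN ψ n) hz
    rw [chartNInv_chartN hn] at h'
    exact h' W W'
  intro z hz W W'
  have hX := sum_componentsM_smul_frame hψ hz (spacePart _ W)
  have hX' := sum_componentsM_smul_frame hψ hz (spacePart _ W')
  have key : gt.inner (ψ.symm (spaceCoord z)) (spacePart _ W) (spacePart _ W')
      = ∑ a, ∑ b, gt.inner (ψ.symm (spaceCoord z)) (frame ψ (spaceCoord z) a)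
          (frame ψ (spaceCoord z) b) * componentsM ψ (ψ.symm (spaceCoord z)) (spacePart _ W) a
          * componentsM ψ (ψ.symm (spaceCoord z)) (spacePart _ W') b := by
    conv_lhs => rw [← hX, ← hX']
    simp only [map_sum, map_smul, sum_apply, smul_apply,
      smul_eq_mul, Finset.mul_sum]
    rw [Finset.sum_comm]
    exact Finset.sum_congr rfl fun a _ => Finset.sum_congr rfl fun b _ => by ring
  rw [warped]
  change _ + f (z 0) ^ 2 * gt.inner (ψ.symm (spaceCoord z)) (spacePart _ W) (spacePart _ W') = _
  rw [key, pairing, Fin.sum_univ_succ, Fin.sum_univ_succ, ambientMatrix_zero_zero]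
  simp only [ambientMatrix_zero_succ, Fin.sum_univ_succ, ambientMatrix_succ_succ,
    (ambientMatrix_isSymm f gt z).apply 0 _]
  simp only [components, Fin.cons_zero, Fin.cons_succ, zero_mul, Finset.sum_const_zero, zero_add,
    Finset.mul_sum]
  rw [add_zero]
  congr 1
  · ring
  · exact Finset.sum_congr rfl fun a _ => Finset.sum_congr rfl fun b _ => by
      rw [← mul_assoc, ← mul_assoc]; rfl

theorem ambientMatrix_det_ne_zero (hf : ∀ t, 0 < f t)
    (hψ : ψ ∈ atlas (EuclideanSpace ℝ (Fin m)) M) {z : EuclideanSpace ℝ (Fin (m + 1))}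
    (hz : spaceCoord z ∈ ψ.target) : (ambientMatrix f gt ψ z).det ≠ 0 := by
  intro hdet
  obtain ⟨X, hX0, hX⟩ := Matrix.exists_mulVec_eq_zero_iff.2 hdet
  have h0 : X 0 = 0 := by
    have := congrFun hX 0
    simpa [Matrix.mulVec, dotProduct, Fin.sum_univ_succ, ambientMatrix_zero_zero,
      ambientMatrix_zero_succ] using this
  set W : TangentSpace (𝓡 m) (ψ.symm (spaceCoord z)) :=
    ∑ a, X a.succ • frame ψ (spaceCoord z) a with hW
  -- the spatial part `W` of a vector in the kernel is orthogonal to all `∂_a`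
  have hrow : ∀ a : Fin m, gt.inner (ψ.symm (spaceCoord z)) (frame ψ (spaceCoord z) a) W = 0 := by
    intro a
    have := congrFun hX a.succ
    simp only [Matrix.mulVec, dotProduct, Fin.sum_univ_succ, h0, ambientMatrix_succ_succ, mul_zero,
      zero_add, Pi.zero_apply, mul_assoc] at this
    rw [← Finset.mul_sum] at this
    have h2 := (mul_eq_zero.1 this).resolve_left (pow_ne_zero 2 (hf _).ne')
    rw [hW, map_sum, ← h2]
    exact Finset.sum_congr rfl fun b _ => by rw [map_smul, smul_eq_mul, mul_comm]
  have hWW : gt.inner (ψ.symm (spaceCoord z)) W W = 0 := by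
    conv_lhs => enter [1]; rw [hW]
    simp only [map_sum, map_smul, sum_apply, smul_apply,
      hrow, smul_zero, Finset.sum_const_zero]
  have hW0 : W = 0 := by
    by_contra hne
    exact (gt.pos _ W hne).ne' hWW
  have hc := eq_zero_of_sum_smul_frame_eq_zero hψ hz (c := fun a => X a.succ) hW0
  refine hX0 (funext fun α => ?_)
  refine Fin.cases h0 (fun a => congrFun hc a) α

theorem contDiffAt_ambientMatrix (hf : ContDiff ℝ ∞ f)
    (hψ : ψ ∈ atlas (EuclideanSpace ℝ (Fin m)) M) {z : EuclideanSpace ℝ (Fin (m + 1))}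
    (hz : spaceCoord z ∈ ψ.target) (α β : Fin (m + 1)) :
    ContDiffAt ℝ ∞ (fun x => ambientMatrix f gt ψ x α β) z := by
  refine Fin.cases ?_ (fun a => ?_) α
  · refine Fin.cases ?_ (fun b => ?_) β
    · simp only [ambientMatrix_zero_zero]
      exact contDiffAt_const
    · simp only [ambientMatrix_zero_succ]
      exact contDiffAt_const
  · refine Fin.cases ?_ (fun b => ?_) β
    · simp only [fun x => (ambientMatrix_isSymm (ψ := ψ) f gt x).apply 0 a.succ,
        ambientMatrix_zero_succ]
      exact contDiffAt_const
    · simp only [ambientMatrix_succ_succ]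
      refine ContDiffAt.mul ?_ ?_
      · exact (hf.comp (contDiff_piLp_apply (i := (0 : Fin (m + 1))) (p := 2))).contDiffAt.pow 2
      · exact ContDiffAt.comp (g := fun x =>
          gt.inner (ψ.symm x) (frame ψ x a) (frame ψ x b)) z
          (contDiffAt_inner_frame gt hψ a b hz) contDiff_spaceCoord.contDiffAt

theorem isWarpedChart_ambientMatrix (hf : ContDiff ℝ ∞ f) (hf_pos : ∀ t, 0 < f t)
    (hψ : ψ ∈ atlas (EuclideanSpace ℝ (Fin m)) M) :
    IsWarpedChart f {z | spaceCoord z ∈ ψ.target} (ambientMatrix f gt ψ) where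
  f_contDiff := hf
  f_pos := hf_pos
  isOpen := isOpen_spaceCoord_preimage
  symm := ambientMatrix_isSymm f gt
  det_ne_zero z hz := ambientMatrix_det_ne_zero f gt hf_pos hψ hz
  time_time := ambientMatrix_zero_zero f gt
  time_space := ambientMatrix_zero_succ f gt
  contDiffAt z hz := contDiffAt_ambientMatrix f gt hf hψ hz
  pd_time z hz a b := by
    refine pd_eq_of_hasDerivAt_line
      ((contDiffAt_ambientMatrix f gt hf hψ hz a.succ b.succ).differentiableAt (by simp)) ?_
    -- along the `t`-line only the factor `f²` varies
    have hspace : ∀ σ : ℝ, spaceCoord (z + σ • EuclideanSpace.single 0 (1 : ℝ)) = spaceCoord z := by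
      intro σ
      ext c
      simp [spaceCoord, Fin.succ_ne_zero]
    have htime : ∀ σ : ℝ,
        (z + σ • EuclideanSpace.single 0 (1 : ℝ) : EuclideanSpace ℝ (Fin (m + 1))) 0 = z 0 + σ := by
      intro σ
      simp
    simp only [ambientMatrix_succ_succ, htime]
    simp only [fun σ : ℝ => congrArg (fun x =>
      gt.inner (ψ.symm x) (frame ψ x a) (frame ψ x b)) (hspace σ)]
    have hd : HasDerivAt f (deriv f (z 0)) (z 0 + 0) := by
      rw [add_zero]
      exact (hf.differentiable (by simp) _).hasDerivAt
    have hd2 := ((hd.comp_const_add (z 0) 0).fun_pow 2).mul_const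
      (gt.inner (ψ.symm (spaceCoord z)) (frame ψ (spaceCoord z) a) (frame ψ (spaceCoord z) b))
    refine hd2.congr_deriv ?_
    have hne := (hf_pos (z 0)).ne'
    rw [add_zero]
    field_simp
    ring

end Ambient

/-! ### Maps into the space-time in coordinates -/

section LocalRep

variable {m : ℕ} {M : Type*} [TopologicalSpace M] [ChartedSpace (EuclideanSpace ℝ (Fin m)) M]
  [IsManifold (𝓡 m) ∞ M]
  {φ ψ : OpenPartialHomeomorph M (EuclideanSpace ℝ (Fin m))}

theorem components_smul (n : ℝ × M) (c : ℝ) (W : TN (m := m) n) :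
    components ψ n (c • W) = c • components ψ n W := by
  ext α
  refine Fin.cases rfl (fun a => ?_) α
  exact congrArg (fun v : EuclideanSpace ℝ (Fin m) => v a)
    (map_smul (mfderiv (𝓡 m) (𝓡 m) ψ n.2) c (spacePart n W))

/-- The differential of the coordinates along a curve or a map into `N` is given by the components
of its differential in `N`. -/
theorem hasFDerivWithinAt_chartN {E : Type*} [NormedAddCommGroup E] [NormedSpace ℝ E]
    (hψ : ψ ∈ atlas (EuclideanSpace ℝ (Fin m)) M) {c : E → ℝ × M} {S : Set E} {s : E}
    {c' : TangentSpace 𝓘(ℝ, E) s →L[ℝ] TN (m := m) (c s)}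
    (hc : HasMFDerivWithinAt 𝓘(ℝ, E) (𝓘(ℝ, ℝ).prod (𝓡 m)) c S s c') (hs : (c s).2 ∈ ψ.source)
    (α : Fin (m + 1)) : ∃ L : E →L[ℝ] ℝ, HasFDerivWithinAt (fun σ => chartN ψ (c σ) α) L S s ∧
      ∀ w : E, L w = components ψ (c s) (c' w) α := by
  refine Fin.cases ?_ (fun a => ?_) α
  · have h := (hasMFDerivAt_fst (I := 𝓘(ℝ, ℝ)) (I' := 𝓡 m) (c s)).comp_hasMFDerivWithinAt s hc
    exact ⟨_, h.hasFDerivWithinAt, fun w => rfl⟩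
  · have h := (hasMFDerivAt_snd (I := 𝓘(ℝ, ℝ)) (I' := 𝓡 m) (c s)).comp_hasMFDerivWithinAt s hc
    have h2 := ((mdifferentiableAt_atlas (I := 𝓡 m) hψ hs).hasMFDerivAt).comp_hasMFDerivWithinAt
      s h
    have h3 := h2.hasFDerivWithinAt
    have h4 := (EuclideanSpace.proj a : EuclideanSpace ℝ (Fin m) →L[ℝ] ℝ).hasFDerivAt
      |>.comp_hasFDerivWithinAt s h3
    exact ⟨_, h4, fun w => rfl⟩

theorem hasDerivWithinAt_chartN (hψ : ψ ∈ atlas (EuclideanSpace ℝ (Fin m)) M) {c : ℝ → ℝ × M}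
    {S : Set ℝ} {s : ℝ} {W : TN (m := m) (c s)}
    (hc : HasMFDerivWithinAt 𝓘(ℝ, ℝ) (𝓘(ℝ, ℝ).prod (𝓡 m)) c S s
      ((1 : ℝ →L[ℝ] ℝ).smulRight W)) (hs : (c s).2 ∈ ψ.source) (α : Fin (m + 1)) :
    HasDerivWithinAt (fun σ => chartN ψ (c σ) α) (components ψ (c s) W α) S s := by
  obtain ⟨L, hL, hL'⟩ := hasFDerivWithinAt_chartN hψ hc hs α
  refine hL.hasDerivWithinAt.congr_deriv ((hL' 1).trans ?_)
  exact congrArg (fun W => components ψ (c s) W α) (one_smul ℝ W)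

variable {F : M → ℝ × M} {y : EuclideanSpace ℝ (Fin m)}

theorem components_D_frame (hφ : φ ∈ atlas (EuclideanSpace ℝ (Fin m)) M)
    (hψ : ψ ∈ atlas (EuclideanSpace ℝ (Fin m)) M) (hy : y ∈ φ.target)
    (hF : MDifferentiableAt (𝓡 m) (𝓘(ℝ, ℝ).prod (𝓡 m)) F (φ.symm y))
    (hy' : (F (φ.symm y)).2 ∈ ψ.source) (i : Fin m) :
    components ψ (F (φ.symm y)) (D F (φ.symm y) (frame φ y i))
      = velocity (localRep φ ψ F) i y := by
  have h1 := hF.hasMFDerivAt.comp y (mdifferentiableAt_atlas_symm (I := 𝓡 m) hφ hy).hasMFDerivAt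
  ext α
  obtain ⟨L, hL, hL'⟩ := hasFDerivWithinAt_chartN hψ h1.hasMFDerivWithinAt hy' α (S := Set.univ)
  rw [hasFDerivWithinAt_univ] at hL
  rw [velocity, pd]
  refine Eq.trans ?_ (congrArg (fun L => L (EuclideanSpace.single i (1 : ℝ))) hL.fderiv).symm
  exact (hL' _).symm

theorem contDiffAt_localRep {k : ℕ∞} (hφ : φ ∈ atlas (EuclideanSpace ℝ (Fin m)) M)
    (hψ : ψ ∈ atlas (EuclideanSpace ℝ (Fin m)) M) (hy : y ∈ φ.target)
    (hF : ContMDiffAt (𝓡 m) (𝓘(ℝ, ℝ).prod (𝓡 m)) k F (φ.symm y))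
    (hy' : (F (φ.symm y)).2 ∈ ψ.source) (α : Fin (m + 1)) :
    ContDiffAt ℝ k (fun x => localRep φ ψ F x α) y := by
  have hk : (k : ℕ∞ω) ≤ ∞ := mod_cast le_top
  have h1 : ContMDiffAt (𝓡 m) (𝓘(ℝ, ℝ).prod (𝓡 m)) k (fun x => F (φ.symm x)) y :=
    ContMDiffAt.comp y hF ((contMDiffAt_chart_symm hφ hy).of_le hk)
  refine Fin.cases ?_ (fun a => ?_) α
  · exact h1.fst.contDiffAt
  · have h2 : ContMDiffAt (𝓡 m) (𝓡 m) k (fun x => ψ (F (φ.symm x)).2) y :=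
      ContMDiffAt.comp (g := ψ) y ((contMDiffAt_chart hψ hy').of_le hk) h1.snd
    exact contDiffAt_euclidean.1 h2.contDiffAt a

variable (f : ℝ → ℝ)
  (gt : Bundle.ContMDiffRiemannianMetric (𝓡 m) ∞ (EuclideanSpace ℝ (Fin m))
    (fun x : M => TangentSpace (𝓡 m) x))

theorem warped_dt (n : ℝ × M) (W : TN (m := m) n) : warped f gt n (dt n) W = -timePart n W := by
  change -((1 : ℝ) * timePart n W) + f n.1 ^ 2 * gt.inner n.2 0 (spacePart n W) = _
  rw [map_zero]
  simp

theorem inducedMatrix_isSymm (y : EuclideanSpace ℝ (Fin m)) : (inducedMatrix f gt φ F y).IsSymm :=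
  Matrix.IsSymm.ext fun _ _ => warped_comm f gt _ _ _

theorem inducedMatrix_apply (hφ : φ ∈ atlas (EuclideanSpace ℝ (Fin m)) M)
    (hψ : ψ ∈ atlas (EuclideanSpace ℝ (Fin m)) M) (hy : y ∈ φ.target)
    (hF : MDifferentiableAt (𝓡 m) (𝓘(ℝ, ℝ).prod (𝓡 m)) F (φ.symm y))
    (hy' : (F (φ.symm y)).2 ∈ ψ.source) (i j : Fin m) :
    inducedMatrix f gt φ F y i j = pairing (ambientMatrix f gt ψ) (localRep φ ψ F y)
      (velocity (localRep φ ψ F) i y) (velocity (localRep φ ψ F) j y) := by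
  rw [← components_D_frame hφ hψ hy hF hy', ← components_D_frame hφ hψ hy hF hy']
  exact warped_eq_pairing f gt hψ hy' _ _

/-- The metric of `N` as a linear map in its first argument. -/
def warpedLeft (n : ℝ × M) (Y : TN (m := m) n) : TN (m := m) n →ₗ[ℝ] ℝ where
  toFun X := warped f gt n X Y
  map_add' X X' := by
    change -((timePart n X + timePart n X') * timePart n Y)
      + f n.1 ^ 2 * gt.inner n.2 (spacePart n X + spacePart n X') (spacePart n Y) = _
    rw [map_add, add_apply, warped, warped]
    ring
  map_smul' a X := by
    change -((a * timePart n X) * timePart n Y)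
      + f n.1 ^ 2 * gt.inner n.2 (a • spacePart n X) (spacePart n Y) = _
    rw [map_smul, smul_apply, warped, RingHom.id_apply, smul_eq_mul, smul_eq_mul]
    ring

theorem inducedMatrix_det_ne_zero (hφ : φ ∈ atlas (EuclideanSpace ℝ (Fin m)) M)
    (hy : y ∈ φ.target) (hF : IsSpacelike f gt F) : (inducedMatrix f gt φ F y).det ≠ 0 := by
  intro hdet
  obtain ⟨c, hc0, hc⟩ := Matrix.exists_mulVec_eq_zero_iff.2 hdet
  set X : TangentSpace (𝓡 m) (φ.symm y) := ∑ i, c i • frame φ y i with hX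
  have hsum : ∀ Y, warped f gt (F (φ.symm y)) (D F (φ.symm y) X) Y
      = ∑ i, c i * warped f gt (F (φ.symm y)) (D F (φ.symm y) (frame φ y i)) Y := by
    intro Y
    have h := map_sum ((warpedLeft f gt (F (φ.symm y)) Y).comp
      (mfderiv (𝓡 m) (𝓘(ℝ, ℝ).prod (𝓡 m)) F (φ.symm y)).toLinearMap) (fun i => c i • frame φ y i)
      Finset.univ
    refine h.trans (Finset.sum_congr rfl fun i _ => ?_)
    rw [map_smul]
    rfl
  have hrow : ∀ i, warped f gt (F (φ.symm y)) (D F (φ.symm y) X) (D F (φ.symm y) (frame φ y i))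
      = 0 := by
    intro i
    rw [hsum]
    refine Eq.trans ?_ (congrFun hc i)
    rw [Matrix.mulVec, dotProduct]
    refine Finset.sum_congr rfl fun j _ => ?_
    rw [mul_comm, warped_comm]
    rfl
  have hXX : warped f gt (F (φ.symm y)) (D F (φ.symm y) X) (D F (φ.symm y) X) = 0 := by
    rw [hsum]
    exact Finset.sum_eq_zero fun i _ => by rw [warped_comm, hrow, mul_zero]
  have hX0 : X = 0 := by
    by_contra hne
    exact (hF _ X hne).ne' hXX
  exact hc0 (eq_zero_of_sum_smul_frame_eq_zero hφ hy hX0)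

end LocalRep

/-! ### Iterated derivatives and partial derivatives -/

section Iterated

variable {ι κ : Type*} [Fintype ι] [DecidableEq ι] [Fintype κ] [DecidableEq κ]
  {Z : EuclideanSpace ℝ κ → EuclideanSpace ℝ ι} {y : EuclideanSpace ℝ κ}

/-- A partial derivative adds a coordinate vector in the first slot of an iterated derivative. -/
theorem pd_iteratedFDeriv {n : ℕ∞ω} {k : ℕ} (hZ : ContDiffAt ℝ n Z y) (hk : (k : ℕ∞ω) < n)
    (i : κ) (v : Fin k → EuclideanSpace ℝ κ) (α : ι) :
    pd i (fun x => iteratedFDeriv ℝ k Z x v α) y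
      = iteratedFDeriv ℝ (k + 1) Z y (Fin.cons (EuclideanSpace.single i 1) v) α := by
  have hd := (hZ.differentiableAt_iteratedFDeriv hk).hasFDerivAt
  have h1 := ((EuclideanSpace.proj α : EuclideanSpace ℝ ι →L[ℝ] ℝ).comp
    (ContinuousMultilinearMap.apply ℝ (fun _ : Fin k => EuclideanSpace ℝ κ)
      (EuclideanSpace ℝ ι) v)).hasFDerivAt.comp y hd
  rw [iteratedFDeriv_succ_apply_left]
  exact congrArg (fun L => L (EuclideanSpace.single i (1 : ℝ))) h1.fderiv

theorem velocity_eq_iteratedFDeriv (hZ : ContDiffAt ℝ 1 Z y) (i : κ) (α : ι) :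
    velocity Z i y α = iteratedFDeriv ℝ 1 Z y ![EuclideanSpace.single i 1] α :=
  pd_iteratedFDeriv (k := 0) hZ (by norm_num) i ![] α

theorem pd_velocity_eq_iteratedFDeriv (hZ : ContDiffAt ℝ 2 Z y) (j i : κ) (α : ι) :
    pd j (fun x => velocity Z i x α) y = iteratedFDeriv ℝ 2 Z y
      ![EuclideanSpace.single j 1, EuclideanSpace.single i 1] α := by
  have hev : ∀ᶠ x in nhds y, ContDiffAt ℝ 1 Z x :=
    (hZ.eventually (by simp)).mono fun x hx => hx.of_le (by norm_num)
  rw [pd_congr j (hev.mono fun x hx => velocity_eq_iteratedFDeriv hx i α)]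
  exact pd_iteratedFDeriv (k := 1) hZ (by norm_num) j _ α

theorem pd_pd_velocity_eq_iteratedFDeriv (hZ : ContDiffAt ℝ 3 Z y) (k j i : κ) (α : ι) :
    pd k (pd j (fun x => velocity Z i x α)) y = iteratedFDeriv ℝ 3 Z y
      ![EuclideanSpace.single k 1, EuclideanSpace.single j 1, EuclideanSpace.single i 1] α := by
  have hev : ∀ᶠ x in nhds y, ContDiffAt ℝ 2 Z x :=
    (hZ.eventually (by simp)).mono fun x hx => hx.of_le (by norm_num)
  rw [pd_congr k (hev.mono fun x hx => pd_velocity_eq_iteratedFDeriv hx j i α)]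
  exact pd_iteratedFDeriv (k := 2) hZ (by norm_num) k _ α

theorem continuousOn_iteratedFDeriv_apply {Z : ℝ → EuclideanSpace ℝ κ → EuclideanSpace ℝ ι}
    {A : Set (ℝ × EuclideanSpace ℝ κ)} {k : ℕ}
    (h : ContinuousOn (fun q : ℝ × EuclideanSpace ℝ κ => iteratedFDeriv ℝ k (Z q.1) q.2) A)
    (v : Fin k → EuclideanSpace ℝ κ) (α : ι) :
    ContinuousOn (fun q : ℝ × EuclideanSpace ℝ κ => iteratedFDeriv ℝ k (Z q.1) q.2 v α) A :=
  ((EuclideanSpace.proj α : EuclideanSpace ℝ ι →L[ℝ] ℝ).comp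
    (ContinuousMultilinearMap.apply ℝ (fun _ : Fin k => EuclideanSpace ℝ κ)
      (EuclideanSpace ℝ ι) v)).continuous.comp_continuousOn h

end Iterated

/-! ### The geometry of a hypersurface in coordinates -/

section Matching

variable {m : ℕ} {M : Type*} [TopologicalSpace M] [ChartedSpace (EuclideanSpace ℝ (Fin m)) M]
  [IsManifold (𝓡 m) ∞ M]
  {φ ψ : OpenPartialHomeomorph M (EuclideanSpace ℝ (Fin m))}
  (f : ℝ → ℝ)
  (gt : Bundle.ContMDiffRiemannianMetric (𝓡 m) ∞ (EuclideanSpace ℝ (Fin m))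
    (fun x : M => TangentSpace (𝓡 m) x))

variable {F : M → ℝ × M} {μ : (p : M) → TN (m := m) (F p)} {y : EuclideanSpace ℝ (Fin m)}

theorem pairing_normal_velocity (hφ : φ ∈ atlas (EuclideanSpace ℝ (Fin m)) M)
    (hψ : ψ ∈ atlas (EuclideanSpace ℝ (Fin m)) M) (hy : y ∈ φ.target)
    (hF : MDifferentiableAt (𝓡 m) (𝓘(ℝ, ℝ).prod (𝓡 m)) F (φ.symm y))
    (hy' : (F (φ.symm y)).2 ∈ ψ.source) (hμ : IsUnitNormal f gt F μ) (i : Fin m) :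
    pairing (ambientMatrix f gt ψ) (localRep φ ψ F y)
      (components ψ (F (φ.symm y)) (μ (φ.symm y))) (velocity (localRep φ ψ F) i y) = 0 := by
  rw [← components_D_frame hφ hψ hy hF hy']
  exact (warped_eq_pairing f gt hψ hy' _ _).symm.trans (hμ.normal _ _)

/-- The tangential part of the second fundamental form does not contribute to its normal
component. -/
theorem scalarFF_eq_secondForm (hφ : φ ∈ atlas (EuclideanSpace ℝ (Fin m)) M)
    (hψ : ψ ∈ atlas (EuclideanSpace ℝ (Fin m)) M) (hy : y ∈ φ.target)
    (hF : MDifferentiableAt (𝓡 m) (𝓘(ℝ, ℝ).prod (𝓡 m)) F (φ.symm y))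
    (hy' : (F (φ.symm y)).2 ∈ ψ.source) (hμ : IsUnitNormal f gt F μ) (i j : Fin m) :
    scalarFF f gt φ ψ F μ y i j = secondForm (ambientMatrix f gt ψ) (localRep φ ψ F)
      (fun x => components ψ (F (φ.symm x)) (μ (φ.symm x))) i j y := by
  have h : secondFF f gt φ ψ F y i j
      = cov (ambientMatrix f gt ψ) (localRep φ ψ F) i (velocity (localRep φ ψ F) j) y
        - ∑ k, christoffel (inducedMatrix f gt φ F) k i j y • velocity (localRep φ ψ F) k y := by
    ext γ
    simp only [Pi.sub_apply, Finset.sum_apply, Pi.smul_apply, smul_eq_mul]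
    rfl
  rw [scalarFF, h, pairing_sub_left, pairing_sum_left, secondForm, sub_eq_self]
  refine Finset.sum_eq_zero fun k _ => ?_
  rw [pairing_smul_left, pairing_comm (ambientMatrix_isSymm f gt _),
    pairing_normal_velocity f gt hφ hψ hy hF hy' hμ, mul_zero]

theorem meanCurvature_eq_meanCurv (hφ : φ ∈ atlas (EuclideanSpace ℝ (Fin m)) M)
    (hψ : ψ ∈ atlas (EuclideanSpace ℝ (Fin m)) M) (hy : y ∈ φ.target)
    (hF : MDifferentiableAt (𝓡 m) (𝓘(ℝ, ℝ).prod (𝓡 m)) F (φ.symm y))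
    (hy' : (F (φ.symm y)).2 ∈ ψ.source) (hμ : IsUnitNormal f gt F μ) :
    meanCurvature f gt φ ψ F μ (φ.symm y) = meanCurv (ambientMatrix f gt ψ)
      (inducedMatrix f gt φ F) (localRep φ ψ F)
      (fun x => components ψ (F (φ.symm x)) (μ (φ.symm x))) y := by
  rw [meanCurvature, meanCurv, φ.right_inv hy]
  exact Finset.sum_congr rfl fun i _ => Finset.sum_congr rfl fun j _ => by
    rw [scalarFF_eq_secondForm f gt hφ hψ hy hF hy' hμ]

theorem normSqFF_eq_sum_secondForm (hφ : φ ∈ atlas (EuclideanSpace ℝ (Fin m)) M)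
    (hψ : ψ ∈ atlas (EuclideanSpace ℝ (Fin m)) M) (hy : y ∈ φ.target)
    (hF : MDifferentiableAt (𝓡 m) (𝓘(ℝ, ℝ).prod (𝓡 m)) F (φ.symm y))
    (hy' : (F (φ.symm y)).2 ∈ ψ.source) (hμ : IsUnitNormal f gt F μ) :
    normSqFF f gt φ ψ F μ (φ.symm y) = ∑ i, ∑ j, ∑ k, ∑ l,
      (inducedMatrix f gt φ F y)⁻¹ i k * (inducedMatrix f gt φ F y)⁻¹ j l
        * secondForm (ambientMatrix f gt ψ) (localRep φ ψ F)
            (fun x => components ψ (F (φ.symm x)) (μ (φ.symm x))) i j y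
        * secondForm (ambientMatrix f gt ψ) (localRep φ ψ F)
            (fun x => components ψ (F (φ.symm x)) (μ (φ.symm x))) k l y := by
  rw [normSqFF, φ.right_inv hy]
  exact Finset.sum_congr rfl fun i _ => Finset.sum_congr rfl fun j _ =>
    Finset.sum_congr rfl fun k _ => Finset.sum_congr rfl fun l _ => by
      rw [scalarFF_eq_secondForm f gt hφ hψ hy hF hy' hμ,
        scalarFF_eq_secondForm f gt hφ hψ hy hF hy' hμ]

theorem tangentialDeriv_eq_sum_velocity (hφ : φ ∈ atlas (EuclideanSpace ℝ (Fin m)) M)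
    (hψ : ψ ∈ atlas (EuclideanSpace ℝ (Fin m)) M) (hy : y ∈ φ.target)
    (hF : MDifferentiableAt (𝓡 m) (𝓘(ℝ, ℝ).prod (𝓡 m)) F (φ.symm y))
    (hy' : (F (φ.symm y)).2 ∈ ψ.source) (w : M → ℝ) :
    tangentialDeriv f gt φ F w (φ.symm y) = -∑ i, ∑ j, (inducedMatrix f gt φ F y)⁻¹ i j
      * velocity (localRep φ ψ F) i y 0 * pd j (fun x => w (φ.symm x)) y := by
  rw [tangentialDeriv, φ.right_inv hy, ← Finset.sum_neg_distrib]
  refine Finset.sum_congr rfl fun i _ => ?_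
  rw [← Finset.sum_neg_distrib]
  refine Finset.sum_congr rfl fun j _ => ?_
  rw [warped_dt, ← components_D_frame hφ hψ hy hF hy']
  change _ * -timePart _ _ * _ = -(_ * timePart _ _ * _)
  ring

theorem gradInner_eq_sum (hφ : φ ∈ atlas (EuclideanSpace ℝ (Fin m)) M) (hy : y ∈ φ.target)
    (hF : IsSpacelike f gt F) (w w' : M → ℝ) :
    gradInner f gt φ F w w' (φ.symm y) = ∑ i, ∑ j, (inducedMatrix f gt φ F y)⁻¹ i j
      * pd i (fun x => w (φ.symm x)) y * pd j (fun x => w' (φ.symm x)) y := by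
  rw [gradInner, φ.right_inv hy]
  exact pairing_grad_grad (inducedMatrix_isSymm f gt y)
    (inducedMatrix_det_ne_zero f gt hφ hy hF) _ _

theorem gradientFunction_eq_timePart (p : M) :
    gradientFunction f gt F μ p = timePart (F p) (μ p) := by
  rw [gradientFunction, warped_dt, neg_neg]

end Matching

/-! ### From the flow on the manifold to the flow in coordinates -/

section Flow

variable {m : ℕ} {M : Type*} [TopologicalSpace M] [ChartedSpace (EuclideanSpace ℝ (Fin m)) M]
  [IsManifold (𝓡 m) ∞ M]
  {φ ψ : OpenPartialHomeomorph M (EuclideanSpace ℝ (Fin m))} {f : ℝ → ℝ}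
  {gt : Bundle.ContMDiffRiemannianMetric (𝓡 m) ∞ (EuclideanSpace ℝ (Fin m))
    (fun x : M => TangentSpace (𝓡 m) x)}
  {𝓗 : M → ℝ} {T : ℝ} {F : ℝ → M → ℝ × M} {μ : (s : ℝ) → (p : M) → TN (m := m) (F s p)}
  {s : ℝ} {y : EuclideanSpace ℝ (Fin m)}

/-- The components in the coordinates of `ψ` of the unit normals `μ(s)`, as functions of the
coordinates of `φ`. -/
def normalComponents (φ ψ : OpenPartialHomeomorph M (EuclideanSpace ℝ (Fin m)))
    (μ : (s : ℝ) → (p : M) → TN (m := m) (F s p)) (s : ℝ) (y : EuclideanSpace ℝ (Fin m)) :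
    Fin (m + 1) → ℝ :=
  components ψ (F s (φ.symm y)) (μ s (φ.symm y))

theorem IsSpatiallyC3.exists_ball_mem_source (hF : IsSpatiallyC3 (m := m) T F)
    (hs : s ∈ Set.Icc 0 T) (hy : y ∈ φ.target) (hy' : (F s (φ.symm y)).2 ∈ ψ.source) :
    ∃ ε > 0, Metric.ball y ε ⊆ φ.target ∧ ∀ σ ∈ Set.Icc 0 T ∩ Metric.ball s ε,
      ∀ x ∈ Metric.ball y ε, (F σ (φ.symm x)).2 ∈ ψ.source := by
  have hc : ContinuousOn (fun q : ℝ × EuclideanSpace ℝ (Fin m) => (F q.1 (φ.symm q.2)).2)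
      (Set.Icc 0 T ×ˢ φ.target) := by
    refine continuous_snd.comp_continuousOn (hF.continuousOn.comp
      (f := fun q : ℝ × EuclideanSpace ℝ (Fin m) => (q.1, φ.symm q.2)) ?_ fun q hq =>
        ⟨hq.1, trivial⟩)
    exact continuousOn_fst.prodMk (φ.continuousOn_symm.comp continuousOn_snd fun q hq => hq.2)
  have hmem := (hc (s, y) ⟨hs, hy⟩).preimage_mem_nhdsWithin (ψ.open_source.mem_nhds hy')
  obtain ⟨δ, hδ, h1⟩ := Metric.mem_nhdsWithin_iff.1 hmem
  obtain ⟨η, hη, h2⟩ := Metric.isOpen_iff.1 φ.open_target y hy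
  refine ⟨min δ η, lt_min hδ hη, (Metric.ball_subset_ball (min_le_right _ _)).trans h2,
    fun σ hσ x hx => ?_⟩
  have hx' := h2 (Metric.ball_subset_ball (min_le_right _ _) hx)
  refine h1 (a := (σ, x)) ⟨?_, hσ.1, hx'⟩
  rw [← ball_prod_same]
  exact ⟨Metric.ball_subset_ball (min_le_left _ _) hσ.2,
    Metric.ball_subset_ball (min_le_left _ _) hx⟩

/-- Near a given time `s` and point, a prescribed mean curvature flow is one in coordinates. The times
are restricted to a ball around `s`, so that `F` stays in the domain of `ψ`; at the ends of `[0, T]`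
they form a one-sided neighbourhood. -/
theorem IsPrescribedMCF.exists_isLocalFlow (hT : 0 < T) (h𝓗 : ContMDiff (𝓡 m) 𝓘(ℝ, ℝ) 1 𝓗)
    (hflow : IsPrescribedMCF f gt 𝓗 T F μ)
    (hφ : φ ∈ atlas (EuclideanSpace ℝ (Fin m)) M) (hψ : ψ ∈ atlas (EuclideanSpace ℝ (Fin m)) M)
    (hs : s ∈ Set.Icc 0 T) (hy : y ∈ φ.target) (hy' : (F s (φ.symm y)).2 ∈ ψ.source) :
    ∃ ε > 0, IsLocalFlow {z | spaceCoord z ∈ ψ.target} (ambientMatrix f gt ψ)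
      (Set.Icc 0 T ∩ Metric.ball s ε) (Metric.ball y ε) (fun σ => inducedMatrix f gt φ (F σ))
      (fun σ => localRep φ ψ (F σ)) (normalComponents φ ψ μ) (fun x => 𝓗 (φ.symm x)) := by
  obtain ⟨ε, hε, htarget, hsource⟩ := hflow.regular.exists_ball_mem_source hs hy hy'
  have hd : ∀ σ ∈ Set.Icc 0 T ∩ Metric.ball s ε, ∀ q,
      MDifferentiableAt (𝓡 m) (𝓘(ℝ, ℝ).prod (𝓡 m)) (F σ) q := fun σ hσ q =>
    (hflow.regular.contMDiff σ hσ.1 q).mdifferentiableAt (by norm_num)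
  have hC : ∀ σ ∈ Set.Icc 0 T ∩ Metric.ball s ε, ∀ x ∈ Metric.ball y ε, ∀ α,
      ContDiffAt ℝ 3 (fun x => localRep φ ψ (F σ) x α) x := fun σ hσ x hx α =>
    contDiffAt_localRep (k := 3) hφ hψ (htarget hx) (hflow.regular.contMDiff σ hσ.1 _)
      (hsource σ hσ x hx) α
  have hZ : ∀ σ ∈ Set.Icc 0 T ∩ Metric.ball s ε, ∀ x ∈ Metric.ball y ε,
      ContDiffAt ℝ 3 (localRep φ ψ (F σ)) x := fun σ hσ x hx => coord_contDiffAt (hC σ hσ x hx)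
  have hcont : ∀ k : ℕ, k ≤ 3 → ContinuousOn (fun q : ℝ × EuclideanSpace ℝ (Fin m) =>
      iteratedFDeriv ℝ k (localRep φ ψ (F q.1)) q.2)
      ((Set.Icc 0 T ∩ Metric.ball s ε) ×ˢ Metric.ball y ε) := fun k hk =>
    (hflow.regular.continuousOn_deriv φ hφ ψ hψ k hk).mono fun q hq =>
      ⟨hq.1.1, htarget hq.2, hsource q.1 hq.1 q.2 hq.2⟩
  refine ⟨ε, hε, ?_⟩
  exact
  { isOpen := Metric.isOpen_ball
    convex := (convex_Icc 0 T).inter (convex_ball s ε)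
    uniqueDiffOn := (uniqueDiffOn_Icc hT).inter Metric.isOpen_ball
    mem := fun σ hσ x hx => ψ.map_source (hsource σ hσ x hx)
    contDiffAt := hC
    continuousOn := fun α =>
      continuousOn_iteratedFDeriv_apply (Z := fun σ => localRep φ ψ (F σ))
        (hcont 0 (by norm_num)) 0 α
    continuousOn_velocity := fun i α =>
      (continuousOn_iteratedFDeriv_apply (Z := fun σ => localRep φ ψ (F σ))
        (hcont 1 (by norm_num)) _ α).congr fun q hq =>
        velocity_eq_iteratedFDeriv ((hZ q.1 hq.1 q.2 hq.2).of_le (by norm_num)) i α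
    continuousOn_pd_velocity := fun j i α =>
      (continuousOn_iteratedFDeriv_apply (Z := fun σ => localRep φ ψ (F σ))
        (hcont 2 (by norm_num)) _ α).congr fun q hq =>
        pd_velocity_eq_iteratedFDeriv ((hZ q.1 hq.1 q.2 hq.2).of_le (by norm_num)) j i α
    continuousOn_pd_pd_velocity := fun k j i α =>
      (continuousOn_iteratedFDeriv_apply (Z := fun σ => localRep φ ψ (F σ))
        (hcont 3 le_rfl) _ α).congr fun q hq =>
        pd_pd_velocity_eq_iteratedFDeriv (hZ q.1 hq.1 q.2 hq.2) k j i α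
    symm := fun σ _ x => inducedMatrix_isSymm f gt x
    apply := fun σ hσ x hx => inducedMatrix_apply f gt hφ hψ (htarget hx) (hd σ hσ _)
      (hsource σ hσ x hx)
    det_ne_zero := fun σ hσ x hx =>
      inducedMatrix_det_ne_zero f gt hφ (htarget hx) (hflow.spacelike σ hσ.1)
    normal := fun σ hσ x hx => pairing_normal_velocity f gt hφ hψ (htarget hx) (hd σ hσ _)
      (hsource σ hσ x hx) (hflow.unitNormal σ hσ.1)
    unit := fun σ hσ x hx => (warped_eq_pairing f gt hψ (hsource σ hσ x hx) _ _).symm.trans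
      ((hflow.unitNormal σ hσ.1).unit _)
    future := fun σ hσ x _ => by
      have h := (hflow.unitNormal σ hσ.1).future (φ.symm x)
      rw [warped_dt, neg_neg] at h
      exact h
    prescribed_contDiffAt := fun x hx => ((h𝓗 (φ.symm x)).comp x
      ((contMDiffAt_chart_symm hφ (htarget hx)).of_le (by simp))).contDiffAt
    flow := fun σ hσ x hx α => by
      have h := hasDerivWithinAt_chartN hψ (hflow.flow σ hσ.1 (φ.symm x) φ hφ ψ hψ
        (φ.map_target (htarget hx)) (hsource σ hσ x hx)) (hsource σ hσ x hx) α
      rw [components_smul, meanCurvature_eq_meanCurv f gt hφ hψ (htarget hx) (hd σ hσ _)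
        (hsource σ hσ x hx) (hflow.unitNormal σ hσ.1)] at h
      exact h.mono Set.inter_subset_left }

theorem gradientFunction_eq_normalComponents (s : ℝ) (y : EuclideanSpace ℝ (Fin m)) :
    gradientFunction f gt (F s) (μ s) (φ.symm y) = normalComponents φ ψ μ s y 0 :=
  gradientFunction_eq_timePart f gt _

theorem IsPrescribedMCF.contDiffAt_gradientFunction (hf : ContDiff ℝ ∞ f) (hf_pos : ∀ t, 0 < f t)
    (hT : 0 < T) (h𝓗 : ContMDiff (𝓡 m) 𝓘(ℝ, ℝ) 1 𝓗) (hflow : IsPrescribedMCF f gt 𝓗 T F μ)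
    (hφ : φ ∈ atlas (EuclideanSpace ℝ (Fin m)) M) (hψ : ψ ∈ atlas (EuclideanSpace ℝ (Fin m)) M)
    (hs : s ∈ Set.Icc 0 T) (hy : y ∈ φ.target) (hy' : (F s (φ.symm y)).2 ∈ ψ.source) :
    ContDiffAt ℝ 2 (fun x => gradientFunction f gt (F s) (μ s) (φ.symm x)) y := by
  obtain ⟨ε, hε, hL⟩ := hflow.exists_isLocalFlow hT h𝓗 hφ hψ hs hy hy'
  simp only [gradientFunction_eq_normalComponents (ψ := ψ)]
  exact hL.contDiffAt_normal (isWarpedChart_ambientMatrix f gt hf hf_pos hψ)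
    ⟨hs, Metric.mem_ball_self hε⟩ (Metric.mem_ball_self hε) 0

/-- The evolution equation of the gradient function at the point with coordinates `y`. -/
theorem IsPrescribedMCF.evolution (hf : ContDiff ℝ ∞ f) (hf_pos : ∀ t, 0 < f t)
    (hT : 0 < T) (h𝓗 : ContMDiff (𝓡 m) 𝓘(ℝ, ℝ) 1 𝓗) (hflow : IsPrescribedMCF f gt 𝓗 T F μ)
    (hφ : φ ∈ atlas (EuclideanSpace ℝ (Fin m)) M) (hψ : ψ ∈ atlas (EuclideanSpace ℝ (Fin m)) M)
    (hs : s ∈ Set.Icc 0 T) (hy : y ∈ φ.target) (hy' : (F s (φ.symm y)).2 ∈ ψ.source)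
    {p : M} (hp : p = φ.symm y) {u v : ℝ → M → ℝ} (hu : u = fun σ q => (F σ q).1)
    (hv : v = fun σ q => gradientFunction f gt (F σ) (μ σ) q) :
    ∃ v' : ℝ, HasDerivWithinAt (fun σ => v σ p) v' (Set.Icc 0 T) s ∧
      v' + laplacianM f gt φ (F s) (v s) p
        = - normSqFF f gt φ ψ (F s) (μ s) p * v s p
          - ricciN f gt ψ (F s p) (μ s p) (μ s p) * v s p
          - 2 * (deriv f (u s p) / f (u s p)) * meanCurvature f gt φ ψ (F s) (μ s) p
          + deriv f (u s p) / f (u s p) * 𝓗 p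
          - tangentialDeriv f gt φ (F s) 𝓗 p
          - deriv f (u s p) / f (u s p) * 𝓗 p * v s p ^ 2
          + 2 * (deriv f (u s p) / f (u s p)) * gradInner f gt φ (F s) (u s) (v s) p
          - m * (deriv (deriv f) (u s p) / f (u s p)) * v s p
          - (deriv f (u s p) / f (u s p)) ^ 2 * gradInner f gt φ (F s) (u s) (u s) p * v s p
          + deriv (deriv f) (u s p) / f (u s p)
              * gradInner f gt φ (F s) (u s) (u s) p * v s p
          - m * (deriv f (u s p) / f (u s p)) ^ 2 * v s p := by
  subst hp hu hv
  obtain ⟨ε, hε, hL⟩ := hflow.exists_isLocalFlow hT h𝓗 hφ hψ hs hy hy'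
  obtain ⟨v', hv', h⟩ := hL.evolution (isWarpedChart_ambientMatrix f gt hf hf_pos hψ)
    ⟨hs, Metric.mem_ball_self hε⟩ (Metric.mem_ball_self hε)
  have hd : MDifferentiableAt (𝓡 m) (𝓘(ℝ, ℝ).prod (𝓡 m)) (F s) (φ.symm y) :=
    (hflow.regular.contMDiff s hs _).mdifferentiableAt (by norm_num)
  have hμ := hflow.unitNormal s hs
  refine ⟨v', ?_, ?_⟩
  · simp only [gradientFunction_eq_normalComponents (ψ := ψ)]
    exact hv'.mono_of_mem_nhdsWithin
      (Filter.inter_mem self_mem_nhdsWithin (mem_nhdsWithin_of_mem_nhds (Metric.ball_mem_nhds s hε)))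
  · rw [normSqFF_eq_sum_secondForm f gt hφ hψ hy hd hy' hμ,
      meanCurvature_eq_meanCurv f gt hφ hψ hy hd hy' hμ,
      tangentialDeriv_eq_sum_velocity f gt hφ hψ hy hd hy',
      gradInner_eq_sum f gt hφ hy (hflow.spacelike s hs),
      gradInner_eq_sum f gt hφ hy (hflow.spacelike s hs), laplacianM, φ.right_inv hy,
      sub_neg_eq_add]
    simp only [gradientFunction_eq_normalComponents (ψ := ψ)]
    exact h

end Flow

end GRW

theorem mainTheorem6 (m : ℕ) {M : Type*} [TopologicalSpace M]
    [ChartedSpace (EuclideanSpace ℝ (Fin m)) M] [IsManifold (𝓡 m) ∞ M]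
    (gt : Bundle.ContMDiffRiemannianMetric (𝓡 m) ∞ (EuclideanSpace ℝ (Fin m))
      (fun x : M => TangentSpace (𝓡 m) x))
    (f : ℝ → ℝ) (hf : ContDiff ℝ ∞ f) (hf_pos : ∀ t, 0 < f t)
    (𝓗 : M → ℝ) (h𝓗 : ContMDiff (𝓡 m) 𝓘(ℝ, ℝ) 1 𝓗)
    (T : ℝ) (hT : 0 < T) (F : ℝ → M → ℝ × M)
    (μ : (s : ℝ) → (p : M) → GRW.TN (m := m) (F s p))
    (hflow : GRW.IsPrescribedMCF f gt 𝓗 T F μ)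
    (u v : ℝ → M → ℝ) (hu : ∀ s p, u s p = (F s p).1)
    (hv : ∀ s p, v s p = GRW.gradientFunction f gt (F s) (μ s) p)
    (s : ℝ) (hs : s ∈ Set.Icc 0 T) :
    ContMDiff (𝓡 m) 𝓘(ℝ, ℝ) 2 (v s) ∧
    ∀ p : M, DifferentiableWithinAt ℝ (fun σ => v σ p) (Set.Icc 0 T) s ∧
      ∀ φ ∈ atlas (EuclideanSpace ℝ (Fin m)) M, ∀ ψ ∈ atlas (EuclideanSpace ℝ (Fin m)) M,
        p ∈ φ.source → (F s p).2 ∈ ψ.source →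
        derivWithin (fun σ => v σ p) (Set.Icc 0 T) s + GRW.laplacianM f gt φ (F s) (v s) p
          = - GRW.normSqFF f gt φ ψ (F s) (μ s) p * v s p
            - GRW.ricciN f gt ψ (F s p) (μ s p) (μ s p) * v s p
            - 2 * (deriv f (u s p) / f (u s p)) * GRW.meanCurvature f gt φ ψ (F s) (μ s) p
            + deriv f (u s p) / f (u s p) * 𝓗 p
            - GRW.tangentialDeriv f gt φ (F s) 𝓗 p
            - deriv f (u s p) / f (u s p) * 𝓗 p * v s p ^ 2
            + 2 * (deriv f (u s p) / f (u s p)) * GRW.gradInner f gt φ (F s) (u s) (v s) p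
            - m * (deriv (deriv f) (u s p) / f (u s p)) * v s p
            - (deriv f (u s p) / f (u s p)) ^ 2
                * GRW.gradInner f gt φ (F s) (u s) (u s) p * v s p
            + deriv (deriv f) (u s p) / f (u s p)
                * GRW.gradInner f gt φ (F s) (u s) (u s) p * v s p
            - m * (deriv f (u s p) / f (u s p)) ^ 2 * v s p := by
  refine ⟨fun p => ?_, fun p => ?_⟩
  · have hφ := chart_mem_atlas (EuclideanSpace ℝ (Fin m)) p
    have hp := mem_chart_source (EuclideanSpace ℝ (Fin m)) p
    have hy := (chartAt (EuclideanSpace ℝ (Fin m)) p).map_source hp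
    have hleft := (chartAt (EuclideanSpace ℝ (Fin m)) p).left_inv hp
    have h := hflow.contDiffAt_gradientFunction hf hf_pos hT h𝓗 hφ
      (chart_mem_atlas (EuclideanSpace ℝ (Fin m)) (F s p).2) hs hy
      (by rw [hleft]; exact mem_chart_source _ _)
    have h1 := h.contMDiffAt.comp p ((GRW.contMDiffAt_chart hφ hp).of_le (by norm_cast))
    refine h1.congr_of_eventuallyEq ?_
    filter_upwards [(chartAt (EuclideanSpace ℝ (Fin m)) p).open_source.mem_nhds hp] with q hq
    simp only [Function.comp, (chartAt (EuclideanSpace ℝ (Fin m)) p).left_inv hq, hv]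
  · have hevol : ∀ φ ∈ atlas (EuclideanSpace ℝ (Fin m)) M,
        ∀ ψ ∈ atlas (EuclideanSpace ℝ (Fin m)) M, p ∈ φ.source → (F s p).2 ∈ ψ.source → _ :=
      fun φ hφ ψ hψ hp hp' => hflow.evolution hf hf_pos hT h𝓗 hφ hψ hs (φ.map_source hp)
        (by rwa [φ.left_inv hp]) (φ.left_inv hp).symm (funext fun σ => funext fun q => hu σ q)
        (funext fun σ => funext fun q => hv σ q)
    refine ⟨?_, fun φ hφ ψ hψ hp hp' => ?_⟩
    · obtain ⟨v', h, -⟩ := hevol _ (chart_mem_atlas (EuclideanSpace ℝ (Fin m)) p) _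
        (chart_mem_atlas (EuclideanSpace ℝ (Fin m)) (F s p).2) (mem_chart_source _ _)
        (mem_chart_source _ _)
      exact h.differentiableWithinAt
    · obtain ⟨v', h, h'⟩ := hevol φ hφ ψ hψ hp hp'
      rw [h.derivWithin (uniqueDiffOn_Icc hT s hs)]
      exact h'
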